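/- **Setting.** A *planar complex* $\mathcal K$ is a finite piecewise Euclidean complex of dimension at most 2 whose 2-cells are Euclidean triangles and whose 1-skeleton has a planar drawing in which the inner faces are exactly the 2-cells. It carries its intrinsic metric $d$ (the infimum of the lengths of paths $x_0,\dots,x_k$ whose consecutive points lie in a common cell, measured there by the Euclidean distance), and it is a *CAT(0) planar complex* if $(\mathcal K,d)$ is a CAT(0) space. Then $\gamma(a,b)$ denotes the unique geodesic joining $a$ and $b$, $\partial\mathcal K$ the boundary of $\mathcal K$ (the points on the frontier of the drawn complex; the other points are *inner*), and $\theta(v)$ the sum of the angles at a vertex $v$ of the 2-cells containing $v$. A set is *convex* if it contains $\gamma(r,s)$ for all of its points $r,s$. The *inner angle* at $u$ of a set $S$ between $\gamma(u,a)$ and $\gamma(u,b)$ is the least total angle of a fan of triangles with apex $u$, each lying in a cell and in $S$, leading from the direction of $\gamma(u,a)$ to that of $\gamma(u,b)$ (it may exceed $\pi$, and it is $\infty$ if there is no such fan). A *cone* $\mathcal C(z;p,q)$ with apex $z\in\mathcal K$ and $p,q\in\partial\mathcal K$ consists of its *sides* $\gamma(z,p)$, $\gamma(z,q)$ and of a connected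 component $R$ of $\mathcal K\setminus(\gamma(z,p)\cup\gamma(z,q))$ whose closure contains both sides, such that the inner angle of the cone at $z$ between its sides is positive and finite (it is not required to be less than $\pi$). Its *interior* is $\mathcal C(z;p,q)\setminus(\gamma(z,p)\cup\gamma(z,q))=R$. A point $y$ lies on a *common side* of two cones if it lies on a side of the one and on a side of the other, and these two sides overlap in a nondegenerate geodesic segment containing $y$. Let $x\in\mathcal K$. A *shortest path map* $\mathrm{SPM}(x)$ is a finite family of cones with pairwise disjoint interiors that covers $\mathcal K$, such that, calling $\gamma(x,p)$ a geodesic of the map whenever $p$ is an endpoint of a side $\gamma(z,p)$ of one of its cones: 1. every vertex of $\mathcal K$ lies on a geodesic of the map; a vertex $y$ with $\theta(y)=2\pi$ lies on a common side of two distinct cones of the map; a vertex $y$ with $\theta(y)>2\pi$ is the apex of at least one cone of the map; 2. the apex $z$ of each cone $\mathcal C(z;p,q)$ of the map belongs to $\gamma(x,p)$ and to $\gamma(x,q)$. **Proposition.** Let $\mathcal K$ be a CAT(0) planar complex, $x$ a point of $\mathcal K$, and $\mathrm{SPM}(x)$ a shortest path map of origin $x$. Then: (i) $\mathrm{SPM}(x)$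 is a geodesic tree: its geodesics $\gamma(x,p)$ are finitely many, they end on $\partial\mathcal K$, the intersection of any two different ones is $\gamma(x,w)$ where $w$ is a vertex of $\mathcal K$ or $w=x$, and their union is the union of the sides of all cones; (ii) the inner angle of each cone $\mathcal C(z;p,q)$ at $z$ between its sides is less than $\pi$; (iii) each cone is a convex subset of $\mathcal K$; (iv) the interior of a cone contains no vertex of $\mathcal K$; (v) every inner point of $\mathcal K$ either lies in the interior of one cone and in no other cone, or lies on a common side of two distinct cones; (vi) for every point $u\ne z,p$ of a side $\gamma(z,p)$ of a cone, the inner angle of the cone at $u$ between $\gamma(u,z)$ and $\gamma(u,p)$ is finite and at least $\pi$. -/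

import Mathlib

open Set

/-- A finite piecewise Euclidean complex with triangular 2-cells: a finite simplicial complex of
dimension at most two on the vertex set `V`, with a length for every edge, such that the three
lengths of every 2-cell satisfy the strict triangle inequalities. -/
structure TriComplex (V : Type*) [Fintype V] [DecidableEq V] where
  /-- the cells, each given by its set of vertices -/
  faces : Set (Finset V)
  nonempty_of_mem : ∀ f ∈ faces, f.Nonempty
  card_le_three : ∀ f ∈ faces, f.card ≤ 3
  vertex_mem : ∀ v : V, {v} ∈ faces
  down_closed : ∀ f ∈ faces, ∀ g : Finset V, g ⊆ f → g.Nonempty → g ∈ faces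
  /-- the length of an edge; only the values at the edges matter -/
  len : V → V → ℝ
  len_self : ∀ v, len v v = 0
  len_symm : ∀ a b, len a b = len b a
  len_pos : ∀ a b, a ≠ b → {a, b} ∈ faces → 0 < len a b
  len_triangle : ∀ a b c, a ≠ b → b ≠ c → a ≠ c → {a, b, c} ∈ faces →
    len a c < len a b + len b c

namespace TriComplex

variable {V : Type*} [Fintype V] [DecidableEq V] (K : TriComplex V)

/-- The closed simplex spanned by `f`, in barycentric coordinates. -/
def cell (f : Finset V) : Set (V → ℝ) :=
  {x | (∀ v, 0 ≤ x v) ∧ ∑ v, x v = 1 ∧ ∀ v, v ∉ f → x v = 0}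

/-- The open simplex spanned by `f`. -/
def openCell (f : Finset V) : Set (V → ℝ) :=
  {x | x ∈ cell f ∧ ∀ v ∈ f, 0 < x v}

/-- The point of the complex given by the vertex `v`. -/
def vertexPoint (v : V) : V → ℝ := Pi.single v 1

/-- The point set of the complex (with the topology of `V → ℝ`). -/
def space : Set (V → ℝ) := {x | ∃ f ∈ K.faces, x ∈ cell f}

/-- The point set of the 1-skeleton. -/
def skeleton : Set (V → ℝ) := {x | ∃ f ∈ K.faces, f.card ≤ 2 ∧ x ∈ cell f}

/-- The Euclidean inner product of two vectors that are parallel to a common cell. If the vertices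
`i` of the cell are realised by points `Pᵢ` of the plane with `|Pᵢ - Pⱼ| = len i j`, and the
coordinates of `a` and of `b` have sum zero, then this is the inner product of
`∑ aᵢ Pᵢ` and `∑ bⱼ Pⱼ`. -/
noncomputable def cellInner (a b : V → ℝ) : ℝ :=
  -(1 / 2) * ∑ i, ∑ j, (K.len i j) ^ 2 * a i * b j

/-- The Euclidean distance of two points of a common cell. -/
noncomputable def cellDist (a b : V → ℝ) : ℝ := Real.sqrt (K.cellInner (a - b) (a - b))

/-- The Euclidean angle at `u` between `a` and `b`, for three points of a common cell. -/
noncomputable def cellAngle (u a b : V → ℝ) : ℝ :=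
  Real.arccos (K.cellInner (a - u) (b - u) / (K.cellDist u a * K.cellDist u b))

open Classical in
/-- `θ(v)`: the sum of the angles at `v` of the 2-cells that contain `v`. Every 2-cell
`{v, a, b}` occurs twice in the double sum, once for each order of `a` and `b`. -/
noncomputable def theta (v : V) : ℝ :=
  (1 / 2) * ∑ a, ∑ b, if v ≠ a ∧ v ≠ b ∧ a ≠ b ∧ {v, a, b} ∈ K.faces then
    K.cellAngle (vertexPoint v) (vertexPoint a) (vertexPoint b) else 0

/-- `w 0, …, w n` is a path from `a` to `b`: consecutive points lie in a common cell. -/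
def IsPath (a b : V → ℝ) (n : ℕ) (w : ℕ → V → ℝ) : Prop :=
  w 0 = a ∧ w n = b ∧ ∀ i < n, ∃ f ∈ K.faces, w i ∈ cell f ∧ w (i + 1) ∈ cell f

/-- The intrinsic metric: the infimum of the lengths of the paths from `a` to `b`. -/
noncomputable def intrinsicDist (a b : V → ℝ) : ℝ :=
  sInf {L | ∃ n w, K.IsPath a b n w ∧ L = ∑ i ∈ Finset.range n, K.cellDist (w i) (w (i + 1))}

/-- `S` is a geodesic joining `a` and `b`: the image of an isometric map from a segment. -/
def IsGeodesic (a b : V → ℝ) (S : Set (V → ℝ)) : Prop :=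
  ∃ (l : ℝ) (g : ℝ → V → ℝ), 0 ≤ l ∧ g 0 = a ∧ g l = b ∧
    (∀ t ∈ Icc 0 l, g t ∈ K.space) ∧
    (∀ t ∈ Icc 0 l, ∀ t' ∈ Icc 0 l, K.intrinsicDist (g t) (g t') = |t - t'|) ∧
    S = g '' Icc 0 l

/-- `γ(a, b)`: the set of the points that lie on a geodesic joining `a` and `b` (in a CAT(0)
complex there is exactly one such geodesic). -/
def geod (a b : V → ℝ) : Set (V → ℝ) := {y | ∃ S, K.IsGeodesic a b S ∧ y ∈ S}

/-- With its intrinsic metric the complex is a CAT(0) space: it is a geodesic space, and its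
geodesic triangles satisfy the comparison axiom. -/
def IsCAT0 : Prop :=
  (∀ a ∈ K.space, ∀ b ∈ K.space, ∃ S, K.IsGeodesic a b S) ∧
  ∀ x₁ ∈ K.space, ∀ x₂ ∈ K.space, ∀ x₃ ∈ K.space, x₁ ≠ x₂ → x₂ ≠ x₃ → x₁ ≠ x₃ →
    ∀ S, K.IsGeodesic x₁ x₂ S → ∀ y ∈ S,
    ∀ x₁' x₂' x₃' y' : EuclideanSpace ℝ (Fin 2),
      dist x₁' x₂' = K.intrinsicDist x₁ x₂ → dist x₂' x₃' = K.intrinsicDist x₂ x₃ →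
      dist x₁' x₃' = K.intrinsicDist x₁ x₃ → y' ∈ segment ℝ x₁' x₂' →
      dist x₁' y' = K.intrinsicDist x₁ y → dist x₂' y' = K.intrinsicDist x₂ y →
      K.intrinsicDist x₃ y ≤ dist x₃' y'

/-- A subset is convex if it contains the geodesics between its points. -/
def GeodConvex (S : Set (V → ℝ)) : Prop := ∀ r ∈ S, ∀ s ∈ S, K.geod r s ⊆ S

/-- `w 0, …, w n` is a fan at `u` inside `S` from the direction of `a` to the direction of `b`:
it starts on `γ(u, a)`, ends on `γ(u, b)`, and `u` and any two consecutive points span a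
triangle that is contained in a cell and in `S` and has an angle less than `π` at `u`. -/
def IsFan (S : Set (V → ℝ)) (u a b : V → ℝ) (n : ℕ) (w : ℕ → V → ℝ) : Prop :=
  w 0 ∈ K.geod u a ∧ w n ∈ K.geod u b ∧ (∀ i ≤ n, w i ≠ u) ∧
  ∀ i < n, (∃ f ∈ K.faces, u ∈ cell f ∧ w i ∈ cell f ∧ w (i + 1) ∈ cell f) ∧
    convexHull ℝ {u, w i, w (i + 1)} ⊆ S ∧ K.cellAngle u (w i) (w (i + 1)) < Real.pi

/-- The angle at `u` between `γ(u, a)` and `γ(u, b)` measured inside `S`: the least total angle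
of a fan inside `S`. It is not truncated at `π`, and it is `⊤` if there is no fan. -/
noncomputable def innerAngle (S : Set (V → ℝ)) (u a b : V → ℝ) : ENNReal :=
  ⨅ (n : ℕ) (w : ℕ → V → ℝ) (_ : K.IsFan S u a b n w),
    ENNReal.ofReal (∑ i ∈ Finset.range n, K.cellAngle u (w i) (w (i + 1)))

/-- The map to the plane that is affine on the cells and sends the vertex `v` to `pos v`. -/
noncomputable def draw (pos : V → EuclideanSpace ℝ (Fin 2)) (x : V → ℝ) :
    EuclideanSpace ℝ (Fin 2) := ∑ v, x v • pos v

end TriComplex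

/-- A planar complex: the complex is drawn in the plane without crossings, and the inner faces of
the drawing of the 1-skeleton (the bounded components of its complement) are exactly the drawings
of the open 2-cells. The drawing has straight edges, which is no restriction for a finite simple
plane graph, by Fáry's theorem; the lengths in the drawing have nothing to do with `len`. -/
structure PlanarComplex (V : Type*) [Fintype V] [DecidableEq V] extends TriComplex V where
  pos : V → EuclideanSpace ℝ (Fin 2)
  draw_injOn : InjOn (TriComplex.draw pos) toTriComplex.space
  inner_faces : ∀ U : Set (EuclideanSpace ℝ (Fin 2)),
    ((∃ y ∈ (TriComplex.draw pos '' toTriComplex.skeleton)ᶜ,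
        U = connectedComponentIn (TriComplex.draw pos '' toTriComplex.skeleton)ᶜ y) ∧
      Bornology.IsBounded U) ↔
    ∃ f ∈ faces, f.card = 3 ∧ U = TriComplex.draw pos '' TriComplex.openCell f

/-- The data of a cone `C(z; p, q)`: the apex `z`, the endpoints `p`, `q` of its two sides, and the
region that the sides bound. -/
structure Cone (V : Type*) where
  apex : V → ℝ
  left : V → ℝ
  right : V → ℝ
  region : Set (V → ℝ)

namespace Cone

/-- The endpoints of the two sides. -/
def ends {V : Type*} (c : Cone V) : Set (V → ℝ) := {c.left, c.right}

end Cone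

namespace PlanarComplex

variable {V : Type*} [Fintype V] [DecidableEq V] (K : PlanarComplex V)

/-- `∂K`: the points of `K` that are drawn on the frontier of the drawing. -/
def boundary : Set (V → ℝ) :=
  {x | x ∈ K.space ∧ TriComplex.draw K.pos x ∈ frontier (TriComplex.draw K.pos '' K.space)}

/-- The union of the two sides of a cone. -/
def sides (c : Cone V) : Set (V → ℝ) := K.geod c.apex c.left ∪ K.geod c.apex c.right

/-- The point set of a cone. -/
def carrier (c : Cone V) : Set (V → ℝ) := c.region ∪ K.sides c

/-- The interior of a cone: the cone without its sides. -/
def coneInterior (c : Cone V) : Set (V → ℝ) := K.carrier c \ K.sides c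

/-- The angle at the apex between the two sides, inside the cone. -/
noncomputable def apexAngle (c : Cone V) : ENNReal :=
  K.innerAngle (K.carrier c) c.apex c.left c.right

/-- `c` is a cone: the sides are geodesics from the apex to the boundary of `K`, the region is a
connected component of the complement of the sides, it is bounded by both sides (they lie in its
closure), and it contains an angle `α` formed by the sides at the apex, where `0 < α < ∞`.
The bound `α < π` is deliberately not built in. -/
def IsCone (c : Cone V) : Prop :=
  c.apex ∈ K.space ∧ c.left ∈ K.boundary ∧ c.right ∈ K.boundary ∧
  (∃ y ∈ K.space \ K.sides c, c.region = connectedComponentIn (K.space \ K.sides c) y) ∧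
  K.sides c ⊆ closure c.region ∧
  0 < K.apexAngle c ∧ K.apexAngle c < ⊤

/-- `y` lies on a common side of the cones `c` and `c'`: it lies on a side of `c` and on a side of
`c'` that overlap in a nondegenerate geodesic segment containing `y`. -/
def OnCommonSide (c c' : Cone V) (y : V → ℝ) : Prop :=
  ∃ p ∈ c.ends, ∃ p' ∈ c'.ends, ∃ y', y' ≠ y ∧ K.geod y y' ⊆ K.geod c.apex p ∩ K.geod c'.apex p' ∧
    y ∈ K.geod c.apex p ∩ K.geod c'.apex p' ∧ y' ∈ K.geod c.apex p ∩ K.geod c'.apex p'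

/-- The endpoints of all sides of the cones of a family. -/
def allEnds {ι : Type*} (C : ι → Cone V) : Set (V → ℝ) := ⋃ i, (C i).ends

/-- The (finite) family `C` of cones is a shortest path map of origin `x`. Its geodesics are the
`γ(x, p)`, for `p` an endpoint of a side of one of the cones. -/
structure IsSPM {ι : Type*} (x : V → ℝ) (C : ι → Cone V) : Prop where
  finite : Finite ι
  isCone : ∀ i, K.IsCone (C i)
  /-- the cones cover `K` -/
  cover : ⋃ i, K.carrier (C i) = K.space
  /-- distinct cones have disjoint interiors -/
  disjoint : ∀ i j, i ≠ j → Disjoint (K.coneInterior (C i)) (K.coneInterior (C j))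
  /-- every vertex lies on a geodesic of the map -/
  through_vertex : ∀ v : V, ∃ p ∈ allEnds C, TriComplex.vertexPoint v ∈ K.geod x p
  flat_vertex : ∀ v : V, K.theta v = 2 * Real.pi →
    ∃ i j, i ≠ j ∧ K.OnCommonSide (C i) (C j) (TriComplex.vertexPoint v)
  negative_vertex : ∀ v : V, 2 * Real.pi < K.theta v →
    ∃ i, (C i).apex = TriComplex.vertexPoint v
  /-- the apex of a cone lies on the geodesics from `x` to the endpoints of its sides -/
  apex_mem : ∀ i, ∀ p ∈ (C i).ends, (C i).apex ∈ K.geod x p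

/-- The geodesics `γ(x, p)`, `p ∈ P`, form a geodesic tree: they are finitely many, they end on
the boundary, and any two of them intersect in a geodesic from `x` to a vertex of `K`, where the
root `x` itself counts as a vertex. -/
def IsGeodesicTree (x : V → ℝ) (P : Set (V → ℝ)) : Prop :=
  P.Finite ∧ P ⊆ K.boundary ∧
  ∀ p ∈ P, ∀ q ∈ P, p ≠ q → ∃ w, (w = x ∨ ∃ v : V, w = TriComplex.vertexPoint v) ∧
    K.geod x p ∩ K.geod x q = K.geod x w

end PlanarComplex

/-! The complex is treated as a CAT(0) metric space `Pt` satisfying Stewart's inequality. Geodesics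
are then unique, two geodesics overlapping in a nondegenerate segment form a geodesic
(`CatZero.ext`), and local geodesics are geodesics. Developing the cells around a point that is not
a vertex into the plane gives three local facts. A geodesic can be prolonged there unless the point
is on a free edge, i.e. an edge of exactly one triangle (`exists_extension`). Geodesics do not
branch there (`exists_common`); this uses planarity, by which an edge lies on at most two triangles
(`atMostTwo`). If a geodesic passes through a point of a free edge, one of its halves prolongs the
edge (`mem_seg_of_freeEdge`).

The geodesics of the map consist of sides. If one of them met the interior of a cone, that interior
would contain the origin, and every geodesic of the map would run through the apex of that cone.
Since all vertices lie on these geodesics, a half-open segment from the origin would be open in the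
complex and would exhaust the interior, which is absurd (`not_root_mem`, `side_of_tree`). So
interiors contain no vertex. Two geodesics of the map can separate only at a vertex or at the
origin; an end that is not a vertex cannot be passed, because it lies on a free edge.

The bound on the apex angle comes from a base of the cone. From an interior point, prolong the
geodesic coming from the origin as far as possible. It never meets a side, since sides lead back to
the origin along sides, so it ends in the interior on a free edge. That edge cuts the cone in a
chord from one side to the other. By the lemma on free edges all chords have the same ends, and
these are the ends of the cone (`Chord.left_eq_end`). Hence the segment between the two ends runs
through the cone and avoids the apex. Convexity follows by a connectedness argument (`cone_convex`):
the geodesics between the two sides vary continuously, and none can leave the cone because one of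
them lies in it.

In a convex cone a short geodesic between the two sides near the apex carries a fan, whose total
angle is less than `π` because the geodesic misses the apex (`exists_fan`). At an inner point of a
side two such fans, joined in the direction of the opposite end, give a finite angle. The angle is
at least `π` because laying out a smaller fan in the plane would yield a shortcut of the side
(`pi_le_innerAngle`). Finally, a geodesic from the opposite end through a point of a side leaves the
cone there, so another cone contains the point; finiteness of the family turns this into common
sides. -/

set_option linter.unusedSectionVars false

/-! ### Geodesics in CAT(0) spaces. -/

/-- A geodesic metric space that satisfies Stewart's inequality, i.e. a CAT(0) space. -/
class CatZero (X : Type*) [MetricSpace X] : Prop where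
  exists_between : ∀ a b : X, ∀ s ∈ Icc (0 : ℝ) 1,
    ∃ y, dist a y = s * dist a b ∧ dist y b = (1 - s) * dist a b
  stewart : ∀ a b c y : X, ∀ s ∈ Icc (0 : ℝ) 1,
    dist a y = s * dist a b → dist y b = (1 - s) * dist a b →
    dist c y ^ 2 ≤ (1 - s) * dist c a ^ 2 + s * dist c b ^ 2 - s * (1 - s) * dist a b ^ 2

namespace CatZero

section Metric

variable {X : Type*} [MetricSpace X] {a b c d y w : X}

/-- The metric segment between two points. -/
def seg (a b : X) : Set X := {y | dist a y + dist y b = dist a b}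

lemma mem_seg : y ∈ seg a b ↔ dist a y + dist y b = dist a b := Iff.rfl

lemma left_mem (a b : X) : a ∈ seg a b := by simp [seg]

lemma right_mem (a b : X) : b ∈ seg a b := by simp [seg]

lemma seg_comm (a b : X) : seg a b = seg b a := by
  ext y; simp only [mem_seg]; rw [dist_comm a y, dist_comm y b, dist_comm a b, add_comm]

lemma mem_comm : y ∈ seg a b ↔ y ∈ seg b a := by rw [seg_comm]

@[simp] lemma seg_self (a : X) : seg a a = {a} := by
  ext y; simp only [mem_seg, dist_self, mem_singleton_iff]
  constructor
  · intro h
    have h1 := dist_nonneg (x := a) (y := y)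
    have h2 := dist_nonneg (x := y) (y := a)
    exact dist_eq_zero.1 (by linarith)
  · rintro rfl; simp

lemma isClosed_seg (a b : X) : IsClosed (seg a b) :=
  isClosed_eq (by fun_prop) (by fun_prop)

lemma dist_le_of_mem (h : y ∈ seg a b) : dist a y ≤ dist a b := by
  have := dist_nonneg (x := y) (y := b); rw [mem_seg] at h; linarith

lemma mem_of_mem_left (h : y ∈ seg a b) (hw : w ∈ seg a y) : w ∈ seg a b := by
  rw [mem_seg] at *
  linarith [dist_triangle w y b, dist_triangle a w b]

lemma mem_mid (h : y ∈ seg a b) (hw : w ∈ seg a y) : y ∈ seg w b := by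
  rw [mem_seg] at *
  linarith [dist_triangle w y b, dist_triangle a w b]

lemma mem_of_mem_right (h : y ∈ seg a b) (hw : w ∈ seg y b) : w ∈ seg a b := by
  rw [mem_comm] at *; exact mem_of_mem_left h hw

lemma mem_mid' (h : y ∈ seg a b) (hw : w ∈ seg y b) : y ∈ seg a w := by
  rw [mem_comm] at *; exact mem_mid h hw

lemma seg_antisymm (h : y ∈ seg a b) (h' : b ∈ seg a y) : y = b := by
  rw [mem_seg] at *
  have := dist_nonneg (x := y) (y := b)
  rw [dist_comm b y] at h'
  exact dist_eq_zero.1 (by linarith)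

/-- Complements `exists_branch`: a common point beyond `w` would also lie before `w`. -/
lemma branch_disjoint {x p q : X} (h : seg x p ∩ seg x q = seg x w) (hw : w ∈ seg x p ∩ seg x q)
    (h1 : y ∈ seg w p) (h2 : y ∈ seg w q) : y = w := by
  have : y ∈ seg x w := by
    rw [← h]; exact ⟨mem_of_mem_right hw.1 h1, mem_of_mem_right hw.2 h2⟩
  have h3 := mem_mid' hw.1 h1
  exact seg_antisymm this h3

end Metric

variable {X : Type*} [MetricSpace X] [CatZero X] {a b c d y w p q x z r s t u : X}

/-- With the second point as third corner of the triangle, the right-hand side of Stewart's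
inequality vanishes. -/
lemma unique_between {σ : ℝ} (hs : σ ∈ Icc (0 : ℝ) 1)
    (h1 : dist a y = σ * dist a b) (h2 : dist y b = (1 - σ) * dist a b)
    (h3 : dist a w = σ * dist a b) (h4 : dist w b = (1 - σ) * dist a b) : y = w := by
  have := stewart a b w y σ hs h1 h2
  rw [dist_comm w a, h3, h4] at this
  have h0 : dist w y ^ 2 ≤ 0 := by nlinarith
  have := pow_eq_zero_iff (two_ne_zero) |>.1 (le_antisymm h0 (sq_nonneg _))
  exact (dist_eq_zero.1 this).symm

lemma seg_unique (hy : y ∈ seg a b) (hw : w ∈ seg a b) (h : dist a y = dist a w) : y = w := by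
  rw [mem_seg] at hy hw
  rcases eq_or_ne a b with rfl | hab
  · rw [dist_self] at hy hw
    have := dist_nonneg (x := a) (y := y)
    have := dist_nonneg (x := y) (y := a)
    have h1 : dist a y = 0 := by linarith
    exact (dist_eq_zero.1 h1).symm.trans (dist_eq_zero.1 (h.symm.trans h1))
  · have hD : 0 < dist a b := dist_pos.2 hab
    have h0 := dist_nonneg (x := a) (y := y)
    have h0' := dist_nonneg (x := y) (y := b)
    refine unique_between (a := a) (b := b) (σ := dist a y / dist a b) ⟨by positivity, ?_⟩
      ?_ ?_ ?_ ?_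
    · rw [div_le_one hD]; linarith
    · field_simp
    · field_simp; linarith
    · rw [← h]; field_simp
    · field_simp; linarith

lemma exists_mem_seg {ρ : ℝ} (h0 : 0 ≤ ρ) (h1 : ρ ≤ dist a b) : ∃ y ∈ seg a b, dist a y = ρ := by
  rcases eq_or_ne a b with rfl | hab
  · exact ⟨a, left_mem _ _, by rw [dist_self] at *; linarith⟩
  · have hD : 0 < dist a b := dist_pos.2 hab
    obtain ⟨y, hy, hy'⟩ := exists_between a b (ρ / dist a b)
      ⟨by positivity, by rwa [div_le_one hD]⟩
    refine ⟨y, ?_, ?_⟩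
    · rw [mem_seg, hy, hy']; ring
    · rw [hy]; field_simp

lemma mem_of_dist_le (hy : y ∈ seg a b) (hw : w ∈ seg a b) (h : dist a w ≤ dist a y) :
    w ∈ seg a y := by
  obtain ⟨w', hw', hd⟩ := exists_mem_seg (a := a) (b := y) dist_nonneg h
  rwa [← seg_unique (mem_of_mem_left hy hw') hw hd]

lemma mem_total (hy : y ∈ seg a b) (hw : w ∈ seg a b) : w ∈ seg a y ∨ y ∈ seg a w :=
  (le_total (dist a w) (dist a y)).imp (mem_of_dist_le hy hw) (mem_of_dist_le hw hy)

lemma mem_split (hy : y ∈ seg a b) (hw : w ∈ seg a b) : w ∈ seg a y ∨ w ∈ seg y b :=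
  (mem_total hy hw).imp_right fun h => mem_mid hw h

lemma seg_subset (hy : y ∈ seg a b) (hw : w ∈ seg a b) : seg y w ⊆ seg a b := by
  rcases mem_total hy hw with h | h
  · intro v hv
    exact mem_of_mem_left hy (mem_of_mem_right h (mem_comm.1 hv))
  · intro v hv
    exact mem_of_mem_left hw (mem_of_mem_right h hv)

/-- Two geodesics that overlap in a nondegenerate segment form a geodesic. -/
lemma ext (h1 : b ∈ seg a c) (h2 : c ∈ seg b d) (hbc : b ≠ c) : b ∈ seg a d := by
  rw [mem_seg] at *
  have hβ : 0 < dist b c := dist_pos.2 hbc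
  have hα := dist_nonneg (x := a) (y := b)
  have hγ := dist_nonneg (x := c) (y := d)
  have hac : 0 < dist a c := by linarith
  -- With `α`, `β`, `γ` the three consecutive lengths and `D` the distance of `a` and `d`, this
  -- rearranges to `β * (α + β + γ)² ≤ β * D²`. The overlap `b ≠ c` is what allows `β` to be
  -- cancelled.
  have key := stewart a c d b (dist a b / dist a c)
    ⟨by positivity, by rw [div_le_one hac]; linarith⟩ (by field_simp) (by field_simp; linarith)
  rw [dist_comm d b, dist_comm d a, dist_comm d c, ← h2, ← h1] at key
  have tri := dist_triangle a b d
  have hD := dist_nonneg (x := a) (y := d)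
  set α := dist a b
  set β := dist b c
  set γ := dist c d
  set D := dist a d
  have e : (1 - α / (α + β)) * D ^ 2 + α / (α + β) * γ ^ 2
      - α / (α + β) * (1 - α / (α + β)) * (α + β) ^ 2 =
      (β * D ^ 2 + α * γ ^ 2 - α * β * (α + β)) / (α + β) := by
    have : α + β ≠ 0 := by positivity
    field_simp; ring
  rw [e, le_div_iff₀ (by positivity)] at key
  have : (α + β + γ) ^ 2 * β ≤ D ^ 2 * β := by nlinarith
  have := le_of_mul_le_mul_right this hβ
  have := abs_le_of_sq_le_sq' this hD
  linarith [this.2]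

lemma ext' (h1 : b ∈ seg a c) (h2 : c ∈ seg b d) (hbc : b ≠ c) : c ∈ seg a d :=
  mem_comm.1 (ext (mem_comm.1 h2) (mem_comm.1 h1) hbc.symm)

/-- The point that divides the segment from `a` to `b` in the ratio `σ : 1 - σ`. -/
noncomputable def pt (a b : X) (σ : ℝ) : X :=
  (exists_between a b (projIcc 0 1 zero_le_one σ : ℝ) (projIcc 0 1 zero_le_one σ).2).choose

lemma dist_left_pt {σ : ℝ} (hs : σ ∈ Icc (0 : ℝ) 1) : dist a (pt a b σ) = σ * dist a b := by
  have h := (exists_between a b (projIcc 0 1 zero_le_one σ : ℝ)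
    (projIcc 0 1 zero_le_one σ).2).choose_spec.1
  exact h.trans (by rw [projIcc_of_mem _ hs])

lemma dist_pt_right {σ : ℝ} (hs : σ ∈ Icc (0 : ℝ) 1) :
    dist (pt a b σ) b = (1 - σ) * dist a b := by
  have h := (exists_between a b (projIcc 0 1 zero_le_one σ : ℝ)
    (projIcc 0 1 zero_le_one σ).2).choose_spec.2
  exact h.trans (by rw [projIcc_of_mem _ hs])

lemma pt_proj (a b : X) (σ : ℝ) : pt a b (projIcc (0 : ℝ) 1 zero_le_one σ) = pt a b σ := by
  simp [pt]

lemma pt_mem_seg (a b : X) (σ : ℝ) : pt a b σ ∈ seg a b := by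
  rw [← pt_proj, mem_seg, dist_left_pt (Subtype.mem _), dist_pt_right (Subtype.mem _)]; ring

lemma pt_eq {σ : ℝ} (hs : σ ∈ Icc (0 : ℝ) 1) (hy : y ∈ seg a b) (h : dist a y = σ * dist a b) :
    pt a b σ = y := seg_unique (pt_mem_seg a b σ) hy (by rw [dist_left_pt hs, h])

lemma pt_zero (a b : X) : pt a b 0 = a :=
  pt_eq (by simp) (left_mem _ _) (by simp)

lemma pt_one (a b : X) : pt a b 1 = b :=
  pt_eq (by simp) (right_mem _ _) (by simp)

lemma seg_eq_image (a b : X) : seg a b = pt a b '' Icc 0 1 := by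
  ext y
  constructor
  · intro hy
    rcases eq_or_ne a b with rfl | hab
    · refine ⟨0, by simp, ?_⟩
      rw [seg_self] at hy; rw [pt_zero, mem_singleton_iff.1 hy]
    · have hD : 0 < dist a b := dist_pos.2 hab
      have h := dist_le_of_mem hy
      have hs : dist a y / dist a b ∈ Icc (0 : ℝ) 1 := ⟨by positivity, by rwa [div_le_one hD]⟩
      exact ⟨_, hs, pt_eq hs hy (by field_simp)⟩
  · rintro ⟨σ, -, rfl⟩; exact pt_mem_seg a b σ

/-- Stewart's inequality twice: for `pt a b σ` seen from `pt a c σ`, and for `pt a c σ` seen from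
`b`. -/
lemma dist_pt_pt_right {σ : ℝ} (hs : σ ∈ Icc (0 : ℝ) 1) (a b c : X) :
    dist (pt a b σ) (pt a c σ) ≤ σ * dist b c := by
  have h1 := stewart a b (pt a c σ) (pt a b σ) σ hs (dist_left_pt hs) (dist_pt_right hs)
  have h2 := stewart a c b (pt a c σ) σ hs (dist_left_pt hs) (dist_pt_right hs)
  rw [dist_comm _ a, dist_left_pt hs] at h1
  rw [dist_comm _ a] at h2
  rw [dist_comm b (pt a c σ)] at h2
  rw [dist_comm (pt a b σ)]
  have h3 : dist (pt a c σ) (pt a b σ) ^ 2 ≤ (σ * dist b c) ^ 2 := by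
    nlinarith [mul_le_mul_of_nonneg_left h2 hs.1]
  exact abs_le_of_sq_le_sq' h3 (mul_nonneg hs.1 dist_nonneg) |>.2

lemma pt_symm {σ : ℝ} (hs : σ ∈ Icc (0 : ℝ) 1) (a b : X) : pt a b σ = pt b a (1 - σ) := by
  have hs' : 1 - σ ∈ Icc (0 : ℝ) 1 := ⟨by linarith [hs.2], by linarith [hs.1]⟩
  refine pt_eq hs (mem_comm.1 (pt_mem_seg _ _ _)) ?_
  rw [dist_comm a (pt b a (1 - σ)), dist_pt_right hs', dist_comm b a]; ring

lemma dist_pt_pt {σ : ℝ} (hs : σ ∈ Icc (0 : ℝ) 1) (a b a' b' : X) :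
    dist (pt a b σ) (pt a' b' σ) ≤ dist a a' + dist b b' := by
  have hs' : 1 - σ ∈ Icc (0 : ℝ) 1 := ⟨by linarith [hs.2], by linarith [hs.1]⟩
  have h1 := dist_pt_pt_right hs a b b'
  have h2 := dist_pt_pt_right hs' b' a a'
  rw [← pt_symm hs, ← pt_symm hs] at h2
  have h3 := dist_triangle (pt a b σ) (pt a b' σ) (pt a' b' σ)
  have h4 : σ * dist b b' ≤ dist b b' := mul_le_of_le_one_left dist_nonneg hs.2
  have h5 : (1 - σ) * dist a a' ≤ dist a a' := mul_le_of_le_one_left dist_nonneg hs'.2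
  linarith

lemma dist_pt_param {σ τ : ℝ} (hs : σ ∈ Icc (0 : ℝ) 1) (ht : τ ∈ Icc (0 : ℝ) 1) (a b : X) :
    dist (pt a b σ) (pt a b τ) = |σ - τ| * dist a b := by
  wlog h : σ ≤ τ generalizing σ τ
  · rw [dist_comm, abs_sub_comm]; exact this ht hs (le_of_not_ge h)
  have h1 : pt a b σ ∈ seg a (pt a b τ) := by
    refine mem_of_dist_le (pt_mem_seg _ _ _) (pt_mem_seg _ _ _) ?_
    rw [dist_left_pt hs, dist_left_pt ht]
    exact mul_le_mul_of_nonneg_right h dist_nonneg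
  rw [mem_seg, dist_left_pt hs, dist_left_pt ht] at h1
  rw [abs_of_nonpos (by linarith)]; linarith

/-- The parameter is clamped to the unit interval, so no side condition is needed. The endpoints are
moved first, with `dist_pt_pt`, and then the parameter. -/
lemma continuous_pt : Continuous (fun v : X × X × ℝ => pt v.1 v.2.1 v.2.2) := by
  have : (fun v : X × X × ℝ => pt v.1 v.2.1 v.2.2) =
      fun v => pt v.1 v.2.1 (projIcc (0 : ℝ) 1 zero_le_one v.2.2 : ℝ) := by
    ext v; rw [pt_proj]
  rw [this, continuous_iff_continuousAt]
  intro v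
  rw [ContinuousAt, tendsto_iff_dist_tendsto_zero]
  set π : ℝ → ℝ := fun σ => (projIcc (0 : ℝ) 1 zero_le_one σ : ℝ)
  have hπ : Continuous π := continuous_subtype_val.comp continuous_projIcc
  have hc : Continuous (fun w : X × X × ℝ =>
      dist w.1 v.1 + dist w.2.1 v.2.1 + |π w.2.2 - π v.2.2| * dist v.1 v.2.1) := by
    fun_prop
  have h0 := hc.tendsto v
  simp only [dist_self, sub_self, abs_zero, zero_mul, add_zero] at h0
  refine squeeze_zero (fun _ => dist_nonneg) (fun w => ?_) h0
  refine (dist_triangle _ (pt v.1 v.2.1 (π w.2.2)) _).trans ?_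
  exact add_le_add (dist_pt_pt (Subtype.mem _) _ _ _ _)
    (dist_pt_param (Subtype.mem _) (Subtype.mem _) _ _).le

lemma continuous_pt_param (a b : X) : Continuous (pt a b) :=
  continuous_pt.comp (by fun_prop : Continuous fun σ : ℝ => (a, b, σ))

lemma isCompact_seg (a b : X) : IsCompact (seg a b) := by
  rw [seg_eq_image]; exact isCompact_Icc.image (continuous_pt_param a b)

lemma isPreconnected_seg (a b : X) : IsPreconnected (seg a b) := by
  rw [seg_eq_image]
  exact isPreconnected_Icc.image _ (continuous_pt_param a b).continuousOn

lemma isPreconnected_seg_diff_right (a b : X) : IsPreconnected (seg a b \ {b}) := by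
  rcases eq_or_ne a b with rfl | hab
  · simp [isPreconnected_empty]
  have : seg a b \ {b} = pt a b '' Ico 0 1 := by
    rw [seg_eq_image]
    ext y
    constructor
    · rintro ⟨⟨σ, hσ, rfl⟩, h⟩
      refine ⟨σ, ⟨hσ.1, lt_of_le_of_ne hσ.2 ?_⟩, rfl⟩
      rintro rfl; exact h (pt_one a b)
    · rintro ⟨σ, hσ, rfl⟩
      have hm : σ ∈ Icc (0 : ℝ) 1 := ⟨hσ.1, hσ.2.le⟩
      refine ⟨⟨σ, hm, rfl⟩, fun h => ?_⟩
      have := dist_pt_right (a := a) (b := b) hm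
      rw [mem_singleton_iff.1 h, dist_self] at this
      have hD := dist_pos.2 hab
      nlinarith [hσ.2]
  rw [this]
  exact isPreconnected_Ico.image _ (continuous_pt_param a b).continuousOn

lemma isPreconnected_seg_diff_left (a b : X) : IsPreconnected (seg a b \ {a}) := by
  rw [seg_comm]; exact isPreconnected_seg_diff_right b a

/-- There are points of a nondegenerate segment arbitrarily close to its first endpoint. -/
lemma exists_near (hab : a ≠ b) {ε : ℝ} (hε : 0 < ε) : ∃ y ∈ seg a b, y ≠ a ∧ dist a y < ε := by
  have hD := dist_pos.2 hab
  obtain ⟨y, hy, h⟩ := exists_mem_seg (a := a) (b := b) (ρ := min (ε / 2) (dist a b))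
    (by positivity) (min_le_right _ _)
  refine ⟨y, hy, ?_, ?_⟩
  · rintro rfl
    rw [dist_self] at h
    have : 0 < min (ε / 2) (dist y b) := by positivity
    linarith
  · rw [h]; linarith [min_le_left (ε / 2) (dist a b)]

/-- The first point outside of an open set on a segment that starts in the set. -/
lemma exists_exit {R : Set X} (hR : IsOpen R) (hb : b ∉ R) :
    ∃ s ∈ seg a b, s ∉ R ∧ ∀ w ∈ seg a s, w ≠ s → w ∈ R := by
  have hK : IsCompact (seg a b \ R) := (isCompact_seg a b).diff hR
  obtain ⟨s, hs, hmin⟩ := hK.exists_isMinOn ⟨b, right_mem _ _, hb⟩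
    (f := fun w => dist a w) (by fun_prop)
  refine ⟨s, hs.1, hs.2, fun w hw hne => ?_⟩
  by_contra hwR
  have h1 : dist a s ≤ dist a w := hmin ⟨mem_of_mem_left hs.1 hw, hwR⟩
  exact hne (seg_unique hw (right_mem _ _) (le_antisymm (dist_le_of_mem hw) h1))

/-- Two geodesics from `x` agree up to some point and are disjoint afterwards. -/
lemma exists_branch (x p q : X) : ∃ w ∈ seg x p ∩ seg x q, seg x p ∩ seg x q = seg x w := by
  obtain ⟨w, hw, hmax⟩ := ((isCompact_seg x p).inter_right (isClosed_seg x q)).exists_isMaxOn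
    ⟨x, left_mem _ _, left_mem _ _⟩ (f := fun w => dist x w) (by fun_prop)
  refine ⟨w, hw, ?_⟩
  ext y
  constructor
  · intro hy; exact mem_of_dist_le hw.1 hy.1 (hmax hy)
  · intro hy; exact ⟨mem_of_mem_left hw.1 hy, mem_of_mem_left hw.2 hy⟩

/-- A local geodesic is a geodesic. -/
lemma dist_of_local {γ : ℝ → X} {L l m : ℝ} (hlm : l ≤ m) (hL : 0 ≤ L)
    (hγ : ContinuousOn γ (Icc l m))
    (hloc : ∀ μ ∈ Icc l m, ∃ ε > 0, ∀ μ' ∈ Icc l m, ∀ μ'' ∈ Icc l m,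
      |μ' - μ| < ε → |μ'' - μ| < ε → dist (γ μ') (γ μ'') = L * |μ' - μ''|) :
    dist (γ l) (γ m) = L * (m - l) := by
  rcases hL.eq_or_lt with rfl | hL
  -- For `L = 0` the overlap needed for gluing degenerates, so constancy is shown directly.
  · have hc : Icc l m ⊆ {μ ∈ Icc l m | γ μ = γ l} := by
      have hcl : IsClosed ({μ ∈ Icc l m | γ μ = γ l} ∩ Icc l m) := by
        have := hγ.preimage_isClosed_of_isClosed isClosed_Icc (isClosed_singleton (x := γ l))
        convert this using 1
        ext; simp only [mem_inter_iff, mem_ofPred_eq, mem_preimage, mem_singleton_iff]; tauto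
      refine hcl.Icc_subset_of_forall_mem_nhdsWithin ⟨left_mem_Icc.2 hlm, rfl⟩ ?_
      rintro μ ⟨⟨hμ, hμe⟩, hμ'⟩
      obtain ⟨ε, hε, h⟩ := hloc μ hμ
      filter_upwards [Ioo_mem_nhdsGT (lt_min hμ'.2 (lt_add_of_pos_right μ hε))] with ν hν
      have hν1 := hν.2.trans_le (min_le_left _ _)
      have hν2 := hν.2.trans_le (min_le_right _ _)
      have hνI : ν ∈ Icc l m := ⟨hμ.1.trans hν.1.le, hν1.le⟩
      refine ⟨hνI, ?_⟩
      have := h μ hμ ν hνI (by simpa using hε) (by rw [abs_lt]; constructor <;> linarith [hν.1])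
      rw [zero_mul] at this
      rw [← dist_eq_zero.1 this, hμe]
    have := (hc (right_mem_Icc.2 hlm)).2
    rw [this]; simp
  -- Continuous induction. The geodesic up to `μ` and the local geodesic around `μ` overlap between
  -- `κ` and `μ`, and `ext'` glues them.
  have hc : Icc l m ⊆ {μ ∈ Icc l m | dist (γ l) (γ μ) = L * (μ - l)} := by
    have hcl : IsClosed ({μ ∈ Icc l m | dist (γ l) (γ μ) = L * (μ - l)} ∩ Icc l m) := by
      have : ContinuousOn (fun μ => dist (γ l) (γ μ) - L * (μ - l)) (Icc l m) := by
        fun_prop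
      have := this.preimage_isClosed_of_isClosed isClosed_Icc (isClosed_singleton (x := (0 : ℝ)))
      convert this using 1
      ext; simp only [mem_inter_iff, mem_ofPred_eq, mem_preimage, mem_singleton_iff, sub_eq_zero]
      tauto
    refine hcl.Icc_subset_of_forall_mem_nhdsWithin ⟨left_mem_Icc.2 hlm, by simp⟩ ?_
    rintro μ ⟨⟨hμ, hμe⟩, hμ'⟩
    obtain ⟨ε, hε, h⟩ := hloc μ hμ
    filter_upwards [Ioo_mem_nhdsGT (lt_min hμ'.2 (lt_add_of_pos_right μ hε))] with ν hν
    have hν1 := hν.2.trans_le (min_le_left _ _)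
    have hν2 := hν.2.trans_le (min_le_right _ _)
    have hνI : ν ∈ Icc l m := ⟨hμ.1.trans hν.1.le, hν1.le⟩
    refine ⟨hνI, ?_⟩
    have hνε : |ν - μ| < ε := by rw [abs_lt]; constructor <;> linarith [hν.1]
    have hμν := h μ hμ ν hνI (by simpa using hε) hνε
    rw [abs_of_neg (by linarith [hν.1])] at hμν
    rcases hμ.1.eq_or_lt with rfl | hlμ
    · rw [hμν]; ring
    · -- a point slightly before `μ`
      set κ := max l (μ - ε / 2)
      have hκ1 : l ≤ κ := le_max_left _ _
      have hκ2 : κ < μ := max_lt hlμ (by linarith)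
      have hκI : κ ∈ Icc l m := ⟨hκ1, hκ2.le.trans hμ.2⟩
      have hκε : |κ - μ| < ε := by
        have := le_max_right l (μ - ε / 2)
        rw [abs_lt]; constructor <;> linarith
      have e1 := h κ hκI μ hμ hκε (by simpa using hε)
      have e2 := h κ hκI ν hνI hκε hνε
      rw [abs_of_neg (by linarith)] at e1
      rw [abs_of_neg (by linarith [hν.1])] at e2
      have e3 : dist (γ l) (γ κ) ≤ L * (κ - l) := by
        -- upper bound along the curve
        have hsub : Icc l κ ⊆ {η ∈ Icc l κ | dist (γ l) (γ η) ≤ L * (η - l)} := by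
          have hcl : IsClosed ({η ∈ Icc l κ | dist (γ l) (γ η) ≤ L * (η - l)} ∩ Icc l κ) := by
            have hγ' := hγ.mono (Icc_subset_Icc_right hκI.2)
            have : ContinuousOn (fun η => dist (γ l) (γ η) - L * (η - l)) (Icc l κ) := by
              fun_prop
            have := this.preimage_isClosed_of_isClosed isClosed_Icc (isClosed_Iic (a := (0 : ℝ)))
            convert this using 1
            ext; simp only [mem_inter_iff, mem_ofPred_eq, mem_preimage, mem_Iic, sub_nonpos]
            tauto
          refine hcl.Icc_subset_of_forall_mem_nhdsWithin ⟨left_mem_Icc.2 hκ1, by simp⟩ ?_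
          rintro η ⟨⟨hη, hηe⟩, hη'⟩
          obtain ⟨δ, hδ, hh⟩ := hloc η ⟨hη.1, hη.2.trans hκI.2⟩
          filter_upwards [Ioo_mem_nhdsGT (lt_min hη'.2 (lt_add_of_pos_right η hδ))] with ξ hξ
          have hξ1 := hξ.2.trans_le (min_le_left _ _)
          have hξ2 := hξ.2.trans_le (min_le_right _ _)
          refine ⟨⟨hη.1.trans hξ.1.le, hξ1.le⟩, ?_⟩
          have := hh η ⟨hη.1, hη.2.trans hκI.2⟩ ξ ⟨hη.1.trans hξ.1.le, hξ1.le.trans hκI.2⟩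
            (by simpa using hδ) (by rw [abs_lt]; constructor <;> linarith [hξ.1])
          rw [abs_of_neg (by linarith [hξ.1])] at this
          linarith [dist_triangle (γ l) (γ η) (γ ξ)]
        exact (hsub (right_mem_Icc.2 hκ1)).2
      have e4 : γ κ ∈ seg (γ l) (γ μ) := by
        rw [mem_seg]
        have := dist_triangle (γ l) (γ κ) (γ μ)
        apply le_antisymm _ this
        rw [e1, hμe]; linarith
      have e5 : γ μ ∈ seg (γ κ) (γ ν) := by
        rw [mem_seg, e1, hμν, e2]; ring
      have hne : γ κ ≠ γ μ := by
        rw [← dist_pos, e1]; exact mul_pos hL (by linarith)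
      have e6 := ext' e4 e5 hne
      rw [mem_seg] at e6
      rw [← e6, hμe, hμν]; ring
  exact (hc (right_mem_Icc.2 hlm)).2

/-! ### Convexity of a region with two geodesic sides. -/

/-- A region bounded by two geodesic sides with a common apex is convex, if one geodesic that
joins the two sides lies in it and avoids the apex. -/
theorem cone_convex {R : Set X} (hR : IsOpen R) (hcl : closure R ⊆ R ∪ (seg z p ∪ seg z q))
    (hPQ : seg z p ∩ seg z q = {z}) (hRd : Disjoint R (seg z p ∪ seg z q))
    {p' q' : X} (hp' : p' ∈ seg z p) (hq' : q' ∈ seg z q) (hz : z ∉ seg p' q')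
    (hC : seg p' q' ⊆ R ∪ (seg z p ∪ seg z q)) {r s : X}
    (hr : r ∈ R ∪ (seg z p ∪ seg z q)) (hs : s ∈ R ∪ (seg z p ∪ seg z q)) :
    seg r s ⊆ R ∪ (seg z p ∪ seg z q) := by
  set P := seg z p
  set Q := seg z q
  set C := R ∪ (P ∪ Q)
  have hCcl : IsClosed C := by
    have : C = closure R ∪ (P ∪ Q) := by
      apply subset_antisymm
      · exact union_subset_union_left _ subset_closure
      · exact union_subset hcl subset_union_right
    rw [this]
    exact isClosed_closure.union ((isClosed_seg _ _).union (isClosed_seg _ _))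
  have hp'z : p' ≠ z := by rintro rfl; exact hz (left_mem _ _)
  have hq'z : q' ≠ z := by rintro rfl; exact hz (right_mem _ _)
  have hzP : z ∈ P := left_mem _ _
  have hzQ : z ∈ Q := left_mem _ _
  have hPP : ∀ r ∈ P, ∀ s ∈ P, seg r s ⊆ P := fun r hr s hs => seg_subset hr hs
  have hQQ : ∀ r ∈ Q, ∀ s ∈ Q, seg r s ⊆ Q := fun r hr s hs => seg_subset hr hs
  have hnR : ∀ y ∈ P ∪ Q, y ∉ R := fun y hy hy' => Set.disjoint_left.1 hRd hy' hy
  -- the apex is on no geodesic between the sides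
  have half : ∀ {p p' r s : X}, p' ∈ seg z p → r ∈ seg z p → r ≠ z → z ∈ seg r s →
      z ∈ seg p' s := by
    intro p p' r s hp' hr hrz hzrs
    rcases mem_total hr hp' with h | h
    · exact mem_mid hzrs (mem_comm.1 h)
    · exact mem_comm.1 (ext (mem_comm.1 hzrs) h hrz.symm)
  have hzrs : ∀ r ∈ P, ∀ s ∈ Q, r ≠ z → s ≠ z → z ∉ seg r s := by
    intro r hr s hs hrz hsz h
    have h1 := half hp' hr hrz h
    exact hz (mem_comm.1 (half hq' hs hsz (mem_comm.1 h1)))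
  -- exit towards either end
  have exitR : ∀ y ∈ R, ∀ e ∈ P ∪ Q, ∃ f ∈ seg y e, f ∈ P ∪ Q ∧ f ≠ y ∧
      ∀ w ∈ seg y f, w ≠ f → w ∈ R := by
    intro y hy e he
    obtain ⟨f, hf, hfR, hfw⟩ := exists_exit (a := y) hR (hnR e he)
    have hfy : f ≠ y := fun h => hfR (h ▸ hy)
    refine ⟨f, hf, ?_, hfy, hfw⟩
    have : f ∈ closure R := by
      rw [Metric.mem_closure_iff]
      intro ε hε
      obtain ⟨w, hw, hwf, hd⟩ := exists_near (a := f) (b := y) hfy hε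
      exact ⟨w, hfw w (mem_comm.1 hw) hwf, hd⟩
    exact (hcl this).resolve_left hfR
  have exitC : ∀ y, y ∉ C → ∀ e ∈ C, ∃ f ∈ seg y e, f ∈ P ∪ Q := by
    intro y hy e he
    obtain ⟨f, hf, hfC, hfw⟩ := exists_exit (a := y) hCcl.isOpen_compl (b := e) (by simpa using he)
    rw [mem_compl_iff, not_not] at hfC
    refine ⟨f, hf, hfC.resolve_left fun hfR => ?_⟩
    have hfy : f ≠ y := fun h => hy (h ▸ Or.inl hfR)
    obtain ⟨ε, hε, hb⟩ := Metric.isOpen_iff.1 hR f hfR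
    obtain ⟨w, hw, hwf, hd⟩ := exists_near (a := f) (b := y) hfy hε
    exact hfw w (mem_comm.1 hw) hwf (Or.inl (hb (by rwa [Metric.mem_ball, dist_comm])))
  -- dichotomy
  have order : ∀ r s y y₀ : X, r ∈ P ∪ Q → s ∈ P ∪ Q → y ∈ seg r s → y₀ ∈ seg y s → y ∈ R →
      y₀ ∉ C → False := by
    intro r s y y₀ hr hs hy hy₀ hyR hy₀C
    -- Along the geodesic the order is `f₂`, `y`, `f₁`, `y₀`, `f₃`. Two of the three points `f₁`,
    -- `f₂`, `f₃` are on the same side, which is convex, so `y` or `y₀` would be on that side.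
    obtain ⟨f₁, hf₁, hf₁s, -, hf₁w⟩ := exitR y hyR s hs
    obtain ⟨f₂, hf₂, hf₂s, -, -⟩ := exitR y hyR r hr
    obtain ⟨f₃, hf₃, hf₃s⟩ := exitC y₀ hy₀C s (Or.inr hs)
    have hf₁y₀ : f₁ ∈ seg y y₀ := by
      rcases mem_total hy₀ hf₁ with h | h
      · exact h
      · rcases eq_or_ne y₀ f₁ with rfl | hne
        · exact right_mem _ _
        · exact absurd (Or.inl (hf₁w _ h hne)) hy₀C
    have hy₀f : y₀ ∈ seg f₁ f₃ := mem_mid' (mem_mid hy₀ hf₁y₀) hf₃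
    have hyf : y ∈ seg f₂ f₃ := by
      have h1 : y ∈ seg f₂ s := mem_comm.1 (mem_mid' (mem_comm.1 hy) hf₂)
      exact mem_mid' h1 (mem_of_mem_right hy₀ hf₃)
    have hyf₁ : y ∈ seg f₂ f₁ := by
      have h1 : y ∈ seg f₂ s := mem_comm.1 (mem_mid' (mem_comm.1 hy) hf₂)
      exact mem_mid' h1 hf₁
    have hyn : y ∉ P ∪ Q := fun h => hnR y h hyR
    have hy₀n : y₀ ∉ P ∪ Q := fun h => hy₀C (Or.inr h)
    rcases hf₁s with h1 | h1 <;> rcases hf₂s with h2 | h2 <;> rcases hf₃s with h3 | h3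
    · exact hyn (Or.inl (hPP _ h2 _ h1 hyf₁))
    · exact hyn (Or.inl (hPP _ h2 _ h1 hyf₁))
    · exact hy₀n (Or.inl (hPP _ h1 _ h3 hy₀f))
    · exact hyn (Or.inr (hQQ _ h2 _ h3 hyf))
    · exact hyn (Or.inl (hPP _ h2 _ h3 hyf))
    · exact hy₀n (Or.inr (hQQ _ h1 _ h3 hy₀f))
    · exact hyn (Or.inr (hQQ _ h2 _ h1 hyf₁))
    · exact hyn (Or.inr (hQQ _ h2 _ h1 hyf₁))
  have dich : ∀ r ∈ P, ∀ s ∈ Q, seg r s ⊆ C ∨ ∀ y ∈ seg r s, y ∉ R := by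
    intro r hr s hs
    by_contra! hcon
    obtain ⟨hn, y, hy, hyR⟩ := hcon
    obtain ⟨y₀, hy₀, hy₀C⟩ := Set.not_subset.1 hn
    rcases mem_split hy hy₀ with h | h
    · exact order s r y y₀ (Or.inr hs) (Or.inl hr) (mem_comm.1 hy) (mem_comm.1 h) hyR hy₀C
    · exact order r s y y₀ (Or.inl hr) (Or.inr hs) hy h hyR hy₀C
  -- By the dichotomy the connected set of pairs is covered by the closed sets `A` (geodesic inside
  -- the cone) and `B` (geodesic missing the region). A pair in both would have its geodesic in the
  -- union of the sides, hence by connectedness through the apex. Since `(p', q')` is in `A`, all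
  -- pairs are.
  have good : ∀ r ∈ P, ∀ s ∈ Q, r ≠ z → s ≠ z → seg r s ⊆ C := by
    set A : Set (X × X) := {v | ∀ σ ∈ Icc (0 : ℝ) 1, pt v.1 v.2 σ ∈ C}
    set B : Set (X × X) := {v | ∀ σ ∈ Icc (0 : ℝ) 1, pt v.1 v.2 σ ∈ Rᶜ}
    have hcont : ∀ σ : ℝ, Continuous fun v : X × X => pt v.1 v.2 σ := fun σ =>
      continuous_pt.comp (by fun_prop : Continuous fun v : X × X => (v.1, v.2, σ))
    have hA : IsClosed A := by
      have : A = ⋂ σ ∈ Icc (0 : ℝ) 1, {v : X × X | pt v.1 v.2 σ ∈ C} := by ext; simp [A]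
      rw [this]
      exact isClosed_biInter fun σ _ => hCcl.preimage (hcont σ)
    have hB : IsClosed B := by
      have : B = ⋂ σ ∈ Icc (0 : ℝ) 1, {v : X × X | pt v.1 v.2 σ ∈ Rᶜ} := by ext; simp [B]
      rw [this]
      exact isClosed_biInter fun σ _ => hR.isClosed_compl.preimage (hcont σ)
    have hAs : ∀ v : X × X, v ∈ A ↔ seg v.1 v.2 ⊆ C := by
      intro v; rw [seg_eq_image, image_subset_iff]; rfl
    have hBs : ∀ v : X × X, v ∈ B ↔ ∀ y ∈ seg v.1 v.2, y ∉ R := by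
      intro v; rw [seg_eq_image, forall_mem_image]; rfl
    have hconn : IsPreconnected ((P \ {z}) ×ˢ (Q \ {z})) :=
      (isPreconnected_seg_diff_left z p).prod (isPreconnected_seg_diff_left z q)
    have hsub : (P \ {z}) ×ˢ (Q \ {z}) ⊆ A ∪ B := by
      rintro ⟨r, s⟩ ⟨hr, hs⟩
      exact (dich r hr.1 s hs.1).imp (hAs _).2 (hBs _).2
    have hdisj : (P \ {z}) ×ˢ (Q \ {z}) ∩ (A ∩ B) = ∅ := by
      rw [Set.eq_empty_iff_forall_notMem]
      rintro ⟨r, s⟩ ⟨⟨hr, hs⟩, hvA, hvB⟩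
      rw [hAs] at hvA
      rw [hBs] at hvB
      have hPQs : seg r s ⊆ P ∪ Q := fun y hy => (hvA hy).resolve_left (hvB y hy)
      obtain ⟨y, hy, hy'⟩ := isPreconnected_closed_iff.1 (isPreconnected_seg r s) P Q
        (isClosed_seg _ _) (isClosed_seg _ _) hPQs ⟨r, left_mem _ _, hr.1⟩
        ⟨s, right_mem _ _, hs.1⟩
      rw [hPQ, mem_singleton_iff] at hy'
      exact hzrs r hr.1 s hs.1 hr.2 hs.2 (hy' ▸ hy)
    have := isPreconnected_iff_subset_of_disjoint_closed.1 hconn A B hA hB hsub hdisj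
    have hAll : (P \ {z}) ×ˢ (Q \ {z}) ⊆ A := by
      rcases this with h | h
      · exact h
      · exfalso
        have hmem : (p', q') ∈ (P \ {z}) ×ˢ (Q \ {z}) := ⟨⟨hp', hp'z⟩, ⟨hq', hq'z⟩⟩
        have : (p', q') ∈ (P \ {z}) ×ˢ (Q \ {z}) ∩ (A ∩ B) := ⟨hmem, (hAs _).2 hC, h hmem⟩
        rw [hdisj] at this; exact this
    intro r hr s hs hrz hsz
    exact (hAs (r, s)).1 (hAll ⟨⟨hr, hrz⟩, ⟨hs, hsz⟩⟩)
  have good' : ∀ r ∈ P, ∀ s ∈ Q, seg r s ⊆ C := by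
    intro r hr s hs
    rcases eq_or_ne r z with rfl | hrz
    · exact (hQQ _ hzQ _ hs).trans fun y hy => Or.inr (Or.inr hy)
    rcases eq_or_ne s z with rfl | hsz
    · exact (hPP _ hr _ hzP).trans fun y hy => Or.inr (Or.inl hy)
    exact good r hr s hs hrz hsz
  intro y hy
  by_contra hyC
  -- A point outside the cone lies between two points of sides, and those geodesics have just been
  -- treated.
  obtain ⟨f, hf, hfs⟩ := exitC y hyC r hr
  obtain ⟨g, hg, hgs⟩ := exitC y hyC s hs
  have hyfg : y ∈ seg f g := mem_mid' (mem_comm.1 (mem_mid' (mem_comm.1 hy) hf)) hg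
  rcases hfs with hfs | hfs <;> rcases hgs with hgs | hgs
  · exact hyC (Or.inr (Or.inl (hPP _ hfs _ hgs hyfg)))
  · exact hyC (good' f hfs g hgs hyfg)
  · exact hyC (good' g hgs f hfs (mem_comm.1 hyfg))
  · exact hyC (Or.inr (Or.inr (hQQ _ hfs _ hgs hyfg)))

end CatZero

/-! ### Developing cells into the plane. -/

namespace TriComplex

open CatZero

variable {V : Type*} [Fintype V] [DecidableEq V] (K : TriComplex V)

/-- The linear map to the plane that sends the vertex `v` to `P v`. -/
noncomputable def lin (P : V → ℂ) (x : V → ℝ) : ℂ := ∑ v, x v • P v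

lemma lin_sub (P : V → ℂ) (x y : V → ℝ) : lin P (x - y) = lin P x - lin P y := by
  simp [lin, sub_smul]

/-- `P` realises the lengths of the edges of `f` in the plane. -/
def Develops (P : V → ℂ) (f : Finset V) : Prop := ∀ i ∈ f, ∀ j ∈ f, ‖P i - P j‖ = K.len i j

variable {K}

/-- Expand the squared distances of the points `P i` and `P j`. Since the coordinates sum to zero,
the squared norms drop out and only the mixed terms remain. -/
lemma Develops.cellInner {P : V → ℂ} {f : Finset V} (h : K.Develops P f) {a b : V → ℝ}
    (ha : ∀ v, v ∉ f → a v = 0) (hb : ∀ v, v ∉ f → b v = 0) (ha' : ∑ v, a v = 0)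
    (hb' : ∑ v, b v = 0) : K.cellInner a b = inner ℝ (lin P a) (lin P b) := by
  have key : ∀ i j, (K.len i j) ^ 2 * a i * b j =
      (‖P i‖ ^ 2 * a i) * b j + a i * (‖P j‖ ^ 2 * b j) - 2 * (inner ℝ (a i • P i) (b j • P j)) := by
    intro i j
    by_cases hi : i ∈ f
    · by_cases hj : j ∈ f
      · rw [← h i hi j hj, norm_sub_sq_real, inner_smul_left, inner_smul_right]
        simp only [conj_trivial]; ring
      · simp [hb j hj]
    · simp [ha i hi]
  have e : inner ℝ (lin P a) (lin P b) = ∑ i, ∑ j, inner ℝ (a i • P i) (b j • P j) := by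
    rw [lin, lin, sum_inner]
    simp_rw [inner_sum]
  rw [TriComplex.cellInner, e]
  simp_rw [key, Finset.sum_sub_distrib, Finset.sum_add_distrib, ← Finset.mul_sum, ← Finset.sum_mul]
  rw [ha', hb']; ring

lemma Develops.cellDist {P : V → ℂ} {f : Finset V} (h : K.Develops P f) {a b : V → ℝ}
    (ha : a ∈ cell f) (hb : b ∈ cell f) : K.cellDist a b = ‖lin P a - lin P b‖ := by
  have h0 : ∀ v, v ∉ f → (a - b) v = 0 := fun v hv => by simp [ha.2.2 v hv, hb.2.2 v hv]
  have h1 : ∑ v, (a - b) v = 0 := by simp [ha.2.1, hb.2.1]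
  rw [TriComplex.cellDist, h.cellInner h0 h0 h1 h1, lin_sub, real_inner_self_eq_norm_sq,
    Real.sqrt_sq (norm_nonneg _)]

variable (K)

/-- The position of the foot of the altitude from `c` on the edge `a b`. -/
noncomputable def foot (a b c : V) : ℝ :=
  (K.len a c ^ 2 + K.len a b ^ 2 - K.len b c ^ 2) / (2 * K.len a b)

/-- The altitude from `c` to the edge `a b`. -/
noncomputable def altitude (a b c : V) : ℝ := √(K.len a c ^ 2 - K.foot a b c ^ 2)

/-- The position of the vertices near the edge `a b` after developing the complex there, with the
third vertex of a triangle placed on the side of the edge given by `σ`. -/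
noncomputable def place (a b : V) (σ : V → ℝ) (v : V) : ℂ :=
  if v = a then 0 else if v = b then (K.len a b : ℂ) else ⟨K.foot a b v, σ v * K.altitude a b v⟩

variable {K}

lemma mem_faces_sub {f g : Finset V} (hf : f ∈ K.faces) (hg : g ⊆ f) (hn : g.Nonempty) :
    g ∈ K.faces := K.down_closed f hf g hg hn

/-- Heron's formula: up to a positive factor the difference is the product of the perimeter and the
three triangle excesses. -/
lemma altitude_sq_pos {a b c : V} (hab : a ≠ b) (hac : a ≠ c) (hbc : b ≠ c)
    (hf : {a, b, c} ∈ K.faces) : 0 < K.len a c ^ 2 - K.foot a b c ^ 2 := by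
  have hsub : ∀ g : Finset V, g ⊆ {a, b, c} → g.Nonempty → g ∈ K.faces :=
    fun g hg hn => mem_faces_sub hf hg hn
  have l1 := K.len_pos a b hab (hsub _ (by intro v; simp; tauto) (by simp))
  have l2 := K.len_pos a c hac (hsub _ (by intro v; simp; tauto) (by simp))
  have l3 := K.len_pos b c hbc (hsub _ (by intro v; simp; tauto) (by simp))
  have t1 := K.len_triangle a b c hab hbc hac hf
  have t2 := K.len_triangle b a c hab.symm hac hbc (by rwa [Finset.insert_comm])
  have t3 := K.len_triangle a c b hac hbc.symm hab (by rwa [Finset.pair_comm c b])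
  rw [K.len_symm b a] at t2
  rw [K.len_symm c b] at t3
  rw [foot, div_pow, sub_pos, div_lt_iff₀ (by positivity)]
  have : 0 < (K.len b c - K.len a c + K.len a b) * (K.len b c + K.len a c - K.len a b) *
      ((K.len a c + K.len a b - K.len b c) * (K.len a c + K.len a b + K.len b c)) :=
    mul_pos (mul_pos (by linarith) (by linarith)) (mul_pos (by linarith) (by linarith))
  nlinarith

lemma altitude_pos {a b c : V} (hab : a ≠ b) (hac : a ≠ c) (hbc : b ≠ c)
    (hf : {a, b, c} ∈ K.faces) : 0 < K.altitude a b c :=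
  Real.sqrt_pos.2 (altitude_sq_pos hab hac hbc hf)

lemma place_left (a b : V) (σ : V → ℝ) : K.place a b σ a = 0 := by simp [place]

lemma place_right {a b : V} (hab : a ≠ b) (σ : V → ℝ) : K.place a b σ b = K.len a b := by
  simp [place, hab.symm]

lemma place_other {a b c : V} (hac : a ≠ c) (hbc : b ≠ c) (σ : V → ℝ) :
    K.place a b σ c = ⟨K.foot a b c, σ c * K.altitude a b c⟩ := by
  simp [place, hac.symm, hbc.symm]

lemma third_eq {f : Finset V} (hf : f ∈ K.faces) {a b c d : V} (ha : a ∈ f) (hb : b ∈ f)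
    (hc : c ∈ f) (hd : d ∈ f) (hab : a ≠ b) (hac : a ≠ c) (hbc : b ≠ c) (had : a ≠ d)
    (hbd : b ≠ d) : c = d := by
  by_contra hcd
  have h1 : ({a, b, c, d} : Finset V) ⊆ f := by
    intro v; simp only [Finset.mem_insert, Finset.mem_singleton]
    rintro (rfl | rfl | rfl | rfl) <;> assumption
  have h2 := (Finset.card_le_card h1).trans (K.card_le_three f hf)
  rw [Finset.card_insert_of_notMem (by simp [hab, hac, had]),
    Finset.card_insert_of_notMem (by simp [hbc, hbd]),
    Finset.card_insert_of_notMem (by simp [hcd])] at h2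
  simp at h2

/-- The signs are arbitrary because reflecting a single triangle in its edge changes no length. This
freedom lets the two triangles at an edge be unfolded onto opposite sides of it. -/
lemma develops_place {a b : V} (hab : a ≠ b) {σ : V → ℝ} (hσ : ∀ v, σ v ^ 2 = 1) {f : Finset V}
    (hf : f ∈ K.faces) (ha : a ∈ f) (hb : b ∈ f) : K.Develops (K.place a b σ) f := by
  have hl : 0 < K.len a b := K.len_pos a b hab (mem_faces_sub hf
    (by intro v; simp only [Finset.mem_insert, Finset.mem_singleton]; rintro (rfl | rfl) <;> assumption)
    (by simp))
  have hac : ∀ c ∈ f, a ≠ c → b ≠ c → ‖K.place a b σ c‖ = K.len a c := by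
    intro c hc hac hbc
    have hf' : {a, b, c} ∈ K.faces := mem_faces_sub hf
      (by intro v; simp only [Finset.mem_insert, Finset.mem_singleton]
          rintro (rfl | rfl | rfl) <;> assumption) (by simp)
    have h0 := altitude_sq_pos hab hac hbc hf'
    have h1 := K.len_pos a c hac (mem_faces_sub hf' (by intro v; simp; tauto) (by simp))
    rw [place_other hac hbc, ← sq_eq_sq₀ (norm_nonneg _) h1.le, ← Complex.normSq_eq_norm_sq,
      Complex.normSq_mk]
    have : K.altitude a b c ^ 2 = _ := Real.sq_sqrt h0.le
    linear_combination (K.altitude a b c ^ 2) * hσ c + this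
  have hbc : ∀ c ∈ f, a ≠ c → b ≠ c → ‖K.place a b σ b - K.place a b σ c‖ = K.len b c := by
    intro c hc hac hbc
    have hf' : {a, b, c} ∈ K.faces := mem_faces_sub hf
      (by intro v; simp only [Finset.mem_insert, Finset.mem_singleton]
          rintro (rfl | rfl | rfl) <;> assumption) (by simp)
    have h0 := altitude_sq_pos hab hac hbc hf'
    have h1 := K.len_pos b c hbc (mem_faces_sub hf' (by intro v; simp; tauto) (by simp))
    rw [place_other hac hbc, place_right hab, ← sq_eq_sq₀ (norm_nonneg _) h1.le,
      ← Complex.normSq_eq_norm_sq, Complex.normSq_apply]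
    simp only [Complex.sub_re, Complex.sub_im, Complex.ofReal_re, Complex.ofReal_im]
    have h2 : K.altitude a b c ^ 2 = _ := Real.sq_sqrt h0.le
    have h3 : K.foot a b c * (2 * K.len a b) =
        K.len a c ^ 2 + K.len a b ^ 2 - K.len b c ^ 2 := by
      rw [foot]; field_simp
    linear_combination (K.altitude a b c ^ 2) * hσ c + h2 - h3
  have hself : ∀ i, ‖K.place a b σ i - K.place a b σ i‖ = K.len i i := by
    intro i; rw [sub_self, norm_zero, K.len_self]
  have hab' : ‖K.place a b σ a - K.place a b σ b‖ = K.len a b := by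
    rw [place_left, place_right hab, zero_sub, norm_neg, Complex.norm_real, Real.norm_of_nonneg hl.le]
  have hac' : ∀ c ∈ f, a ≠ c → b ≠ c → ‖K.place a b σ a - K.place a b σ c‖ = K.len a c := by
    intro c hc h1 h2; rw [place_left, zero_sub, norm_neg]; exact hac c hc h1 h2
  intro i hi j hj
  rcases eq_or_ne i j with rfl | hij
  · exact hself i
  rcases eq_or_ne a i with rfl | hai
  · rcases eq_or_ne b j with rfl | hbj
    · exact hab'
    · exact hac' j hj hij hbj
  rcases eq_or_ne a j with rfl | haj
  · rw [norm_sub_rev, K.len_symm]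
    rcases eq_or_ne b i with rfl | hbi
    · exact hab'
    · exact hac' i hi hai hbi
  rcases eq_or_ne b i with rfl | hbi
  · exact hbc j hj haj hij
  rcases eq_or_ne b j with rfl | hbj
  · rw [norm_sub_rev, K.len_symm]; exact hbc i hi hai hbi
  · exact absurd (third_eq hf ha hb hi hj hab hai hbi haj hbj) hij

lemma exists_develops {f : Finset V} (hf : f ∈ K.faces) : ∃ P, K.Develops P f := by
  rcases (K.nonempty_of_mem f hf).exists_eq_singleton_or_nontrivial with ⟨a, rfl⟩ | ⟨a, ha, b, hb, hab⟩
  · refine ⟨0, fun i hi j hj => ?_⟩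
    rw [Finset.mem_singleton] at hi hj
    subst hi; subst hj; simp [K.len_self]
  · exact ⟨_, develops_place hab (σ := 1) (by simp) hf ha hb⟩

lemma cellDist_nonneg (a b : V → ℝ) : 0 ≤ K.cellDist a b := Real.sqrt_nonneg _

lemma cellDist_self (a : V → ℝ) : K.cellDist a a = 0 := by simp [cellDist, cellInner]

lemma cellDist_comm (a b : V → ℝ) : K.cellDist a b = K.cellDist b a := by
  simp only [cellDist, cellInner]
  congr 2
  refine Finset.sum_congr rfl fun i _ => Finset.sum_congr rfl fun j _ => ?_
  simp only [Pi.sub_apply]; ring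

/-! ### The intrinsic metric -/

variable (K) in
/-- There is a path of length `L` from `a` to `b`. -/
def Reach (a b : V → ℝ) (L : ℝ) : Prop :=
  ∃ n w, K.IsPath a b n w ∧ L = ∑ i ∈ Finset.range n, K.cellDist (w i) (w (i + 1))

lemma Reach.nonneg {a b : V → ℝ} {L : ℝ} (h : K.Reach a b L) : 0 ≤ L := by
  obtain ⟨n, w, -, rfl⟩ := h
  exact Finset.sum_nonneg fun i _ => cellDist_nonneg _ _

lemma reach_refl (a : V → ℝ) : K.Reach a a 0 :=
  ⟨0, fun _ => a, ⟨rfl, rfl, by simp⟩, by simp⟩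

lemma reach_step {f : Finset V} (hf : f ∈ K.faces) {a b : V → ℝ} (ha : a ∈ cell f)
    (hb : b ∈ cell f) : K.Reach a b (K.cellDist a b) := by
  refine ⟨1, fun i => if i = 0 then a else b, ⟨by simp, by simp, ?_⟩, by simp⟩
  intro i hi
  obtain rfl : i = 0 := by omega
  exact ⟨f, hf, by simpa using ha, by simpa using hb⟩

lemma Reach.trans {a b c : V → ℝ} {L M : ℝ} (h : K.Reach a b L) (h' : K.Reach b c M) :
    K.Reach a c (L + M) := by
  obtain ⟨n, w, ⟨h0, hn, hw⟩, rfl⟩ := h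
  obtain ⟨m, w', ⟨h0', hm', hw'⟩, rfl⟩ := h'
  have e1 : ∀ i ≤ n, (if i ≤ n then w i else w' (i - n)) = w i := fun i hi => by simp [hi]
  have e2 : ∀ i, (if n + i ≤ n then w (n + i) else w' (n + i - n)) = w' i := by
    intro i
    split_ifs with hi
    · obtain rfl : i = 0 := by omega
      rw [add_zero, hn, h0']
    · simp
  refine ⟨n + m, fun i => if i ≤ n then w i else w' (i - n), ⟨?_, ?_, ?_⟩, ?_⟩
  · simp [h0]
  · exact (e2 m).trans hm'
  · intro i hi
    rcases lt_or_ge i n with hin | hin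
    · obtain ⟨f, hf, h1, h2⟩ := hw i hin
      refine ⟨f, hf, ?_, ?_⟩
      · simp only [e1 i hin.le]; exact h1
      · simp only [e1 (i + 1) hin]; exact h2
    · obtain ⟨k, rfl⟩ := Nat.exists_eq_add_of_le hin
      obtain ⟨f, hf, h1, h2⟩ := hw' k (by omega)
      refine ⟨f, hf, ?_, ?_⟩
      · simp only [e2 k]; exact h1
      · simp only [add_assoc, e2 (k + 1)]; exact h2
  · rw [Finset.sum_range_add]
    congr 1
    · refine Finset.sum_congr rfl fun i hi => ?_
      have := Finset.mem_range.1 hi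
      simp only [e1 i this.le, e1 (i + 1) this]
    · refine Finset.sum_congr rfl fun i hi => ?_
      simp only [add_assoc, e2]

lemma Reach.symm {a b : V → ℝ} {L : ℝ} (h : K.Reach a b L) : K.Reach b a L := by
  obtain ⟨n, w, ⟨h0, hn, hw⟩, rfl⟩ := h
  refine ⟨n, fun i => w (n - i), ⟨by simpa using hn, by simpa using h0, ?_⟩, ?_⟩
  · intro i hi
    obtain ⟨f, hf, h1, h2⟩ := hw (n - (i + 1)) (by omega)
    rw [show n - (i + 1) + 1 = n - i by omega] at h2
    exact ⟨f, hf, h2, h1⟩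
  · rw [← Finset.sum_range_reflect]
    refine Finset.sum_congr rfl fun i hi => ?_
    have := Finset.mem_range.1 hi
    rw [cellDist_comm, show n - 1 - i + 1 = n - i by omega, show n - 1 - i = n - (i + 1) by omega]

lemma intrinsicDist_eq (a b : V → ℝ) : K.intrinsicDist a b = sInf {L | K.Reach a b L} := rfl

lemma bddBelow_reach (a b : V → ℝ) : BddBelow {L | K.Reach a b L} := ⟨0, fun _ h => h.nonneg⟩

lemma Reach.le {a b : V → ℝ} {L : ℝ} (h : K.Reach a b L) : K.intrinsicDist a b ≤ L :=
  csInf_le (bddBelow_reach a b) h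

lemma intrinsicDist_nonneg (a b : V → ℝ) : 0 ≤ K.intrinsicDist a b :=
  Real.sInf_nonneg fun _ h => Reach.nonneg h

lemma intrinsicDist_self (a : V → ℝ) : K.intrinsicDist a a = 0 :=
  le_antisymm (reach_refl a).le (intrinsicDist_nonneg a a)

lemma intrinsicDist_comm (a b : V → ℝ) : K.intrinsicDist a b = K.intrinsicDist b a := by
  rw [intrinsicDist_eq, intrinsicDist_eq]
  congr 1; ext L; exact ⟨Reach.symm, Reach.symm⟩

/-- Definiteness needs no lower bound on path lengths: a geodesic of length zero is a single point.
-/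
lemma IsCAT0.eq_of_dist (hK : K.IsCAT0) {a b : V → ℝ} (ha : a ∈ K.space) (hb : b ∈ K.space)
    (h : K.intrinsicDist a b = 0) : a = b := by
  obtain ⟨S, l, g, hl, rfl, rfl, -, hg, -⟩ := hK.1 a ha b hb
  have := hg 0 ⟨le_rfl, hl⟩ l ⟨hl, le_rfl⟩
  rw [h, zero_sub, abs_neg, abs_of_nonneg hl] at this
  rw [this]

/-- Points joined by no path would get the distance `sInf ∅ = 0`, hence would coincide. -/
lemma IsCAT0.exists_reach (hK : K.IsCAT0) {a b : V → ℝ} (ha : a ∈ K.space) (hb : b ∈ K.space) :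
    ∃ L, K.Reach a b L := by
  by_contra h
  have : {L | K.Reach a b L} = ∅ := by
    ext L; simp only [mem_ofPred_eq, mem_empty_iff_false, iff_false]; exact fun hL => h ⟨L, hL⟩
  obtain rfl := hK.eq_of_dist ha hb (by rw [intrinsicDist_eq, this, Real.sInf_empty])
  exact h ⟨0, reach_refl a⟩

lemma IsCAT0.exists_reach_lt (hK : K.IsCAT0) {a b : V → ℝ} (ha : a ∈ K.space) (hb : b ∈ K.space)
    {M : ℝ} (h : K.intrinsicDist a b < M) : ∃ L, K.Reach a b L ∧ L < M := by
  obtain ⟨L, hL, hM⟩ := exists_lt_of_csInf_lt (s := {L | K.Reach a b L})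
    (hK.exists_reach ha hb) h
  exact ⟨L, hL, hM⟩

lemma IsCAT0.triangle (hK : K.IsCAT0) {a b c : V → ℝ} (ha : a ∈ K.space) (hb : b ∈ K.space)
    (hc : c ∈ K.space) : K.intrinsicDist a c ≤ K.intrinsicDist a b + K.intrinsicDist b c := by
  refine le_of_forall_pos_lt_add fun ε hε => ?_
  obtain ⟨L, hL, hL'⟩ := hK.exists_reach_lt ha hb (M := K.intrinsicDist a b + ε / 2) (by linarith)
  obtain ⟨M, hM, hM'⟩ := hK.exists_reach_lt hb hc (M := K.intrinsicDist b c + ε / 2) (by linarith)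
  linarith [(hL.trans hM).le]

lemma mem_space {f : Finset V} (hf : f ∈ K.faces) {x : V → ℝ} (hx : x ∈ cell f) : x ∈ K.space :=
  ⟨f, hf, hx⟩

variable (K) in
/-- The points of a CAT(0) complex, with the intrinsic metric. -/
def Pt (_ : K.IsCAT0) : Type _ := {x : V → ℝ // x ∈ K.space}

/-- The barycentric coordinates of a point. -/
def Pt.val {hK : K.IsCAT0} (a : K.Pt hK) : V → ℝ := Subtype.val a

variable {hK : K.IsCAT0}

lemma Pt.mem (a : K.Pt hK) : a.val ∈ K.space := a.2

lemma Pt.val_injective : Function.Injective (Pt.val : K.Pt hK → V → ℝ) := Subtype.val_injective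

@[ext] lemma Pt.ext {a b : K.Pt hK} (h : a.val = b.val) : a = b := Pt.val_injective h

/-- The point with the given coordinates. -/
def IsCAT0.mk (hK : K.IsCAT0) (x : V → ℝ) (hx : x ∈ K.space) : K.Pt hK := ⟨x, hx⟩

@[simp] lemma IsCAT0.mk_val (hK : K.IsCAT0) (x : V → ℝ) (hx : x ∈ K.space) :
    (hK.mk x hx).val = x := rfl

noncomputable instance : MetricSpace (K.Pt hK) where
  dist a b := K.intrinsicDist a.val b.val
  dist_self a := intrinsicDist_self _
  dist_comm a b := intrinsicDist_comm _ _
  dist_triangle a b c := hK.triangle a.mem b.mem c.mem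
  eq_of_dist_eq_zero {a b} h := Pt.ext (hK.eq_of_dist a.mem b.mem h)

lemma Pt.dist_def (a b : K.Pt hK) : dist a b = K.intrinsicDist a.val b.val := rfl

lemma dist_le_cellDist {f : Finset V} (hf : f ∈ K.faces) {a b : K.Pt hK} (ha : a.val ∈ cell f)
    (hb : b.val ∈ cell f) : dist a b ≤ K.cellDist a.val b.val := (reach_step hf ha hb).le

/-! ### Supports -/

open Classical in
/-- The vertices of the smallest cell that contains a point. -/
noncomputable def supp (x : V → ℝ) : Finset V := Finset.univ.filter fun v => x v ≠ 0

@[simp] lemma mem_supp {x : V → ℝ} {v : V} : v ∈ supp x ↔ x v ≠ 0 := by simp [supp]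

lemma supp_subset {x : V → ℝ} {f : Finset V} (h : x ∈ cell f) : supp x ⊆ f := by
  intro v hv
  by_contra hvf
  exact mem_supp.1 hv (h.2.2 v hvf)

lemma supp_nonempty {x : V → ℝ} {f : Finset V} (h : x ∈ cell f) : (supp x).Nonempty := by
  by_contra hn
  rw [Finset.not_nonempty_iff_eq_empty] at hn
  have : ∀ v, x v = 0 := fun v => by
    by_contra hv
    have := mem_supp.2 hv
    rw [hn] at this; simp at this
  have h1 := h.2.1
  simp [this] at h1

lemma Pt.supp_mem (a : K.Pt hK) : supp a.val ∈ K.faces := by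
  obtain ⟨f, hf, h⟩ := a.mem
  exact mem_faces_sub hf (supp_subset h) (supp_nonempty h)

lemma Pt.nonneg (a : K.Pt hK) (v : V) : 0 ≤ a.val v := by
  obtain ⟨f, hf, h⟩ := a.mem; exact h.1 v

lemma Pt.sum_eq (a : K.Pt hK) : ∑ v, a.val v = 1 := by
  obtain ⟨f, hf, h⟩ := a.mem; exact h.2.1

lemma Pt.mem_cell_iff {a : K.Pt hK} {f : Finset V} : a.val ∈ cell f ↔ supp a.val ⊆ f := by
  refine ⟨supp_subset, fun h => ⟨a.nonneg, a.sum_eq, fun v hv => ?_⟩⟩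
  by_contra hne
  exact hv (h (mem_supp.2 hne))

lemma Pt.mem_cell_supp (a : K.Pt hK) : a.val ∈ cell (supp a.val) :=
  Pt.mem_cell_iff.2 subset_rfl

lemma isClosed_cell (f : Finset V) : IsClosed (cell f) := by
  have : cell f = (⋂ v, {x | 0 ≤ x v}) ∩ ({x | ∑ v, x v = 1} ∩ ⋂ v, ⋂ (_ : v ∉ f), {x | x v = 0}) := by
    ext x; simp [cell]
  rw [this]
  refine (isClosed_iInter fun v => isClosed_le continuous_const (continuous_apply v)).inter
    ((isClosed_eq (by fun_prop) continuous_const).inter ?_)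
  exact isClosed_iInter fun v => isClosed_iInter fun _ =>
    isClosed_eq (continuous_apply v) continuous_const

lemma isCompact_cell (f : Finset V) : IsCompact (cell f) := by
  refine IsCompact.of_isClosed_subset (isCompact_univ_pi (s := fun _ : V => Icc (0 : ℝ) 1)
    fun _ => isCompact_Icc) (isClosed_cell f) ?_
  intro x hx v _
  refine ⟨hx.1 v, ?_⟩
  rw [← hx.2.1]
  exact Finset.single_le_sum (fun i _ => hx.1 i) (Finset.mem_univ v)

variable (K) in
lemma isCompact_space : IsCompact K.space := by
  have : K.space = ⋃ f ∈ K.faces, cell f := by ext x; simp [space]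
  rw [this]
  exact (Set.toFinite K.faces).isCompact_biUnion fun f _ => isCompact_cell f

lemma continuous_cellDist (a : V → ℝ) : Continuous (K.cellDist a) := by
  unfold cellDist cellInner
  fun_prop

lemma supp_nhds (x : V → ℝ) : ∀ᶠ y in nhds x, supp x ⊆ supp y := by
  have : ∀ v ∈ supp x, ∀ᶠ y in nhds x, y v ≠ 0 := fun v hv =>
    (continuous_apply v).continuousAt.eventually_ne (mem_supp.1 hv)
  rw [← Finset.eventually_all] at this
  filter_upwards [this] with y hy v hv
  exact mem_supp.2 (hy v hv)

/-- The identity from the subspace topology to the metric topology. -/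
def toPt (hK : K.IsCAT0) (x : K.space) : K.Pt hK := ⟨x.1, x.2⟩

/-- The support can only grow near a point, so nearby points share a cell with it and the distance
is at most the distance in that cell. -/
lemma continuous_toPt : Continuous (toPt hK) := by
  rw [continuous_iff_continuousAt]
  intro x
  rw [ContinuousAt, tendsto_iff_dist_tendsto_zero]
  have h1 : Filter.Tendsto (fun y : K.space => K.cellDist x.1 y.1) (nhds x) (nhds 0) := by
    have : Continuous fun y : K.space => K.cellDist x.1 y.1 :=
      (continuous_cellDist _).comp continuous_subtype_val
    have := this.tendsto x
    rwa [cellDist_self] at this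
  refine squeeze_zero' (Filter.Eventually.of_forall fun _ => dist_nonneg) ?_ h1
  have h2 : ∀ᶠ y : K.space in nhds x, supp x.1 ⊆ supp y.1 :=
    continuous_subtype_val.continuousAt.eventually (supp_nhds x.1)
  filter_upwards [h2] with y hy
  rw [dist_comm]
  exact dist_le_cellDist (toPt hK y).supp_mem (Pt.mem_cell_iff.2 hy) (toPt hK y).mem_cell_supp

instance : CompactSpace K.space := isCompact_iff_compactSpace.1 K.isCompact_space

instance : CompactSpace (K.Pt hK) :=
  Function.Surjective.compactSpace (f := toPt hK) continuous_toPt fun y => ⟨⟨y.1, y.2⟩, rfl⟩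

/-- A continuous bijection from a compact space to a Hausdorff space. Topological notions in
coordinates and in the intrinsic metric therefore agree. -/
lemma isHomeomorph_toPt : IsHomeomorph (toPt hK) :=
  isHomeomorph_iff_continuous_bijective.2
    ⟨continuous_toPt, fun _ _ h => Subtype.ext (congrArg Pt.val h), fun y => ⟨⟨y.1, y.2⟩, rfl⟩⟩

lemma Pt.isClosedEmbedding_val : Topology.IsClosedEmbedding (Pt.val : K.Pt hK → V → ℝ) := by
  have h1 : Topology.IsClosedEmbedding (Subtype.val : K.space → V → ℝ) :=
    K.isCompact_space.isClosed.isClosedEmbedding_subtypeVal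
  have e : (Pt.val : K.Pt hK → V → ℝ) = Subtype.val ∘ (isHomeomorph_toPt (hK := hK)).homeomorph.symm := by
    ext y v
    obtain ⟨x, rfl⟩ := (isHomeomorph_toPt (hK := hK)).surjective y
    have : (isHomeomorph_toPt (hK := hK)).homeomorph.symm (toPt hK x) = x :=
      (isHomeomorph_toPt (hK := hK)).homeomorph.symm_apply_apply x
    rw [Function.comp_apply, this]; rfl
  rw [e]
  exact h1.comp (Homeomorph.isClosedEmbedding _)

lemma Pt.continuous_val : Continuous (Pt.val : K.Pt hK → V → ℝ) :=
  Pt.isClosedEmbedding_val.continuous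

/-- Points near `a` lie in cells that contain `a`. -/
lemma Pt.exists_star (a : K.Pt hK) : ∃ ε > 0, ∀ y : K.Pt hK, dist a y < ε →
    supp a.val ⊆ supp y.val := by
  have h := Pt.continuous_val.continuousAt.eventually (supp_nhds a.val)
  obtain ⟨ε, hε, h⟩ := Metric.eventually_nhds_iff.1 h
  exact ⟨ε, hε, fun y hy => h (by rwa [dist_comm])⟩

/-! ### The CAT(0) inequality -/

lemma exists_seg_of_isGeodesic {a b : V → ℝ} {S : Set (V → ℝ)}
    (h : K.IsGeodesic a b S) {y : V → ℝ} (hy : y ∈ S) :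
    y ∈ K.space ∧ K.intrinsicDist a y + K.intrinsicDist y b = K.intrinsicDist a b := by
  obtain ⟨l, g, hl, rfl, rfl, hs, hg, rfl⟩ := h
  obtain ⟨t, ht, rfl⟩ := hy
  refine ⟨hs t ht, ?_⟩
  rw [hg 0 ⟨le_rfl, hl⟩ t ht, hg t ht l ⟨hl, le_rfl⟩, hg 0 ⟨le_rfl, hl⟩ l ⟨hl, le_rfl⟩,
    abs_of_nonpos (by linarith [ht.1]), abs_of_nonpos (by linarith [ht.2]),
    abs_of_nonpos (by linarith)]
  ring

/-- Two geodesics whose lengths add up to the distance of the endpoints can be concatenated. -/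
lemma isGeodesic_concat (hK : K.IsCAT0) {a y b : V → ℝ} (ha : a ∈ K.space)
    (hy : y ∈ K.space) (hb : b ∈ K.space)
    (h : K.intrinsicDist a y + K.intrinsicDist y b = K.intrinsicDist a b) :
    ∃ S, K.IsGeodesic a b S ∧ y ∈ S := by
  obtain ⟨S₁, l₁, g₁, hl₁, h10, h11, hs₁, hg₁, -⟩ := hK.1 a ha y hy
  obtain ⟨S₂, l₂, g₂, hl₂, h20, h21, hs₂, hg₂, -⟩ := hK.1 y hy b hb
  have d1 : K.intrinsicDist a y = l₁ := by
    have := hg₁ 0 ⟨le_rfl, hl₁⟩ l₁ ⟨hl₁, le_rfl⟩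
    rwa [h10, h11, zero_sub, abs_neg, abs_of_nonneg hl₁] at this
  have d2 : K.intrinsicDist y b = l₂ := by
    have := hg₂ 0 ⟨le_rfl, hl₂⟩ l₂ ⟨hl₂, le_rfl⟩
    rwa [h20, h21, zero_sub, abs_neg, abs_of_nonneg hl₂] at this
  set g : ℝ → V → ℝ := fun t => if t ≤ l₁ then g₁ t else g₂ (t - l₁)
  have e1 : ∀ t, t ≤ l₁ → g t = g₁ t := fun t ht => by simp [g, ht]
  have e2 : ∀ t, l₁ ≤ t → g t = g₂ (t - l₁) := by
    intro t ht
    rcases ht.eq_or_lt with rfl | ht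
    · simp [g, h11, h20]
    · simp [g, not_le.2 ht]
  have hsp : ∀ t ∈ Icc 0 (l₁ + l₂), g t ∈ K.space := by
    intro t ht
    rcases le_total t l₁ with h | h
    · rw [e1 t h]; exact hs₁ t ⟨ht.1, h⟩
    · rw [e2 t h]; exact hs₂ _ ⟨by linarith, by linarith [ht.2]⟩
  have hmix : ∀ t ∈ Icc 0 (l₁ + l₂), ∀ t' ∈ Icc 0 (l₁ + l₂), t ≤ t' →
      K.intrinsicDist (g t) (g t') = t' - t := by
    intro t ht t' ht' htt
    rcases le_total t' l₁ with h' | h'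
    · rw [e1 t (htt.trans h'), e1 t' h', hg₁ t ⟨ht.1, htt.trans h'⟩ t' ⟨ht'.1, h'⟩,
        abs_of_nonpos (by linarith)]; ring
    rcases le_total l₁ t with h'' | h''
    · rw [e2 t h'', e2 t' h', hg₂ _ ⟨by linarith, by linarith [ht.2]⟩ _
        ⟨by linarith, by linarith [ht'.2]⟩, abs_of_nonpos (by linarith)]; ring
    -- The two points are on different pieces: passing through `y` bounds their distance from above,
    -- and a smaller value would shorten the way from `a` to `b`.
    · have u1 := hK.triangle (hsp t ht) hy (hsp t' ht')
      have u2 := hK.triangle ha (hsp t ht) hb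
      have u3 := hK.triangle (hsp t ht) (hsp t' ht') hb
      rw [e1 t h'', e2 t' h'] at *
      have v1 := hg₁ t ⟨ht.1, h''⟩ l₁ ⟨hl₁, le_rfl⟩
      have v2 := hg₁ 0 ⟨le_rfl, hl₁⟩ t ⟨ht.1, h''⟩
      have v3 := hg₂ 0 ⟨le_rfl, hl₂⟩ (t' - l₁) ⟨by linarith, by linarith [ht'.2]⟩
      have v4 := hg₂ (t' - l₁) ⟨by linarith, by linarith [ht'.2]⟩ l₂ ⟨hl₂, le_rfl⟩
      rw [abs_of_nonpos (by linarith)] at v1 v3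
      rw [abs_of_nonpos (by linarith [ht.1])] at v2
      rw [abs_of_nonpos (by linarith [ht'.2])] at v4
      rw [h11] at v1
      rw [h10] at v2
      rw [h20] at v3
      rw [h21] at v4
      linarith
  refine ⟨g '' Icc 0 (l₁ + l₂), ⟨l₁ + l₂, g, by linarith, ?_, ?_, hsp, ?_, rfl⟩, ?_⟩
  · rw [e1 0 hl₁, h10]
  · rw [e2 _ (by linarith), add_sub_cancel_left, h21]
  · intro t ht t' ht'
    rcases le_total t t' with h | h
    · rw [hmix t ht t' ht' h, abs_of_nonpos (by linarith)]; ring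
    · rw [intrinsicDist_comm, hmix t' ht' t ht h, abs_of_nonneg (by linarith)]
  · exact ⟨l₁, ⟨hl₁, by linarith⟩, by rw [e1 _ le_rfl, h11]⟩

/-- `γ(a, b)` is the metric segment. -/
lemma geod_eq (a b : K.Pt hK) : K.geod a.val b.val = Pt.val '' seg a b := by
  ext y
  constructor
  · rintro ⟨S, hS, hy⟩
    obtain ⟨h1, h2⟩ := exists_seg_of_isGeodesic hS hy
    exact ⟨hK.mk y h1, h2, rfl⟩
  · rintro ⟨y, hy, rfl⟩
    exact isGeodesic_concat hK a.mem y.mem b.mem hy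

lemma mem_geod {a b y : K.Pt hK} : y.val ∈ K.geod a.val b.val ↔ y ∈ seg a b := by
  rw [geod_eq]
  exact Pt.val_injective.mem_set_image

/-- Stewart's theorem in the plane, with an existence statement for the triangle. -/
lemma exists_comparison {D a b s : ℝ} (hD : 0 < D) (ha : 0 ≤ a) (hb : 0 ≤ b)
    (h1 : D ≤ a + b) (h2 : a ≤ D + b) (h3 : b ≤ D + a) (hs : s ∈ Icc (0 : ℝ) 1) :
    ∃ x₁ x₂ x₃ y : EuclideanSpace ℝ (Fin 2), dist x₁ x₂ = D ∧ dist x₁ x₃ = a ∧ dist x₂ x₃ = b ∧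
      y ∈ segment ℝ x₁ x₂ ∧ dist x₁ y = s * D ∧ dist x₂ y = (1 - s) * D ∧
      dist x₃ y ^ 2 = (1 - s) * a ^ 2 + s * b ^ 2 - s * (1 - s) * D ^ 2 := by
  -- The abscissa of the third corner, when the first two are placed at `0` and `D` on an axis.
  obtain ⟨u, hu⟩ : ∃ u, u = (a ^ 2 + D ^ 2 - b ^ 2) / (2 * D) := ⟨_, rfl⟩
  have hu' : u * (2 * D) = a ^ 2 + D ^ 2 - b ^ 2 := by rw [hu]; field_simp
  have h0 : 0 ≤ a ^ 2 - u ^ 2 := by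
    have h4 : 0 ≤ (b - a + D) * (b + a - D) * ((a + D - b) * (a + D + b)) :=
      mul_nonneg (mul_nonneg (by linarith) (by linarith)) (mul_nonneg (by linarith) (by linarith))
    have h5 : (a ^ 2 - u ^ 2) * (2 * D) ^ 2 =
        (b - a + D) * (b + a - D) * ((a + D - b) * (a + D + b)) := by
      rw [sub_mul, ← mul_pow u, hu']; ring
    by_contra hneg
    push Not at hneg
    have : (a ^ 2 - u ^ 2) * (2 * D) ^ 2 < 0 := mul_neg_of_neg_of_pos hneg (by positivity)
    linarith
  have hv := Real.sq_sqrt h0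
  set v := √(a ^ 2 - u ^ 2)
  refine ⟨!₂[0, 0], !₂[D, 0], !₂[u, v], !₂[s * D, 0], ?_, ?_, ?_, ?_, ?_, ?_, ?_⟩
  · rw [EuclideanSpace.dist_eq]; simp [Real.dist_eq, Real.sqrt_sq hD.le]
  · rw [EuclideanSpace.dist_eq]
    simp only [Fin.sum_univ_two, Real.dist_eq, sq_abs]
    simp only [Matrix.cons_val_zero, Matrix.cons_val_one]
    rw [show (0 - u) ^ 2 + (0 - v) ^ 2 = a ^ 2 by rw [zero_sub, zero_sub, neg_sq, neg_sq, hv]; ring,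
      Real.sqrt_sq ha]
  · rw [EuclideanSpace.dist_eq]
    simp only [Fin.sum_univ_two, Real.dist_eq, sq_abs]
    simp only [Matrix.cons_val_zero, Matrix.cons_val_one]
    rw [show (D - u) ^ 2 + (0 - v) ^ 2 = b ^ 2 by rw [zero_sub, neg_sq, hv]; linarith,
      Real.sqrt_sq hb]
  · refine ⟨1 - s, s, by linarith [hs.2], hs.1, by ring, ?_⟩
    ext i; fin_cases i <;> simp
  · rw [EuclideanSpace.dist_eq]
    simp only [Fin.sum_univ_two, Real.dist_eq, sq_abs]
    simp only [Matrix.cons_val_zero, Matrix.cons_val_one]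
    rw [show (0 - s * D) ^ 2 + (0 - 0) ^ 2 = (s * D) ^ 2 by ring,
      Real.sqrt_sq (mul_nonneg hs.1 hD.le)]
  · rw [EuclideanSpace.dist_eq]
    simp only [Fin.sum_univ_two, Real.dist_eq, sq_abs]
    simp only [Matrix.cons_val_zero, Matrix.cons_val_one]
    rw [show (D - s * D) ^ 2 + ((0 : ℝ) - 0) ^ 2 = ((1 - s) * D) ^ 2 by ring,
      Real.sqrt_sq (mul_nonneg (by linarith [hs.2]) hD.le)]
  · rw [EuclideanSpace.dist_eq]
    simp only [Fin.sum_univ_two, Real.dist_eq, sq_abs]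
    simp only [Matrix.cons_val_zero, Matrix.cons_val_one]
    rw [Real.sq_sqrt (by positivity), sub_zero, hv]
    linear_combination -s * hu'

/-- The comparison axiom concerns three distinct points; the degenerate triangles satisfy Stewart's
relation with equality and are treated apart. -/
instance : CatZero (K.Pt hK) where
  exists_between a b s hs := by
    obtain ⟨S, l, g, hl, h0, h1, hsp, hg, -⟩ := hK.1 a.val a.mem b.val b.mem
    have d : dist a b = l := by
      have := hg 0 ⟨le_rfl, hl⟩ l ⟨hl, le_rfl⟩
      rwa [h0, h1, zero_sub, abs_neg, abs_of_nonneg hl] at this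
    have hsl : s * l ∈ Icc 0 l := ⟨mul_nonneg hs.1 hl, mul_le_of_le_one_left hl hs.2⟩
    refine ⟨hK.mk _ (hsp _ hsl), ?_, ?_⟩
    · rw [Pt.dist_def, IsCAT0.mk_val, d, ← h0, hg 0 ⟨le_rfl, hl⟩ _ hsl, zero_sub, abs_neg,
        abs_of_nonneg hsl.1]
    · rw [Pt.dist_def, IsCAT0.mk_val, d, ← h1, hg _ hsl l ⟨hl, le_rfl⟩,
        abs_of_nonpos (by linarith [hsl.2])]; ring
  stewart a b c y s hs h1 h2 := by
    have hy : dist a y + dist y b = dist a b := by rw [h1, h2]; ring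
    rcases eq_or_ne a b with rfl | hab
    · rw [dist_self, mul_zero] at h1
      rw [← dist_eq_zero.1 h1, dist_self]
      apply le_of_eq; ring
    have hs1 := hs.1
    have hs2 := hs.2
    have hD := dist_pos.2 hab
    rcases eq_or_ne a c with rfl | hac
    · rw [h1, dist_self]; apply le_of_eq; ring
    rcases eq_or_ne b c with rfl | hbc
    · rw [dist_comm b y, h2, dist_self, dist_comm b a]; apply le_of_eq; ring
    obtain ⟨x₁, x₂, x₃, y', e1, e2, e3, e4, e5, e6, e7⟩ := exists_comparison hD
      (dist_nonneg (x := a) (y := c)) (dist_nonneg (x := b) (y := c))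
      (by rw [dist_comm b c]; exact dist_triangle _ _ _) (dist_triangle _ _ _)
      (by rw [dist_comm a b]; exact dist_triangle _ _ _) hs
    obtain ⟨S, hS, hyS⟩ := isGeodesic_concat hK a.mem y.mem b.mem hy
    have hne : ∀ {u v : K.Pt hK}, u ≠ v → u.val ≠ v.val := fun h h' => h (Pt.ext h')
    have := hK.2 a.val a.mem b.val b.mem c.val c.mem (hne hab) (hne hbc) (hne hac) S hS y.val hyS
      x₁ x₂ x₃ y' e1 e3 e2 e4 (e5.trans h1.symm) (e6.trans (by rw [← h2, dist_comm]; rfl))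
    rw [dist_comm c a, dist_comm c b, ← e7]
    exact pow_le_pow_left₀ dist_nonneg this 2

/-! ### Developing a neighbourhood -/

/-- If `P` develops all cells around `u`, then near `u` the development does not increase
distances. -/
lemma exists_dist_ge (u : K.Pt hK) {P : V → ℂ}
    (hP : ∀ f ∈ K.faces, supp u.val ⊆ f → K.Develops P f) :
    ∃ ε > 0, ∀ a b : K.Pt hK, dist u a < ε → dist u b < ε →
      ‖lin P a.val - lin P b.val‖ ≤ dist a b := by
  obtain ⟨ρ, hρ, hstar⟩ := u.exists_star
  refine ⟨ρ / 4, by positivity, fun a b ha hb => ?_⟩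
  refine le_of_forall_pos_le_add fun δ hδ => ?_
  have hab : dist a b < ρ / 2 := by linarith [dist_triangle a u b, dist_comm a u]
  -- An almost shortest path stays within `ρ` of `u`: it starts at distance less than `ρ / 4` and is
  -- shorter than `ρ / 2 + ρ / 8`. All its cells thus contain `u`, and the development preserves the
  -- length of each step.
  obtain ⟨L, ⟨n, w, ⟨h0, hn, hw⟩, rfl⟩, hL⟩ := hK.exists_reach_lt a.mem b.mem
    (M := dist a b + min δ (ρ / 8)) (by rw [← Pt.dist_def]; linarith [show 0 < min δ (ρ / 8) by positivity])
  have hsum : ∀ k ≤ n, K.Reach a.val (w k)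
      (∑ i ∈ Finset.range k, K.cellDist (w i) (w (i + 1))) := fun k hk =>
    ⟨k, w, ⟨h0, rfl, fun i hi => hw i (by omega)⟩, rfl⟩
  have hmono : ∀ k ≤ n, ∑ i ∈ Finset.range k, K.cellDist (w i) (w (i + 1)) ≤
      ∑ i ∈ Finset.range n, K.cellDist (w i) (w (i + 1)) := fun k hk =>
    Finset.sum_le_sum_of_subset_of_nonneg (Finset.range_mono hk) fun i _ _ => cellDist_nonneg _ _
  have hd : ∀ k < n, ‖lin P (w k) - lin P (w (k + 1))‖ = K.cellDist (w k) (w (k + 1)) := by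
    intro k hk
    obtain ⟨f, hf, h1, h2⟩ := hw k hk
    have h3 := (hsum k hk.le).le
    have h4 := hmono k hk.le
    have h5 : dist u (hK.mk (w k) (mem_space hf h1)) < ρ := by
      have h6 := dist_triangle u a (hK.mk (w k) (mem_space hf h1))
      have h7 : dist a (hK.mk (w k) (mem_space hf h1)) = K.intrinsicDist a.val (w k) := rfl
      linarith [min_le_right δ (ρ / 8)]
    have h8 := (hstar _ h5).trans (supp_subset h1)
    exact ((hP f hf h8).cellDist h1 h2).symm
  have htri : ∀ k ≤ n, ‖lin P a.val - lin P (w k)‖ ≤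
      ∑ i ∈ Finset.range k, K.cellDist (w i) (w (i + 1)) := by
    intro k
    induction k with
    | zero => intro _; simp [h0]
    | succ k ih =>
      intro hk
      rw [Finset.sum_range_succ, ← hd k hk]
      refine (norm_sub_le_norm_sub_add_norm_sub _ (lin P (w k)) _).trans ?_
      linarith [ih (by omega)]
  have := htri n le_rfl
  rw [hn] at this
  linarith [min_le_left δ (ρ / 8)]

end TriComplex

namespace TriComplex

open CatZero

variable {V : Type*} [Fintype V] [DecidableEq V] {K : TriComplex V} {hK : K.IsCAT0}

/-! ### Cells are convex -/

lemma convex_cell (f : Finset V) : Convex ℝ (cell f) := by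
  intro x hx y hy s t hs ht hst
  refine ⟨fun v => ?_, ?_, fun v hv => ?_⟩
  · exact add_nonneg (mul_nonneg hs (hx.1 v)) (mul_nonneg ht (hy.1 v))
  · simp only [Pi.add_apply, Pi.smul_apply, smul_eq_mul, Finset.sum_add_distrib, ← Finset.mul_sum]
    rw [hx.2.1, hy.2.1]; linarith
  · simp [hx.2.2 v hv, hy.2.2 v hv]

lemma lin_comb (P : V → ℂ) (s t : ℝ) (x y : V → ℝ) :
    lin P (s • x + t • y) = s • lin P x + t • lin P y := by
  simp only [lin, Pi.add_apply, Pi.smul_apply, smul_eq_mul, add_smul, Finset.sum_add_distrib,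
    mul_smul, Finset.smul_sum]

/-- The point is a vertex of the complex. -/
def Pt.IsVertex (u : K.Pt hK) : Prop := ∃ v, u.val = vertexPoint v

lemma Pt.isVertex_of_supp_subset {u : K.Pt hK} {v : V} (h : supp u.val ⊆ {v}) :
    u.val = vertexPoint v := by
  have h0 : ∀ w, w ≠ v → u.val w = 0 := fun w hw => by
    by_contra hne
    exact hw (by simpa using h (mem_supp.2 hne))
  have h1 := u.sum_eq
  rw [Finset.sum_eq_single v (fun w _ hw => h0 w hw) (by simp)] at h1
  ext w
  rcases eq_or_ne w v with rfl | hw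
  · simp [vertexPoint, h1]
  · simp [vertexPoint, hw, h0 w hw]

lemma Pt.exists_ne {u : K.Pt hK} (hu : ¬ u.IsVertex) :
    ∃ a ∈ supp u.val, ∃ b ∈ supp u.val, a ≠ b := by
  obtain ⟨a, ha⟩ := supp_nonempty u.mem_cell_supp
  by_contra! h
  exact hu ⟨a, Pt.isVertex_of_supp_subset fun b hb => by
    rw [Finset.mem_singleton]; exact (h a ha b hb).symm⟩

lemma Pt.val_le_one (u : K.Pt hK) (v : V) : u.val v ≤ 1 := by
  rw [← u.sum_eq]
  exact Finset.single_le_sum (fun i _ => u.nonneg i) (Finset.mem_univ v)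

lemma Pt.pos {u : K.Pt hK} {v : V} (h : v ∈ supp u.val) : 0 < u.val v :=
  lt_of_le_of_ne (u.nonneg v) (mem_supp.1 h).symm

lemma develops_star {u : K.Pt hK} {a b : V} (ha : a ∈ supp u.val) (hb : b ∈ supp u.val)
    (hab : a ≠ b) {σ : V → ℝ} (hσ : ∀ v, σ v ^ 2 = 1) :
    ∀ f ∈ K.faces, supp u.val ⊆ f → K.Develops (K.place a b σ) f :=
  fun _ hf hs => develops_place hab hσ hf (hs ha) (hs hb)

/-- The cells are isometrically embedded. -/
theorem dist_eq_cellDist {f : Finset V} (hf : f ∈ K.faces) {a b : K.Pt hK} (ha : a.val ∈ cell f)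
    (hb : b.val ∈ cell f) : dist a b = K.cellDist a.val b.val := by
  refine le_antisymm (dist_le_cellDist hf ha hb) ?_
  rcases eq_or_ne a b with rfl | hab
  · simp [cellDist_self]
  have hmem : ∀ l ∈ Icc (0 : ℝ) 1, (1 - l) • a.val + l • b.val ∈ cell f := fun l hl =>
    convex_cell f ha hb (by linarith [hl.2]) hl.1 (by ring)
  set γ : ℝ → K.Pt hK := fun l =>
    if hl : l ∈ Icc (0 : ℝ) 1 then hK.mk _ (mem_space hf (hmem l hl)) else a
  have hγ : ∀ l ∈ Icc (0 : ℝ) 1, (γ l).val = (1 - l) • a.val + l • b.val := by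
    intro l hl; simp only [γ, hl, dif_pos, IsCAT0.mk_val]
  have hγf : ∀ l ∈ Icc (0 : ℝ) 1, (γ l).val ∈ cell f := fun l hl => hγ l hl ▸ hmem l hl
  have hlin : ∀ P, K.Develops P f → ∀ l ∈ Icc (0 : ℝ) 1, ∀ m ∈ Icc (0 : ℝ) 1,
      ‖lin P (γ l).val - lin P (γ m).val‖ = K.cellDist a.val b.val * |l - m| := by
    intro P hP l hl m hm
    rw [hγ l hl, hγ m hm, lin_comb, lin_comb, hP.cellDist ha hb]
    have : (1 - l) • lin P a.val + l • lin P b.val - ((1 - m) • lin P a.val + m • lin P b.val)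
        = (m - l) • (lin P a.val - lin P b.val) := by
      simp only [sub_smul, smul_sub, one_smul]; abel
    rw [this, norm_smul, Real.norm_eq_abs, abs_sub_comm]; ring
  obtain ⟨P₀, hP₀⟩ := exists_develops hf
  set L := K.cellDist a.val b.val
  have hL : 0 ≤ L := cellDist_nonneg _ _
  have hup : ∀ l ∈ Icc (0 : ℝ) 1, ∀ m ∈ Icc (0 : ℝ) 1, dist (γ l) (γ m) ≤ L * |l - m| := by
    intro l hl m hm
    rw [← hlin P₀ hP₀ l hl m hm, ← hP₀.cellDist (hγf l hl) (hγf m hm)]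
    exact dist_le_cellDist hf (hγf l hl) (hγf m hm)
  -- An inner point of the affine segment is not a vertex, so its star develops into the plane and
  -- the segment is a local geodesic there. The endpoints may be vertices and are reached by a
  -- limit.
  have hmid : ∀ l m, 0 < l → l ≤ m → m < 1 → dist (γ l) (γ m) = L * (m - l) := by
    intro l m h0 hlm h1
    have hsub : Icc l m ⊆ Icc (0 : ℝ) 1 := Icc_subset_Icc h0.le h1.le
    refine dist_of_local hlm hL ?_ ?_
    · have : LipschitzOnWith (⟨L, hL⟩ : NNReal) γ (Icc l m) :=
        LipschitzOnWith.of_dist_le_mul fun x hx y hy => by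
          rw [Real.dist_eq]; exact hup x (hsub hx) y (hsub hy)
      exact this.continuousOn
    · intro μ hμ
      have hμ01 : 0 < μ ∧ μ < 1 := ⟨h0.trans_le hμ.1, hμ.2.trans_lt h1⟩
      have hnv : ¬ (γ μ).IsVertex := by
        rintro ⟨v, hv⟩
        rw [hγ μ (hsub hμ)] at hv
        have h2 : ∀ w, w ≠ v → a.val w = 0 ∧ b.val w = 0 := by
          intro w hw
          have := congrFun hv w
          simp only [Pi.add_apply, Pi.smul_apply, smul_eq_mul, vertexPoint, Pi.single_apply, hw,
            if_false] at this
          have h3 := mul_nonneg (sub_nonneg.2 hμ01.2.le) (a.nonneg w)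
          have h4 := mul_nonneg hμ01.1.le (b.nonneg w)
          constructor
          · have : (1 - μ) * a.val w = 0 := by linarith
            exact (mul_eq_zero.1 this).resolve_left (by linarith)
          · have : μ * b.val w = 0 := by linarith
            exact (mul_eq_zero.1 this).resolve_left (by linarith)
        have h5 : a.val = vertexPoint v := Pt.isVertex_of_supp_subset fun w hw => by
          rw [Finset.mem_singleton]; by_contra hne; exact mem_supp.1 hw (h2 w hne).1
        have h6 : b.val = vertexPoint v := Pt.isVertex_of_supp_subset fun w hw => by
          rw [Finset.mem_singleton]; by_contra hne; exact mem_supp.1 hw (h2 w hne).2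
        exact hab (Pt.ext (h5.trans h6.symm))
      obtain ⟨i, hi, j, hj, hij⟩ := Pt.exists_ne hnv
      have hdev := develops_star hi hj hij (σ := 1) (by simp)
      obtain ⟨ε, hε, hloc⟩ := exists_dist_ge (γ μ) hdev
      have hPf := hdev f hf (supp_subset (hγf μ (hsub hμ)))
      refine ⟨ε / (L + 1), by positivity, fun ν hν ξ hξ h1 h2 => ?_⟩
      have hsm : ∀ ν ∈ Icc l m, |ν - μ| < ε / (L + 1) → dist (γ μ) (γ ν) < ε := by
        intro ν hν h
        refine (hup μ (hsub hμ) ν (hsub hν)).trans_lt ?_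
        rw [abs_sub_comm]
        rw [lt_div_iff₀ (by positivity)] at h
        have := abs_nonneg (ν - μ)
        nlinarith
      refine le_antisymm (hup ν (hsub hν) ξ (hsub hξ)) ?_
      rw [← hlin _ hPf ν (hsub hν) ξ (hsub hξ)]
      exact hloc _ _ (hsm ν hν h1) (hsm ξ hξ h2)
  refine le_of_forall_pos_le_add fun δ hδ => ?_
  obtain ⟨ε, hε0, hε1, hεδ⟩ : ∃ ε : ℝ, 0 < ε ∧ ε ≤ 1 / 4 ∧ L * (4 * ε) ≤ δ := by
    refine ⟨min (1 / 4) (δ / (4 * (L + 1))), by positivity, min_le_left _ _, ?_⟩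
    have h1 := min_le_right (1 / 4) (δ / (4 * (L + 1)))
    rw [le_div_iff₀ (by positivity)] at h1
    have : 0 < min (1 / 4) (δ / (4 * (L + 1))) := by positivity
    nlinarith
  have e0 : γ 0 = a := Pt.ext (by rw [hγ 0 (by simp)]; simp)
  have e1 : γ 1 = b := Pt.ext (by rw [hγ 1 (by simp)]; simp)
  have m1 : ε ∈ Icc (0 : ℝ) 1 := ⟨hε0.le, by linarith⟩
  have m2 : 1 - ε ∈ Icc (0 : ℝ) 1 := ⟨by linarith, by linarith⟩
  have h1 := hmid ε (1 - ε) hε0 (by linarith) (by linarith)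
  have h2 := hup ε m1 0 (by simp)
  have h3 := hup 1 (by simp) (1 - ε) m2
  rw [e0, sub_zero, abs_of_pos hε0] at h2
  rw [e1, show 1 - (1 - ε) = ε by ring, abs_of_pos hε0] at h3
  have h4 := dist_triangle (γ ε) a (γ (1 - ε))
  have h5 := dist_triangle a b (γ (1 - ε))
  nlinarith

lemma Develops.dist_eq {P : V → ℂ} {f : Finset V} (hP : K.Develops P f) (hf : f ∈ K.faces)
    {a b : K.Pt hK} (ha : a.val ∈ cell f) (hb : b.val ∈ cell f) :
    dist a b = ‖lin P a.val - lin P b.val‖ := by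
  rw [dist_eq_cellDist hf ha hb, hP.cellDist ha hb]

/-- In a cell the metric segments are the affine segments. -/
lemma mem_seg_iff_segment {f : Finset V} (hf : f ∈ K.faces) {a b y : K.Pt hK} (ha : a.val ∈ cell f)
    (hb : b.val ∈ cell f) : y ∈ seg a b ↔ y.val ∈ segment ℝ a.val b.val := by
  obtain ⟨P, hP⟩ := exists_develops hf
  have key : ∀ s ∈ Icc (0 : ℝ) 1, ∀ y : K.Pt hK, y.val = (1 - s) • a.val + s • b.val →
      dist a y = s * dist a b ∧ dist y b = (1 - s) * dist a b := by
    intro s hs y hy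
    have hyf : y.val ∈ cell f := hy ▸ convex_cell f ha hb (by linarith [hs.2]) hs.1 (by ring)
    rw [hP.dist_eq hf ha hyf, hP.dist_eq hf hyf hb, hP.dist_eq hf ha hb, hy, lin_comb]
    have e1 : lin P a.val - ((1 - s) • lin P a.val + s • lin P b.val) =
        s • (lin P a.val - lin P b.val) := by
      simp only [sub_smul, smul_sub, one_smul]; abel
    have e2 : (1 - s) • lin P a.val + s • lin P b.val - lin P b.val =
        (1 - s) • (lin P a.val - lin P b.val) := by
      simp only [sub_smul, smul_sub, one_smul]; abel
    rw [e1, e2, norm_smul, norm_smul, Real.norm_of_nonneg hs.1,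
      Real.norm_of_nonneg (by linarith [hs.2])]
    exact ⟨rfl, rfl⟩
  constructor
  · intro hy
    rw [seg_eq_image] at hy
    obtain ⟨s, hs, rfl⟩ := hy
    have hc : (1 - s) • a.val + s • b.val ∈ cell f :=
      convex_cell f ha hb (by linarith [hs.2]) hs.1 (by ring)
    obtain ⟨h1, h2⟩ := key s hs (hK.mk _ (mem_space hf hc)) rfl
    have := pt_eq hs (y := hK.mk _ (mem_space hf hc)) (by rw [mem_seg, h1, h2]; ring) h1
    rw [this]
    exact ⟨1 - s, s, by linarith [hs.2], hs.1, by ring, rfl⟩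
  · rintro ⟨t, s, ht, hs, hts, hy⟩
    obtain rfl : t = 1 - s := by linarith
    obtain ⟨h1, h2⟩ := key s ⟨hs, by linarith⟩ y hy.symm
    rw [mem_seg, h1, h2]; ring

lemma seg_subset_cell {f : Finset V} (hf : f ∈ K.faces) {a b y : K.Pt hK} (ha : a.val ∈ cell f)
    (hb : b.val ∈ cell f) (hy : y ∈ seg a b) : y.val ∈ cell f :=
  (convex_cell f).segment_subset ha hb ((mem_seg_iff_segment hf ha hb).1 hy)

/-- A coordinate that vanishes at an inner point of a segment vanishes on the segment. -/
lemma coord_eq_zero {f : Finset V} (hf : f ∈ K.faces) {a b y : K.Pt hK} (ha : a.val ∈ cell f)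
    (hb : b.val ∈ cell f) (hy : y ∈ seg a b) (hya : y ≠ a) {v : V} (hv : y.val v = 0) :
    b.val v = 0 := by
  obtain ⟨s, t, hs, ht, hst, h⟩ := (mem_seg_iff_segment hf ha hb).1 hy
  have h1 := congrFun h v
  simp only [Pi.add_apply, Pi.smul_apply, smul_eq_mul, hv] at h1
  have h2 := mul_nonneg hs (a.nonneg v)
  have h3 := mul_nonneg ht (b.nonneg v)
  have h4 : t * b.val v = 0 := by linarith
  refine (mul_eq_zero.1 h4).resolve_left fun h0 => hya (Pt.ext ?_)
  rw [← h, h0, show s = 1 by linarith]; simp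

/-- A vertex is not an inner point of a segment in a cell. -/
lemma IsVertex.eq_or_eq {f : Finset V} (hf : f ∈ K.faces) {a b y : K.Pt hK} (hv : y.IsVertex)
    (ha : a.val ∈ cell f) (hb : b.val ∈ cell f) (hy : y ∈ seg a b) : y = a ∨ y = b := by
  by_contra! hne
  obtain ⟨v, hv⟩ := hv
  have h1 : b.val = vertexPoint v := Pt.isVertex_of_supp_subset fun w hw => by
    rw [Finset.mem_singleton]
    by_contra hwv
    refine mem_supp.1 hw (coord_eq_zero hf ha hb hy hne.1 ?_)
    rw [hv]; simp [vertexPoint, hwv]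
  exact hne.2 (Pt.ext (hv.trans h1.symm))

/-! ### Local structure at points that are not vertices -/

/-- Lets a geodesic issuing from `u` be replaced by a short initial piece whose end lies in the
relative interior of a cell containing `u`. -/
lemma exists_near_star {u c : K.Pt hK} (hcu : c ≠ u) {ε : ℝ} (hε : 0 < ε) :
    ∃ c₁ ∈ seg u c, c₁ ≠ u ∧ dist u c₁ < ε ∧ supp u.val ⊆ supp c₁.val := by
  obtain ⟨ρ, hρ, hstar⟩ := u.exists_star
  obtain ⟨c₁, h1, h2, h3⟩ := exists_near hcu.symm (lt_min hε hρ)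
  exact ⟨c₁, h1, h2, h3.trans_le (min_le_left _ _), hstar _ (h3.trans_le (min_le_right _ _))⟩

lemma sum_triple {M : Type*} [AddCommMonoid M] {a b c : V} (hab : a ≠ b) (hac : a ≠ c)
    (hbc : b ≠ c) {F : V → M} (hF : ∀ v, v ∉ ({a, b, c} : Finset V) → F v = 0) :
    ∑ v, F v = F a + F b + F c := by
  rw [← Finset.sum_subset (Finset.subset_univ ({a, b, c} : Finset V)) fun v _ hv => hF v hv,
    Finset.sum_insert (by simp [hab, hac]), Finset.sum_insert (by simp [hbc]),
    Finset.sum_singleton, add_assoc]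

lemma lin_place {a b c : V} (hab : a ≠ b) (hac : a ≠ c) (hbc : b ≠ c) (σ : V → ℝ) {x : V → ℝ}
    (hx : ∀ v, v ∉ ({a, b, c} : Finset V) → x v = 0) :
    lin (K.place a b σ) x =
      ⟨x b * K.len a b + x c * K.foot a b c, σ c * (x c * K.altitude a b c)⟩ := by
  rw [lin, sum_triple hab hac hbc fun v hv => by rw [hx v hv, zero_smul], place_left,
    place_right hab, place_other hac hbc]
  apply Complex.ext
  · simp
  · simp; ring

/-- A face that properly contains two vertices of the support of a point is a triangle. -/
lemma supp_eq_of_ssubset {u : K.Pt hK} (hu : ¬ u.IsVertex) {f : Finset V} (hf : f ∈ K.faces)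
    (hs : supp u.val ⊆ f) {d : V} (hd : d ∈ f) (hdu : d ∉ supp u.val) :
    ∃ a b, a ≠ b ∧ a ≠ d ∧ b ≠ d ∧ supp u.val = {a, b} ∧ f = {a, b, d} := by
  obtain ⟨a, ha, b, hb, hab⟩ := Pt.exists_ne hu
  have had : a ≠ d := by rintro rfl; exact hdu ha
  have hbd : b ≠ d := by rintro rfl; exact hdu hb
  refine ⟨a, b, hab, had, hbd, ?_, ?_⟩
  · ext c
    simp only [Finset.mem_insert, Finset.mem_singleton]
    constructor
    · intro hc
      by_contra! hne
      have := third_eq hf (hs ha) (hs hb) (hs hc) hd hab hne.1.symm hne.2.symm had hbd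
      exact hdu (this ▸ hc)
    · rintro (rfl | rfl) <;> assumption
  · ext c
    simp only [Finset.mem_insert, Finset.mem_singleton]
    constructor
    · intro hc
      by_contra! hne
      exact hne.2.2 (third_eq hf (hs ha) (hs hb) hc hd hab hne.1.symm hne.2.1.symm had hbd)
    · rintro (rfl | rfl | rfl)
      · exact hs ha
      · exact hs hb
      · exact hd

variable (K) in
/-- The edge `a b` lies on exactly one triangle, whose third vertex is `c`. -/
def FreeEdge (a b c : V) : Prop :=
  a ≠ b ∧ a ≠ c ∧ b ≠ c ∧ {a, b, c} ∈ K.faces ∧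
    ∀ d, a ≠ d → b ≠ d → {a, b, d} ∈ K.faces → d = c

/-- The point is an inner point of an edge that lies on exactly one triangle. -/
def Pt.OnFreeEdge (u : K.Pt hK) : Prop := ∃ a b c, K.FreeEdge a b c ∧ supp u.val = {a, b}

/-- Geodesics can be prolonged at the points that are neither vertices nor on free edges. -/
theorem exists_extension {u c : K.Pt hK} (hu : ¬ u.IsVertex) (hfree : ¬ u.OnFreeEdge)
    (hcu : c ≠ u) : ∃ u', u' ≠ u ∧ u ∈ seg c u' := by
  have suff : ∀ c₁ ∈ seg u c, c₁ ≠ u → ∀ u' : K.Pt hK, u ∈ seg c₁ u' → u ∈ seg c u' :=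
    fun c₁ h1 h2 u' h3 => ext' (mem_comm.1 h1) h3 h2
  obtain ⟨a, ha, b, hb, hab⟩ := Pt.exists_ne hu
  -- Either the direction of `c` runs inside the smallest cell of `u`, and the affine prolongation
  -- stays in it for a while, or `u` is on an edge and the direction points into a triangle; a
  -- second triangle then exists because the edge is not free.
  by_cases hA : ∃ c₁ ∈ seg u c, c₁ ≠ u ∧ supp c₁.val ⊆ supp u.val
  · obtain ⟨c₁, h1, h2, h3⟩ := hA
    have hc₁ : c₁.val ∈ cell (supp u.val) := Pt.mem_cell_iff.2 h3
    obtain ⟨v, hv, hmin⟩ := (supp u.val).exists_min_image u.val ⟨a, ha⟩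
    -- Moving by `τ` times a difference of barycentric coordinates lowers none of them by more than
    -- the smallest coordinate of `u` in its support.
    set τ := u.val v
    have hτ : 0 < τ := Pt.pos hv
    have hu' : u.val + τ • (u.val - c₁.val) ∈ cell (supp u.val) := by
      refine ⟨fun w => ?_, ?_, fun w hw => ?_⟩
      · simp only [Pi.add_apply, Pi.smul_apply, Pi.sub_apply, smul_eq_mul]
        by_cases hw : w ∈ supp u.val
        · have := hmin w hw
          have := c₁.val_le_one w
          have := u.nonneg w
          nlinarith
        · rw [hc₁.2.2 w hw, u.mem_cell_supp.2.2 w hw]; simp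
      · simp only [Pi.add_apply, Pi.smul_apply, Pi.sub_apply, smul_eq_mul, Finset.sum_add_distrib,
          ← Finset.mul_sum, Finset.sum_sub_distrib, u.sum_eq, c₁.sum_eq]; ring
      · simp [hc₁.2.2 w hw, u.mem_cell_supp.2.2 w hw]
    refine ⟨hK.mk _ (mem_space u.supp_mem hu'), fun h => h2 ?_, suff c₁ h1 h2 _ ?_⟩
    · have h4 := congrArg Pt.val h
      rw [IsCAT0.mk_val] at h4
      have h5 : τ • (u.val - c₁.val) = 0 := by simpa using h4
      have := (smul_eq_zero.1 h5).resolve_left hτ.ne'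
      exact Pt.ext (sub_eq_zero.1 this).symm
    · rw [mem_seg_iff_segment u.supp_mem hc₁ (by rwa [IsCAT0.mk_val])]
      refine ⟨τ / (1 + τ), 1 / (1 + τ), by positivity, by positivity, by field_simp; ring, ?_⟩
      ext w
      simp only [IsCAT0.mk_val, Pi.add_apply, Pi.smul_apply, Pi.sub_apply, smul_eq_mul]
      field_simp; ring
  · obtain ⟨c₀, h1₀, h2₀, h3₀, h4₀⟩ := exists_near_star hcu one_pos
    obtain ⟨d, hd, hdu⟩ : ∃ d ∈ supp c₀.val, d ∉ supp u.val := by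
      by_contra! hcon
      exact hA ⟨c₀, h1₀, h2₀, hcon⟩
    obtain ⟨a, b, hab, had, hbd, hsu, hsc⟩ := supp_eq_of_ssubset hu c₀.supp_mem h4₀ hd hdu
    have hfd : {a, b, d} ∈ K.faces := hsc ▸ c₀.supp_mem
    obtain ⟨e, hae, hbe, hfe, hed⟩ : ∃ e, a ≠ e ∧ b ≠ e ∧ {a, b, e} ∈ K.faces ∧ e ≠ d := by
      by_contra! hcon
      exact hfree ⟨a, b, d, ⟨hab, had, hbd, hfd, fun e h1 h2 h3 => hcon e h1 h2 h3⟩, hsu⟩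
    have hau : a ∈ supp u.val := by simp [hsu]
    have hbu : b ∈ supp u.val := by simp [hsu]
    -- The triangle with `c₀` is developed above the edge, the other one below it.
    set σ : V → ℝ := fun v => if v = d then 1 else -1
    have hσ : ∀ v, σ v ^ 2 = 1 := fun v => by simp only [σ]; split_ifs <;> norm_num
    have hdev := develops_star hau hbu hab hσ
    obtain ⟨ε, hε, hloc⟩ := exists_dist_ge u hdev
    obtain ⟨c₁, h1, h2, h3⟩ := exists_near (a := u) (b := c₀) h2₀.symm hε
    have h1' : c₁ ∈ seg u c := mem_of_mem_left h1₀ h1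
    have hufd : u.val ∈ cell {a, b, d} := Pt.mem_cell_iff.2 (hsc ▸ h4₀)
    have hufe : u.val ∈ cell {a, b, e} := Pt.mem_cell_iff.2 (hsu ▸ by intro v; simp; tauto)
    have hc₁f : c₁.val ∈ cell {a, b, d} :=
      seg_subset_cell hfd hufd (hsc ▸ c₀.mem_cell_supp) h1
    have hc₁d : 0 < c₁.val d := by
      refine lt_of_le_of_ne (c₁.nonneg d) fun h => ?_
      refine hA ⟨c₁, h1', h2, fun v hv => ?_⟩
      have := supp_subset hc₁f hv
      simp only [Finset.mem_insert, Finset.mem_singleton] at this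
      rw [hsu, Finset.mem_insert, Finset.mem_singleton]
      rcases this with rfl | rfl | rfl
      · simp
      · simp
      · exact absurd h.symm (mem_supp.1 hv)
    have hud : u.val d = 0 := by by_contra h; exact hdu (mem_supp.2 h)
    have hue : u.val e = 0 := by
      by_contra h
      have := mem_supp.2 h
      rw [hsu, Finset.mem_insert, Finset.mem_singleton] at this
      rcases this with rfl | rfl <;> contradiction
    have hl : 0 < K.len a b := K.len_pos a b hab (hsu ▸ u.supp_mem)
    have hhd := altitude_pos hab had hbd hfd
    have hhe := altitude_pos hab hae hbe hfe
    set l := K.len a b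
    set hd' := K.altitude a b d
    set he' := K.altitude a b e
    -- the direction of the prolongation in barycentric coordinates
    obtain ⟨κ, hκ⟩ : ∃ κ, κ = c₁.val d * hd' / he' := ⟨_, rfl⟩
    obtain ⟨B, hB⟩ : ∃ B, B = (u.val b * l - c₁.val b * l - c₁.val d * K.foot a b d
      - κ * K.foot a b e) / l := ⟨_, rfl⟩
    have hκ' : κ * he' = c₁.val d * hd' := by rw [hκ]; field_simp
    have hB' : B * l = u.val b * l - c₁.val b * l - c₁.val d * K.foot a b d
      - κ * K.foot a b e := by rw [hB]; field_simp
    have hκ0 : 0 < κ := by rw [hκ]; positivity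
    have hua := Pt.pos hau
    have hub := Pt.pos hbu
    set r := dist u c₁
    have hr : 0 < r := dist_pos.2 h2.symm
    obtain ⟨τ, hτ, hτ1, hτ2, hτ3⟩ : ∃ τ > 0, τ * r < ε ∧ 0 ≤ u.val b + τ * B ∧
        0 ≤ u.val a + τ * (- κ - B) := by
      have t1 : Filter.Tendsto (fun τ : ℝ => τ * r) (nhdsWithin 0 (Ioi 0)) (nhds (0 * r)) :=
        (by fun_prop : Continuous fun τ : ℝ => τ * r).continuousWithinAt
      have t2 : Filter.Tendsto (fun τ : ℝ => u.val b + τ * B) (nhdsWithin 0 (Ioi 0))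
          (nhds (u.val b + 0 * B)) :=
        (by fun_prop : Continuous fun τ : ℝ => u.val b + τ * B).continuousWithinAt
      have t3 : Filter.Tendsto (fun τ : ℝ => u.val a + τ * (- κ - B)) (nhdsWithin 0 (Ioi 0))
          (nhds (u.val a + 0 * (- κ - B))) :=
        (by fun_prop : Continuous fun τ : ℝ => u.val a + τ * (- κ - B)).continuousWithinAt
      have := (self_mem_nhdsWithin : Ioi (0 : ℝ) ∈ nhdsWithin 0 (Ioi 0))
      obtain ⟨τ, h1, h2, h3, h4⟩ := (((t1.eventually_lt_const (u := ε) (by simpa using hε)).and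
        ((t2.eventually_const_lt (u := 0) (by simpa using hub)).and
        ((t3.eventually_const_lt (u := 0) (by simpa using hua)).and this))).exists)
      exact ⟨τ, h4, h1, h2.le, h3.le⟩
    set x : V → ℝ := fun v => if v = a then u.val a + τ * (-κ - B) else
      if v = b then u.val b + τ * B else if v = e then τ * κ else 0
    have hxa : x a = u.val a + τ * (-κ - B) := by simp [x]
    have hxb : x b = u.val b + τ * B := by simp [x, hab.symm]
    have hxe : x e = τ * κ := by simp [x, hae.symm, hbe.symm]
    have hx0 : ∀ v, v ∉ ({a, b, e} : Finset V) → x v = 0 := by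
      intro v hv
      simp only [Finset.mem_insert, Finset.mem_singleton, not_or] at hv
      simp [x, hv.1, hv.2.1, hv.2.2]
    have husum : u.val a + u.val b = 1 := by
      have := sum_triple hab had hbd hufd.2.2
      rw [u.sum_eq, hud] at this; linarith
    have hx : x ∈ cell {a, b, e} := by
      refine ⟨fun v => ?_, ?_, hx0⟩
      · simp only [x]
        split_ifs
        · exact hτ3
        · exact hτ2
        · positivity
        · exact le_rfl
      · rw [sum_triple hab hae hbe hx0, hxa, hxb, hxe]; linarith
    set u' := hK.mk x (mem_space hfe hx)
    have hu'f : u'.val ∈ cell {a, b, e} := hx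
    have hPd := hdev _ hfd (by rw [hsu]; intro v; simp; tauto)
    have hPe := hdev _ hfe (by rw [hsu]; intro v; simp; tauto)
    have key : lin (K.place a b σ) u'.val - lin (K.place a b σ) u.val =
        τ • (lin (K.place a b σ) u.val - lin (K.place a b σ) c₁.val) := by
      rw [lin_place hab hae hbe σ hu'f.2.2, lin_place hab had hbd σ hc₁f.2.2]
      have e1 : lin (K.place a b σ) u.val = ⟨u.val b * l, 0⟩ := by
        rw [lin_place hab had hbd σ hufd.2.2, hud]
        apply Complex.ext <;> simp [l]
      have e2 : σ d = 1 := by simp [σ]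
      have e3 : σ e = -1 := by simp [σ, hed]
      have e4 : u'.val = x := rfl
      rw [e1, e2, e3, e4, hxb, hxe]
      apply Complex.ext
      · simp only [Complex.sub_re, Complex.real_smul, Complex.mul_re, Complex.ofReal_re,
          Complex.ofReal_im]
        linear_combination τ * hB'
      · simp only [Complex.sub_im, Complex.real_smul, Complex.mul_im, Complex.ofReal_re,
          Complex.ofReal_im]
        linear_combination (-τ) * hκ'
    have hd1 : dist c₁ u = ‖lin (K.place a b σ) u.val - lin (K.place a b σ) c₁.val‖ := by
      rw [dist_comm, hPd.dist_eq hfd hufd hc₁f]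
    have hd2 : dist u u' = τ * dist c₁ u := by
      rw [hPe.dist_eq hfe hufe hu'f, norm_sub_rev, key, norm_smul, Real.norm_of_nonneg hτ.le, hd1]
    -- In the development `c₁`, `u`, `u'` are on a line in this order, and developing near `u` does
    -- not increase distances. Together with the triangle inequality this makes `u` a point between
    -- `c₁` and `u'`.
    have hd3 : (1 + τ) * dist c₁ u ≤ dist c₁ u' := by
      have h5 := hloc c₁ u' h3 (by rw [hd2, dist_comm c₁]; exact hτ1)
      have h6 : lin (K.place a b σ) u'.val - lin (K.place a b σ) c₁.val =
          (1 + τ) • (lin (K.place a b σ) u.val - lin (K.place a b σ) c₁.val) := by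
        rw [add_smul, one_smul, ← key]; abel
      rwa [norm_sub_rev, h6, norm_smul, Real.norm_of_nonneg (by positivity), ← hd1] at h5
    refine ⟨u', fun h => ?_, suff c₁ h1' h2 u' ?_⟩
    · have : u'.val e = u.val e := by rw [h]
      rw [hue] at this
      have h7 : u'.val e = τ * κ := hxe
      have : 0 < τ * κ := by positivity
      linarith
    · rw [mem_seg]
      exact le_antisymm (by rw [hd2]; linarith) (dist_triangle _ _ _)

end TriComplex

/-! ### Non-branching, and geodesics through free edges. -/

namespace TriComplex

open CatZero

variable {V : Type*} [Fintype V] [DecidableEq V] {K : TriComplex V} {hK : K.IsCAT0}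

variable (K) in
/-- Every edge lies on at most two triangles. -/
def AtMostTwo : Prop := ∀ a b c d e : V, a ≠ b → a ≠ c → b ≠ c → a ≠ d → b ≠ d → a ≠ e → b ≠ e →
  {a, b, c} ∈ K.faces → {a, b, d} ∈ K.faces → {a, b, e} ∈ K.faces → c ≠ d → c ≠ e → d = e

/-- Two points of a cell in the same direction from a third one. -/
lemma mem_seg_of_same_direction {f : Finset V} (hf : f ∈ K.faces) {u p q : K.Pt hK}
    (hu : u.val ∈ cell f) (hp : p.val ∈ cell f) (hq : q.val ∈ cell f) {P : V → ℂ}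
    (hP : K.Develops P f) {v : ℂ} {r s : ℝ} (hr : 0 ≤ r) (hs : 0 < s) (hrs : r ≤ s)
    (h1 : lin P p.val - lin P u.val = r • v) (h2 : lin P q.val - lin P u.val = s • v) :
    p ∈ seg u q := by
  rw [mem_seg, hP.dist_eq hf hu hp, hP.dist_eq hf hp hq, hP.dist_eq hf hu hq, norm_sub_rev, h1,
    norm_sub_rev (lin P p.val), norm_sub_rev (lin P u.val), h2]
  have : lin P q.val - lin P p.val = (s - r) • v := by
    rw [sub_smul, ← h1, ← h2]; abel
  rw [this, norm_smul, norm_smul, norm_smul, Real.norm_of_nonneg hr, Real.norm_of_nonneg hs.le,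
    Real.norm_of_nonneg (sub_nonneg.2 hrs)]
  ring

/-- Near an inner point of an edge, points on different triangles are joined by a straight segment
in the development. -/
lemma dist_le_across {a b d e : V} (hab : a ≠ b) (had : a ≠ d) (hbd : b ≠ d) (hae : a ≠ e)
    (hbe : b ≠ e) (hfd : {a, b, d} ∈ K.faces) (hfe : {a, b, e} ∈ K.faces)
    {σ : V → ℝ} (hσ : ∀ v, σ v ^ 2 = 1) (hσd : σ d = 1) (hσe : σ e = -1)
    {u c p : K.Pt hK} (hu : supp u.val = {a, b}) (hc : c.val ∈ cell {a, b, d})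
    (hp : p.val ∈ cell {a, b, e}) (hcd : 0 < c.val d) (hpe : 0 < p.val e)
    (h1 : dist u c ≤ K.len a b * min (u.val a) (u.val b))
    (h2 : dist u p ≤ K.len a b * min (u.val a) (u.val b)) :
    dist c p ≤ ‖lin (K.place a b σ) c.val - lin (K.place a b σ) p.val‖ := by
  have hfu : {a, b} ∈ K.faces := hu ▸ u.supp_mem
  have hl : 0 < K.len a b := K.len_pos a b hab hfu
  have hhd := altitude_pos hab had hbd hfd
  have hhe := altitude_pos hab hae hbe hfe
  have hPd : K.Develops (K.place a b σ) {a, b, d} := develops_place hab hσ hfd (by simp) (by simp)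
  have hPe : K.Develops (K.place a b σ) {a, b, e} := develops_place hab hσ hfe (by simp) (by simp)
  have hufd : u.val ∈ cell {a, b, d} := Pt.mem_cell_iff.2 (hu ▸ by intro v; simp; tauto)
  have hufe : u.val ∈ cell {a, b, e} := Pt.mem_cell_iff.2 (hu ▸ by intro v; simp; tauto)
  have h0 : ∀ v, v ∉ ({a, b} : Finset V) → u.val v = 0 := fun v hv => by
    by_contra hne; exact hv (hu ▸ mem_supp.2 hne)
  have hud : u.val d = 0 := h0 d (by simp [had.symm, hbd.symm])
  have lu : lin (K.place a b σ) u.val = ⟨u.val b * K.len a b, 0⟩ := by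
    rw [lin_place hab had hbd σ hufd.2.2, hud]
    apply Complex.ext <;> simp
  have lc := lin_place (K := K) hab had hbd σ hc.2.2
  have lp := lin_place (K := K) hab hae hbe σ hp.2.2
  rw [hσd, one_mul] at lc
  rw [hσe] at lp
  rw [hPd.dist_eq hfd hufd hc] at h1
  rw [hPe.dist_eq hfe hufe hp] at h2
  have r1 := (Complex.abs_re_le_norm _).trans h1
  have r2 := (Complex.abs_re_le_norm _).trans h2
  set φ := lin (K.place a b σ)
  have husum : u.val a + u.val b = 1 := by
    have := sum_triple hab had hbd hufd.2.2
    rw [u.sum_eq, hud] at this; linarith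
  obtain ⟨Y, hY⟩ : ∃ Y, Y = c.val d * K.altitude a b d := ⟨_, rfl⟩
  obtain ⟨Z, hZ⟩ : ∃ Z, Z = p.val e * K.altitude a b e := ⟨_, rfl⟩
  have hY0 : 0 < Y := by rw [hY]; positivity
  have hZ0 : 0 < Z := by rw [hZ]; positivity
  have cim : (φ c.val).im = Y := by rw [lc, hY]
  have pim : (φ p.val).im = -Z := by rw [lp, hZ]; simp
  have ure : (φ u.val).re = u.val b * K.len a b := by rw [lu]
  -- The abscissa at which the straight segment between the two developed points crosses the line of
  -- the edge. It is a convex combination of their abscissas, so the distance bounds place it on the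
  -- edge itself.
  obtain ⟨M, hM⟩ : ∃ M, M = (Z / (Y + Z)) * (φ c.val).re + (Y / (Y + Z)) * (φ p.val).re := ⟨_, rfl⟩
  have hlt : |u.val b * K.len a b - M| ≤ K.len a b * min (u.val a) (u.val b) := by
    rw [Complex.sub_re, ure] at r1 r2
    have : u.val b * K.len a b - M = (Z / (Y + Z)) * (u.val b * K.len a b - (φ c.val).re) +
        (Y / (Y + Z)) * (u.val b * K.len a b - (φ p.val).re) := by
      rw [hM]; field_simp; ring
    rw [this]
    refine (abs_add_le _ _).trans ?_
    rw [abs_mul, abs_mul, abs_of_pos (by positivity : 0 < Z / (Y + Z)),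
      abs_of_pos (by positivity : 0 < Y / (Y + Z))]
    have h3 := mul_le_mul_of_nonneg_left r1 (by positivity : 0 ≤ Z / (Y + Z))
    have h4 := mul_le_mul_of_nonneg_left r2 (by positivity : 0 ≤ Y / (Y + Z))
    have h5 : Z / (Y + Z) + Y / (Y + Z) = 1 := by field_simp; ring
    calc _ ≤ (Z / (Y + Z) + Y / (Y + Z)) * (K.len a b * min (u.val a) (u.val b)) := by
          rw [add_mul]; exact add_le_add h3 h4
      _ = _ := by rw [h5, one_mul]
  obtain ⟨μ, hμ⟩ : ∃ μ, μ = M / K.len a b := ⟨_, rfl⟩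
  have hμM : μ * K.len a b = M := by rw [hμ]; field_simp
  have hab' := abs_le.1 hlt
  have hm1 := mul_le_mul_of_nonneg_left (min_le_left (u.val a) (u.val b)) hl.le
  have hm2 := mul_le_mul_of_nonneg_left (min_le_right (u.val a) (u.val b)) hl.le
  have hμ0 : 0 ≤ μ := by
    rw [hμ]; apply div_nonneg _ hl.le; linarith [hab'.2]
  have hμ1 : μ ≤ 1 := by
    rw [hμ, div_le_one hl]
    have : K.len a b = u.val a * K.len a b + u.val b * K.len a b := by rw [← add_mul, husum, one_mul]
    linarith [hab'.1]
  set x : V → ℝ := fun v => if v = a then 1 - μ else if v = b then μ else 0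
  have hxd : ∀ v, v ≠ a → v ≠ b → x v = 0 := fun v h1 h2 => by simp [x, h1, h2]
  have hxb : x b = μ := by simp [x, hab.symm]
  have hxa : x a = 1 - μ := by simp [x]
  have hx : ∀ g : V, a ≠ g → b ≠ g → x ∈ cell {a, b, g} := by
    intro g hag hbg
    have h0' : ∀ v, v ∉ ({a, b, g} : Finset V) → x v = 0 := fun v hv => by
      simp only [Finset.mem_insert, Finset.mem_singleton, not_or] at hv
      exact hxd v hv.1 hv.2.1
    refine ⟨fun v => ?_, ?_, h0'⟩
    · simp only [x]; split_ifs
      · linarith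
      · exact hμ0
      · exact le_rfl
    · rw [sum_triple hab hag hbg h0', hxa, hxb, hxd g hag.symm hbg.symm]; ring
  have hxsp : x ∈ K.space := mem_space hfd (hx d had hbd)
  set m := hK.mk x hxsp
  have hmd : m.val ∈ cell {a, b, d} := hx d had hbd
  have hme : m.val ∈ cell {a, b, e} := hx e hae hbe
  have lm : φ m.val = ⟨M, 0⟩ := by
    have : m.val = x := rfl
    change lin (K.place a b σ) m.val = _
    rw [lin_place hab had hbd σ hmd.2.2, this, hxb, hxd d had.symm hbd.symm, ← hμM]
    apply Complex.ext <;> simp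
  refine (dist_triangle c m p).trans ?_
  rw [hPd.dist_eq hfd hc hmd, hPe.dist_eq hfe hme hp]
  have e1 : φ c.val - φ m.val = (Y / (Y + Z)) • (φ c.val - φ p.val) := by
    rw [lm]
    apply Complex.ext
    · simp only [Complex.sub_re, Complex.real_smul, Complex.mul_re, Complex.ofReal_re,
        Complex.ofReal_im, hM]
      field_simp; ring
    · simp only [Complex.sub_im, Complex.real_smul, Complex.mul_im, Complex.ofReal_re,
        Complex.ofReal_im, cim, pim]
      field_simp; ring
  have e2 : φ m.val - φ p.val = (Z / (Y + Z)) • (φ c.val - φ p.val) := by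
    rw [lm]
    apply Complex.ext
    · simp only [Complex.sub_re, Complex.real_smul, Complex.mul_re, Complex.ofReal_re,
        Complex.ofReal_im, hM]
      field_simp; ring
    · simp only [Complex.sub_im, Complex.real_smul, Complex.mul_im, Complex.ofReal_re,
        Complex.ofReal_im, cim, pim]
      field_simp; ring
  rw [e1, e2, norm_smul, norm_smul, Real.norm_of_nonneg (by positivity),
    Real.norm_of_nonneg (by positivity), ← add_mul]
  apply le_of_eq
  field_simp

/-- Geodesics do not branch at points that are not vertices. -/
theorem exists_common (hT : K.AtMostTwo) {u c p q : K.Pt hK} (hu : ¬ u.IsVertex)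
    (h1 : u ∈ seg c p) (h2 : u ∈ seg c q) (hc : c ≠ u) (hp : p ≠ u) (hq : q ≠ u) :
    ∃ w, w ≠ u ∧ w ∈ seg u p ∧ w ∈ seg u q := by
  -- it suffices to find a common development in which `u` is between the points
  have fin : ∀ c₁ p₁ q₁ : K.Pt hK, p₁ ∈ seg u p → q₁ ∈ seg u q → c₁ ≠ u → p₁ ≠ u → q₁ ≠ u →
      u ∈ seg c₁ p₁ → u ∈ seg c₁ q₁ → ∀ (P : V → ℂ) (f g : Finset V), f ∈ K.faces → g ∈ K.faces →
      K.Develops P f → K.Develops P g → u.val ∈ cell f → u.val ∈ cell g → c₁.val ∈ cell g →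
      p₁.val ∈ cell f → q₁.val ∈ cell f →
      dist c₁ p₁ ≤ ‖lin P c₁.val - lin P p₁.val‖ → dist c₁ q₁ ≤ ‖lin P c₁.val - lin P q₁.val‖ →
      ∃ w, w ≠ u ∧ w ∈ seg u p ∧ w ∈ seg u q := by
    intro c₁ p₁ q₁ hp₁ hq₁ hc hpu hqu hup huq P f g hf hg hPf hPg huf hug hcg hpf hqf hdp hdq
    have hne : lin P u.val - lin P c₁.val ≠ 0 := by
      rw [← norm_ne_zero_iff, ← hPg.dist_eq hg hug hcg]; exact (dist_pos.2 hc.symm).ne'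
    have ray : ∀ p₁ : K.Pt hK, p₁.val ∈ cell f → p₁ ≠ u → u ∈ seg c₁ p₁ →
        dist c₁ p₁ ≤ ‖lin P c₁.val - lin P p₁.val‖ →
        ∃ r : ℝ, 0 < r ∧ lin P p₁.val - lin P u.val = r • (lin P u.val - lin P c₁.val) := by
      intro p₁ hpf hpu hup hdp
      rw [mem_seg, hPg.dist_eq hg hcg hug, hPf.dist_eq hf huf hpf] at hup
      have h3 : ‖(lin P u.val - lin P c₁.val) + (lin P p₁.val - lin P u.val)‖ =
          ‖lin P u.val - lin P c₁.val‖ + ‖lin P p₁.val - lin P u.val‖ := by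
        refine le_antisymm (norm_add_le _ _) ?_
        rw [norm_sub_rev (lin P u.val), norm_sub_rev (lin P p₁.val) (lin P u.val), hup]
        refine hdp.trans (le_of_eq ?_)
        rw [norm_sub_rev]; congr 1; abel
      obtain ⟨r, hr, hr'⟩ := (sameRay_iff_norm_add.2 h3).exists_nonneg_left hne
      refine ⟨r, lt_of_le_of_ne hr ?_, hr'.symm⟩
      rintro rfl
      rw [zero_smul] at hr'
      apply hpu
      rw [← dist_eq_zero, hPf.dist_eq hf hpf huf, ← hr', norm_zero]
    obtain ⟨r, hr, hr'⟩ := ray p₁ hpf hpu hup hdp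
    obtain ⟨s, hs, hs'⟩ := ray q₁ hqf hqu huq hdq
    rcases le_total r s with h | h
    · have := mem_seg_of_same_direction hf huf hpf hqf hPf hr.le hs h hr' hs'
      exact ⟨p₁, hpu, hp₁, mem_of_mem_left hq₁ this⟩
    · have := mem_seg_of_same_direction hf huf hqf hpf hPf hs.le hr h hs' hr'
      exact ⟨q₁, hqu, mem_of_mem_left hp₁ this, hq₁⟩
  have between : ∀ {c₁ p₁ p : K.Pt hK}, u ∈ seg c p → c₁ ∈ seg u c → p₁ ∈ seg u p →
      u ∈ seg c₁ p₁ := by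
    intro c₁ p₁ p h hc hp
    exact mem_mid' (mem_comm.1 (mem_mid' (mem_comm.1 h) hc)) hp
  obtain ⟨a, ha, b, hb, hab⟩ := Pt.exists_ne hu
  obtain ⟨c₀, hc₀, hc₀u, -, hc₀s⟩ := exists_near_star hc one_pos
  -- If the geodesic arrives inside the smallest cell of `u`, it also leaves inside that cell.
  -- Otherwise it arrives through a triangle at an edge and must leave into the other triangle.
  by_cases hA : supp c₀.val ⊆ supp u.val
  · obtain ⟨p₁, hp₁, hp₁u, -, hp₁s⟩ := exists_near_star hp one_pos
    obtain ⟨q₁, hq₁, hq₁u, -, hq₁s⟩ := exists_near_star hq one_pos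
    have inU : ∀ p₁ : K.Pt hK, supp u.val ⊆ supp p₁.val → u ∈ seg c₀ p₁ →
        p₁.val ∈ cell (supp u.val) := by
      intro p₁ hs hup
      rw [Pt.mem_cell_iff]
      intro v hv
      by_contra hvu
      have : u.val v = 0 := by by_contra h; exact hvu (mem_supp.2 h)
      exact mem_supp.1 hv (coord_eq_zero p₁.supp_mem (Pt.mem_cell_iff.2 (hA.trans hs))
        p₁.mem_cell_supp hup hc₀u.symm this)
    have hup := between h1 hc₀ hp₁
    have huq := between h2 hc₀ hq₁
    have hpU := inU p₁ hp₁s hup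
    have hqU := inU q₁ hq₁s huq
    have hcU := Pt.mem_cell_iff.2 hA
    have hP := develops_star ha hb hab (σ := 1) (by simp) _ u.supp_mem subset_rfl
    exact fin c₀ p₁ q₁ hp₁ hq₁ hc₀u hp₁u hq₁u hup huq _ _ _ u.supp_mem u.supp_mem hP hP
      u.mem_cell_supp u.mem_cell_supp hcU hpU hqU (hP.dist_eq u.supp_mem hcU hpU).le
      (hP.dist_eq u.supp_mem hcU hqU).le
  · obtain ⟨d, hd, hdu⟩ := Finset.not_subset.1 hA
    obtain ⟨a, b, hab, had, hbd, hsu, hsc⟩ := supp_eq_of_ssubset hu c₀.supp_mem hc₀s hd hdu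
    have hfd : {a, b, d} ∈ K.faces := hsc ▸ c₀.supp_mem
    have hau : a ∈ supp u.val := by simp [hsu]
    have hbu : b ∈ supp u.val := by simp [hsu]
    have hl : 0 < K.len a b := K.len_pos a b hab (hsu ▸ u.supp_mem)
    have hε : 0 < K.len a b * min (u.val a) (u.val b) :=
      mul_pos hl (lt_min (Pt.pos hau) (Pt.pos hbu))
    obtain ⟨c₁, hc₁, hc₁u, hc₁d⟩ := exists_near (a := u) (b := c₀) hc₀u.symm hε
    obtain ⟨p₁, hp₁, hp₁u, hp₁d, hp₁s⟩ := exists_near_star hp hε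
    obtain ⟨q₁, hq₁, hq₁u, hq₁d, hq₁s⟩ := exists_near_star hq hε
    have hufd : u.val ∈ cell {a, b, d} := Pt.mem_cell_iff.2 (hsc ▸ hc₀s)
    have hc₁f : c₁.val ∈ cell {a, b, d} :=
      seg_subset_cell hfd hufd (hsc ▸ c₀.mem_cell_supp) hc₁
    have hud : u.val d = 0 := by by_contra h; exact hdu (mem_supp.2 h)
    have hc₁d0 : 0 < c₁.val d := by
      refine lt_of_le_of_ne (c₁.nonneg d) fun h => ?_
      rcases eq_or_ne c₁ c₀ with rfl | hne
      · exact mem_supp.1 hd h.symm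
      · exact mem_supp.1 hd (coord_eq_zero hfd hufd (hsc ▸ c₀.mem_cell_supp) hc₁ hc₁u h.symm)
    have hcc : c₁ ∈ seg u c := mem_of_mem_left hc₀ hc₁
    have hup := between h1 hcc hp₁
    have huq := between h2 hcc hq₁
    -- Staying in the triangle of `c₁` is impossible: the coordinate of `d` vanishes at `u` and is
    -- positive at `c₁`.
    have other : ∀ p₁ : K.Pt hK, supp u.val ⊆ supp p₁.val → u ∈ seg c₁ p₁ → p₁ ≠ u →
        ∃ e, a ≠ e ∧ b ≠ e ∧ d ≠ e ∧ supp p₁.val = {a, b, e} := by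
      intro p₁ hs hup hpu
      have hnd : p₁.val ∉ cell {a, b, d} := fun h => by
        have := coord_eq_zero hfd h hc₁f (mem_comm.1 hup) hpu.symm hud
        linarith
      obtain ⟨e, he, hed⟩ := Finset.not_subset.1 fun h => hnd (Pt.mem_cell_iff.2 h)
      simp only [Finset.mem_insert, Finset.mem_singleton, not_or] at hed
      refine ⟨e, hed.1 ∘ Eq.symm, hed.2.1 ∘ Eq.symm, hed.2.2 ∘ Eq.symm, ?_⟩
      have ha' := hs hau
      have hb' := hs hbu
      ext v
      simp only [Finset.mem_insert, Finset.mem_singleton]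
      constructor
      · intro hv
        by_contra! hne
        exact hne.2.2 (third_eq p₁.supp_mem ha' hb' hv he hab hne.1.symm hne.2.1.symm
          (hed.1 ∘ Eq.symm) (hed.2.1 ∘ Eq.symm))
      · rintro (rfl | rfl | rfl) <;> assumption
    obtain ⟨e, hae, hbe, hde, hpe⟩ := other p₁ hp₁s hup hp₁u
    obtain ⟨e', hae', hbe', hde', hqe⟩ := other q₁ hq₁s huq hq₁u
    have hfe : {a, b, e} ∈ K.faces := hpe ▸ p₁.supp_mem
    -- Here planarity enters: both geodesics leave into the same triangle.
    obtain rfl : e = e' := hT a b d e e' hab had hbd hae hbe hae' hbe' hfd hfe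
      (hqe ▸ q₁.supp_mem) hde hde'
    set σ : V → ℝ := fun v => if v = d then 1 else -1
    have hσ : ∀ v, σ v ^ 2 = 1 := fun v => by simp only [σ]; split_ifs <;> norm_num
    have hσd : σ d = 1 := by simp [σ]
    have hσe : σ e = -1 := by simp [σ, hde.symm]
    have hPd : K.Develops (K.place a b σ) {a, b, d} := develops_place hab hσ hfd (by simp) (by simp)
    have hPe : K.Develops (K.place a b σ) {a, b, e} := develops_place hab hσ hfe (by simp) (by simp)
    have hpf : p₁.val ∈ cell {a, b, e} := hpe ▸ p₁.mem_cell_supp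
    have hqf : q₁.val ∈ cell {a, b, e} := hqe ▸ q₁.mem_cell_supp
    refine fin c₁ p₁ q₁ hp₁ hq₁ hc₁u hp₁u hq₁u hup huq _ _ _ hfe hfd hPe hPd
      (Pt.mem_cell_iff.2 (hpe ▸ hp₁s)) hufd hc₁f hpf hqf ?_ ?_
    · exact dist_le_across hab had hbd hae hbe hfd hfe hσ hσd hσe hsu hc₁f hpf hc₁d0
        (Pt.pos (by simp [hpe])) hc₁d.le hp₁d.le
    · exact dist_le_across hab had hbd hae hbe hfd hfe hσ hσd hσe hsu hc₁f hqf hc₁d0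
        (Pt.pos (by simp [hqe])) hc₁d.le hq₁d.le

/-- Near an inner point of a free edge, the complex is a half disc: points are determined by their
distances from two points of the edge. -/
lemma exists_half_disc {a b c : V} (h : K.FreeEdge a b c) {t : K.Pt hK} (ht : supp t.val = {a, b}) :
    ∃ ρ > 0, ∀ u y y' : K.Pt hK, u.val ∈ cell {a, b} → u ≠ t → dist t y < ρ → dist t y' < ρ →
      dist t y = dist t y' → dist u y = dist u y' → y = y' := by
  obtain ⟨hab, hac, hbc, hf, huniq⟩ := h
  obtain ⟨ρ, hρ, hstar⟩ := t.exists_star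
  refine ⟨ρ, hρ, fun u y y' hu hut hy hy' h1 h2 => ?_⟩
  have inT : ∀ y : K.Pt hK, dist t y < ρ → y.val ∈ cell {a, b, c} := by
    intro y hy
    have hs := hstar y hy
    rw [ht] at hs
    have ha : a ∈ supp y.val := hs (by simp)
    have hb : b ∈ supp y.val := hs (by simp)
    rw [Pt.mem_cell_iff]
    intro v hv
    simp only [Finset.mem_insert, Finset.mem_singleton]
    by_contra! hne
    refine hne.2.2 (huniq v hne.1.symm hne.2.1.symm (mem_faces_sub y.supp_mem ?_ (by simp)))
    intro w
    simp only [Finset.mem_insert, Finset.mem_singleton]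
    rintro (rfl | rfl | rfl) <;> assumption
  have hsub : ({a, b} : Finset V) ⊆ {a, b, c} := by intro v; simp; tauto
  have hyf := inT y hy
  have hyf' := inT y' hy'
  have htf : t.val ∈ cell {a, b, c} := Pt.mem_cell_iff.2 (ht ▸ hsub)
  have huf : u.val ∈ cell {a, b, c} := Pt.mem_cell_iff.2 ((supp_subset hu).trans hsub)
  have hP : K.Develops (K.place a b 1) {a, b, c} :=
    develops_place hab (by simp) hf (by simp) (by simp)
  have hh := altitude_pos hab hac hbc hf
  have hl := K.len_pos a b hab (ht ▸ t.supp_mem)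
  have onE : ∀ u : K.Pt hK, u.val ∈ cell {a, b} → lin (K.place a b 1) u.val =
      ⟨u.val b * K.len a b, 0⟩ := by
    intro u hu
    have huc : u.val c = 0 := hu.2.2 c (by simp [hac.symm, hbc.symm])
    rw [lin_place hab hac hbc 1 (fun v hv => hu.2.2 v fun h => hv (hsub h)), huc]
    apply Complex.ext <;> simp
  have lt := onE t (Pt.mem_cell_iff.2 ht.subset)
  have lu := onE u hu
  have ly := lin_place (K := K) hab hac hbc 1 hyf.2.2
  have ly' := lin_place (K := K) hab hac hbc 1 hyf'.2.2
  have hne : dist u t ≠ 0 := (dist_pos.2 hut).ne'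
  rw [hP.dist_eq hf huf htf] at hne
  rw [hP.dist_eq hf htf hyf, hP.dist_eq hf htf hyf'] at h1
  rw [hP.dist_eq hf huf hyf, hP.dist_eq hf huf hyf'] at h2
  rw [← dist_eq_zero, hP.dist_eq hf hyf hyf', norm_eq_zero, sub_eq_zero]
  have him : 0 ≤ (lin (K.place a b 1) y.val).im := by
    rw [ly]; simp only [Pi.one_apply, one_mul]; exact mul_nonneg (y.nonneg c) hh.le
  have him' : 0 ≤ (lin (K.place a b 1) y'.val).im := by
    rw [ly']; simp only [Pi.one_apply, one_mul]; exact mul_nonneg (y'.nonneg c) hh.le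
  have q1 := congrArg (· ^ 2) h1
  have q2 := congrArg (· ^ 2) h2
  simp only [← Complex.normSq_eq_norm_sq, Complex.normSq_apply, Complex.sub_re, Complex.sub_im]
    at q1 q2
  rw [lt] at q1
  rw [lu] at q2
  have hne' : (lin (K.place a b 1) u.val).re - (lin (K.place a b 1) t.val).re ≠ 0 := by
    intro h0
    apply hne
    rw [norm_eq_zero]
    apply Complex.ext
    · rw [Complex.sub_re, h0]; rfl
    · rw [lu, lt]; simp
  rw [lu, lt] at hne'
  set z := lin (K.place a b 1) y.val
  set z' := lin (K.place a b 1) y'.val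
  simp only at q1 q2 hne'
  have hre : z.re = z'.re := by
    have : (u.val b * K.len a b - t.val b * K.len a b) * (z.re - z'.re) = 0 := by
      linear_combination (q1 - q2) / 2
    exact sub_eq_zero.1 ((mul_eq_zero.1 this).resolve_left hne')
  have hsq : z.im ^ 2 = z'.im ^ 2 := by
    rw [hre] at q1; linear_combination q1
  exact Complex.ext hre ((sq_eq_sq₀ him him').1 hsq)

set_option maxHeartbeats 800000 in
/-- If a geodesic passes through a point `u` of a free edge, then the prolongation of one of its
two halves beyond `u` along the edge is a geodesic. -/
theorem mem_seg_of_freeEdge (hT : K.AtMostTwo) {a b c : V} (h : K.FreeEdge a b c)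
    {t u p q : K.Pt hK} (ht : supp t.val = {a, b}) (hu : u.val ∈ cell {a, b}) (hut : u ≠ t)
    (hup : u ∈ seg p q) (hp : p ≠ u) (hq : q ≠ u) : u ∈ seg t p ∨ u ∈ seg t q := by
  -- If neither half prolongs the edge, the geodesics from a point `t₁` of the edge to the two
  -- halves start in different directions. But their points at distance `δ` from `t₁` trace, for
  -- either half, an arc of one half circle that begins at the same end on the edge, so the arcs
  -- overlap.
  by_contra! hcon
  obtain ⟨htp, htq⟩ := hcon
  have hfab : {a, b} ∈ K.faces := ht ▸ t.supp_mem
  -- move the points close to `u`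
  obtain ⟨ε, hε, hvert⟩ : ∃ ε > 0, ∀ w : K.Pt hK, dist u w < ε → w.IsVertex → w = u := by
    have hfin : Set.Finite {w : K.Pt hK | w.IsVertex ∧ w ≠ u} := by
      have : Set.Finite {w : K.Pt hK | w.IsVertex} := by
        refine Set.Finite.of_finite_image (f := Pt.val) ?_ Pt.val_injective.injOn
        refine (Set.finite_range (vertexPoint : V → V → ℝ)).subset ?_
        rintro _ ⟨w, ⟨v, hv⟩, rfl⟩
        exact ⟨v, hv.symm⟩
      exact this.subset fun w hw => hw.1
    have hop := hfin.isClosed.isOpen_compl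
    obtain ⟨ε, hε, hb⟩ := Metric.isOpen_iff.1 hop u (by simp)
    refine ⟨ε, hε, fun w hw hv => ?_⟩
    by_contra hne
    exact hb (by rwa [Metric.mem_ball, dist_comm] : w ∈ Metric.ball u ε) ⟨hv, hne⟩
  obtain ⟨t₁, ht₁, ht₁u, ht₁d, ht₁s⟩ : ∃ t₁ ∈ seg u t, t₁ ≠ u ∧ dist u t₁ < ε / 4 ∧
      supp t₁.val = {a, b} := by
    have htab : t.val ∈ cell {a, b} := Pt.mem_cell_iff.2 ht.subset
    obtain ⟨t₁, h1, h2, h3⟩ := exists_near hut (by positivity : 0 < ε / 4)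
    refine ⟨t₁, h1, h2, h3, ?_⟩
    apply subset_antisymm (supp_subset (seg_subset_cell hfab hu htab h1))
    intro v hv
    rw [mem_supp]
    intro h0
    exact mem_supp.1 (ht ▸ hv) (coord_eq_zero hfab hu htab h1 h2 h0)
  obtain ⟨p₁, hp₁, hp₁u, hp₁d⟩ := exists_near hp.symm (by positivity : 0 < ε / 4)
  obtain ⟨q₁, hq₁, hq₁u, hq₁d⟩ := exists_near hq.symm (by positivity : 0 < ε / 4)
  have trans : ∀ {p p₁ : K.Pt hK}, u ∉ seg t p → p₁ ∈ seg u p → p₁ ≠ u → u ∉ seg t₁ p₁ := by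
    intro p p₁ hn hp₁ hpu h
    have h1 := ext h hp₁ hpu.symm
    exact hn (mem_comm.1 (ext (mem_comm.1 h1) ht₁ ht₁u.symm))
  have htp₁ := trans htp hp₁ hp₁u
  have htq₁ := trans htq hq₁ hq₁u
  have hup₁ : u ∈ seg p₁ q₁ := mem_mid' (mem_comm.1 (mem_mid' (mem_comm.1 hup) hp₁)) hq₁
  clear trans hup htp htq
  -- no geodesic from `t₁` to a point close to `u` has other vertices in it
  have hnov : ∀ v, dist u v < ε / 4 → ∀ w ∈ seg t₁ v, w.IsVertex → w = u := by
    intro v hv w hw hwv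
    apply hvert w _ hwv
    have h1 := dist_le_of_mem hw
    linarith [dist_triangle u t₁ w, dist_triangle t₁ u v, dist_comm t₁ u]
  have hnear : ∀ {p₁ v : K.Pt hK}, dist u p₁ < ε / 4 → v ∈ seg u p₁ → dist u v < ε / 4 :=
    fun h1 h2 => (dist_le_of_mem h2).trans_lt h1
  have hnu : ∀ {p₁ v : K.Pt hK}, u ∉ seg t₁ p₁ → v ∈ seg u p₁ → v ≠ u → u ∉ seg t₁ v :=
    fun h1 h2 h3 h4 => h1 (ext h4 h2 h3.symm)
  -- geodesics from `t₁` to different points start in different directions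
  have hdir : ∀ v ∈ seg u p₁, ∀ v' ∈ seg u q₁, ¬ (v = u ∧ v' = u) → ∀ g, g ≠ t₁ → g ∈ seg t₁ v →
      g ∈ seg t₁ v' → False := by
    intro v hv v' hv' hne g hg hgv hgv'
    -- Two such geodesics with a common direction separate at `v`, at `v'` or at a vertex, and the
    -- only vertex available is `u`. In each case `u` would lie on a geodesic from `t₁` to `p₁` or
    -- to `q₁`.
    obtain ⟨w, hw, hwe⟩ := exists_branch t₁ v v'
    have hgw : g ∈ seg t₁ w := by rw [← hwe]; exact ⟨hgv, hgv'⟩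
    have hwt : w ≠ t₁ := by
      rintro rfl; rw [seg_self] at hgw; exact hg hgw
    have huv : u ∈ seg v v' := mem_mid' (mem_comm.1 (mem_mid' (mem_comm.1 hup₁) hv)) hv'
    by_cases hwv : w = v
    · -- `v` lies on the geodesic to `v'`
      rw [hwv] at hw
      by_cases hv'u : v' = u
      · rw [hv'u] at hw
        have hvu : v ≠ u := fun h => hne ⟨h, hv'u⟩
        have h1 : u ∈ seg v q₁ := mem_mid' (mem_comm.1 (mem_mid' (mem_comm.1 hup₁) hv)) (right_mem _ _)
        exact htq₁ (ext' hw.2 h1 hvu)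
      · exact hnu htq₁ hv' hv'u (mem_of_mem_right hw.2 huv)
    · by_cases hwv' : w = v'
      · rw [hwv'] at hw
        by_cases hvu : v = u
        · rw [hvu] at hw
          have hv'u : v' ≠ u := fun h => hne ⟨hvu, h⟩
          have h1 : u ∈ seg v' p₁ := mem_comm.1 (mem_mid' hup₁ hv')
          exact htp₁ (ext' hw.1 h1 hv'u)
        · exact hnu htp₁ hv hvu (mem_of_mem_right hw.1 (mem_comm.1 huv))
      · have hwver : w.IsVertex := by
          by_contra hwver
          obtain ⟨w', h1, h2, h3⟩ := exists_common hT hwver hw.1 hw.2 hwt.symm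
            (fun h => hwv h.symm) (fun h => hwv' h.symm)
          exact h1 (branch_disjoint hwe hw h2 h3)
        have hwu := hnov v (hnear hp₁d hv) w hw.1 hwver
        rw [hwu] at hw hwv hwv'
        exact hnu htp₁ hv (fun h => hwv h.symm) hw.1
  -- the points at a small distance from `t₁`
  obtain ⟨ρ, hρ, hdisc⟩ := exists_half_disc h ht₁s
  have htn : t₁ ∉ seg p₁ q₁ := by
    intro hmem
    rcases mem_split hup₁ hmem with h1 | h1
    · have h2 := mem_mid' (mem_comm.1 (mem_mid' (mem_comm.1 hup₁) (mem_comm.1 h1))) (right_mem u q₁)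
      exact htq₁ h2
    · exact htp₁ (mem_comm.1 (mem_mid' hup₁ h1))
  obtain ⟨δ, hδ, hδρ, hδd⟩ : ∃ δ > 0, δ < ρ ∧ ∀ v ∈ seg p₁ q₁, δ ≤ dist t₁ v := by
    obtain ⟨η, hη, hb⟩ := Metric.isOpen_iff.1 (isClosed_seg p₁ q₁).isOpen_compl t₁ htn
    refine ⟨min (ρ / 2) (η / 2), by positivity, (min_le_left _ _).trans_lt (by linarith),
      fun v hv => ?_⟩
    by_contra hlt
    push Not at hlt
    refine hb (?_ : v ∈ Metric.ball t₁ η) hv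
    rw [Metric.mem_ball, dist_comm]
    linarith [min_le_right (ρ / 2) (η / 2)]
  have hpq : ∀ {v}, v ∈ seg p₁ q₁ → 0 < dist t₁ v := fun hv => hδ.trans_le (hδd _ hv)
  obtain ⟨g, hg1, hg2, hgc⟩ : ∃ g : K.Pt hK → K.Pt hK, (∀ v ∈ seg p₁ q₁, dist t₁ (g v) = δ) ∧
      (∀ v, g v ∈ seg t₁ v) ∧ ContinuousOn g (seg p₁ q₁) := by
    refine ⟨fun v => pt t₁ v (δ / dist t₁ v), fun v hv => ?_, fun v => pt_mem_seg _ _ _, ?_⟩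
    · have := hpq hv
      rw [dist_left_pt ⟨by positivity, by rw [div_le_one this]; exact hδd v hv⟩]
      field_simp
    · have h1 : ContinuousOn (fun v : K.Pt hK => (t₁, v, δ / dist t₁ v)) (seg p₁ q₁) := by
        refine continuousOn_const.prodMk (continuousOn_id.prodMk ?_)
        exact continuousOn_const.div (continuous_const.dist continuous_id).continuousOn
          fun v hv => (hpq hv).ne'
      exact continuous_pt.comp_continuousOn h1
  have hsp : seg u p₁ ⊆ seg p₁ q₁ := fun v hv => mem_of_mem_left hup₁ (mem_comm.1 hv)
  have hsq : seg u q₁ ⊆ seg p₁ q₁ := fun v hv => mem_of_mem_right hup₁ hv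
  have huu : u ∈ seg p₁ q₁ := hup₁
  have hgt : ∀ v ∈ seg p₁ q₁, g v ≠ t₁ := by
    intro v hv h0
    have := hg1 v hv
    rw [h0, dist_self] at this
    linarith
  have ht₁ab : t₁.val ∈ cell {a, b} := Pt.mem_cell_iff.2 ht₁s.subset
  have hguE : (g u).val ∈ cell {a, b} := seg_subset_cell hfab ht₁ab hu (hg2 u)
  -- On the small half circle around `t₁`, a point is determined by its distance from the end `g u`
  -- on the edge.
  have hinj : ∀ v ∈ seg p₁ q₁, ∀ v' ∈ seg p₁ q₁, dist (g u) (g v) = dist (g u) (g v') →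
      g v = g v' := fun v hv v' hv' hd =>
    hdisc (g u) _ _ hguE (hgt u huu) (by rw [hg1 v hv]; exact hδρ) (by rw [hg1 v' hv']; exact hδρ)
      (by rw [hg1 v hv, hg1 v' hv']) hd
  have hhc : ContinuousOn (fun v => dist (g u) (g v)) (seg p₁ q₁) :=
    (continuous_const.dist continuous_id).comp_continuousOn hgc
  have hgp : g u ≠ g p₁ := fun h0 =>
    hdir p₁ (right_mem _ _) u (left_mem _ _) (fun h => hp₁u h.1) (g u) (hgt u huu)
      (h0 ▸ hg2 p₁) (hg2 u)
  have hgq : g u ≠ g q₁ := fun h0 =>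
    hdir u (left_mem _ _) q₁ (right_mem _ _) (fun h => hq₁u h.2) (g u) (hgt u huu)
      (hg2 u) (h0 ▸ hg2 q₁)
  -- A distance from `g u` that both arcs attain, by the intermediate value theorem.
  set m := min (dist (g u) (g p₁)) (dist (g u) (g q₁))
  have hm : 0 < m := lt_min (dist_pos.2 hgp) (dist_pos.2 hgq)
  obtain ⟨v, hv, hvm⟩ := (isPreconnected_seg u p₁).intermediate_value (left_mem _ _) (right_mem _ _)
    (hhc.mono hsp) (show m ∈ Icc _ _ from ⟨by rw [dist_self]; exact hm.le, min_le_left _ _⟩)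
  obtain ⟨v', hv', hvm'⟩ := (isPreconnected_seg u q₁).intermediate_value (left_mem _ _)
    (right_mem _ _) (hhc.mono hsq)
    (show m ∈ Icc _ _ from ⟨by rw [dist_self]; exact hm.le, min_le_right _ _⟩)
  have heq : g v = g v' := hinj v (hsp hv) v' (hsq hv') (hvm.trans hvm'.symm)
  refine hdir v hv v' hv' ?_ (g v) (hgt v (hsp hv)) (hg2 v) (heq ▸ hg2 v')
  rintro ⟨rfl, -⟩
  simp only [dist_self] at hvm
  linarith

end TriComplex

/-! ### Consequences of the planar drawing. -/

namespace TriComplex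

variable {V : Type*} [Fintype V] [DecidableEq V]

/-- The function on `V` with three prescribed values. -/
def triple (a b c : V) (α β γ : ℝ) : V → ℝ :=
  fun v => if v = a then α else if v = b then β else if v = c then γ else 0

lemma triple_left (a b c : V) (α β γ : ℝ) : triple a b c α β γ a = α := by simp [triple]

lemma triple_mid {a b : V} (hab : a ≠ b) (c : V) (α β γ : ℝ) : triple a b c α β γ b = β := by
  simp [triple, hab.symm]

lemma triple_right {a b c : V} (hac : a ≠ c) (hbc : b ≠ c) (α β γ : ℝ) :
    triple a b c α β γ c = γ := by simp [triple, hac.symm, hbc.symm]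

lemma triple_other {a b c v : V} (hv : v ∉ ({a, b, c} : Finset V)) (α β γ : ℝ) :
    triple a b c α β γ v = 0 := by
  simp only [Finset.mem_insert, Finset.mem_singleton, not_or] at hv
  simp [triple, hv.1, hv.2.1, hv.2.2]

lemma triple_mem_cell {a b c : V} (hab : a ≠ b) (hac : a ≠ c) (hbc : b ≠ c) {α β γ : ℝ}
    (hα : 0 ≤ α) (hβ : 0 ≤ β) (hγ : 0 ≤ γ) (h : α + β + γ = 1) :
    triple a b c α β γ ∈ cell {a, b, c} := by
  refine ⟨fun v => ?_, ?_, fun v hv => triple_other hv _ _ _⟩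
  · simp only [triple]; split_ifs <;> first | assumption | exact le_rfl
  · rw [sum_triple hab hac hbc fun v hv => triple_other hv _ _ _, triple_left, triple_mid hab,
      triple_right hac hbc, h]

lemma draw_triple {a b c : V} (hab : a ≠ b) (hac : a ≠ c) (hbc : b ≠ c) (α β γ : ℝ)
    (pos : V → EuclideanSpace ℝ (Fin 2)) :
    draw pos (triple a b c α β γ) = α • pos a + β • pos b + γ • pos c := by
  rw [draw, sum_triple hab hac hbc fun v hv => by rw [triple_other hv, zero_smul], triple_left,
    triple_mid hab, triple_right hac hbc]

end TriComplex

namespace PlanarComplex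

open TriComplex

variable {V : Type*} [Fintype V] [DecidableEq V] {K : PlanarComplex V}

/-- The determinant of two vectors of the plane. -/
def cross (x y : EuclideanSpace ℝ (Fin 2)) : ℝ := x 0 * y 1 - x 1 * y 0

lemma cross_smul_sub (w x y : EuclideanSpace ℝ (Fin 2)) (r s : ℝ) :
    cross w (r • x - s • y) = r * cross w x - s * cross w y := by
  simp [cross]; ring

lemma exists_smul_of_cross {w x : EuclideanSpace ℝ (Fin 2)} (hw : w ≠ 0) (h : cross w x = 0) :
    ∃ μ : ℝ, x = μ • w := by
  unfold cross at h
  by_cases h0 : w 0 = 0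
  · have h1 : w 1 ≠ 0 := by
      intro h1; apply hw; ext i; fin_cases i <;> simp [h0, h1]
    refine ⟨x 1 / w 1, ?_⟩
    rw [h0, zero_mul, zero_sub, neg_eq_zero] at h
    have h2 := (mul_eq_zero.1 h).resolve_left h1
    ext i; fin_cases i
    · simp [h0, h2]
    · simp [h1]
  · refine ⟨x 0 / w 0, ?_⟩
    ext i; fin_cases i
    · simp [h0]
    · simp only [Fin.mk_one, PiLp.smul_apply, smul_eq_mul]
      field_simp; linarith

lemma pos_ne {a b : V} (hab : a ≠ b) : K.pos a ≠ K.pos b := by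
  intro h
  have hv : ∀ v, vertexPoint v ∈ K.space := fun v =>
    ⟨{v}, K.vertex_mem v, fun w => by
      unfold vertexPoint; rcases eq_or_ne w v with rfl | h <;> simp [*], by simp [vertexPoint],
      fun w hw => by simp at hw; simp [vertexPoint, hw]⟩
  have hd : ∀ v, draw K.pos (vertexPoint v) = K.pos v := fun v => by
    rw [draw, Finset.sum_eq_single v (fun w _ hw => by simp [vertexPoint, hw]) (by simp)]
    simp [vertexPoint]
  have := K.draw_injOn (hv a) (hv b) (by rw [hd, hd, h])
  have := congrFun this a
  simp [vertexPoint, hab] at this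

variable (K) in
/-- On which side of the edge `a b` the vertex `c` is drawn. -/
def side (a b c : V) : ℝ := cross (K.pos b - K.pos a) (K.pos c - K.pos a)

/-- If `c` were drawn on the line of the edge, a point of the triangle close to the midpoint of the
edge would have the same image as a point of the edge. -/
lemma side_ne_zero {a b c : V} (hab : a ≠ b) (hac : a ≠ c) (hbc : b ≠ c)
    (hf : {a, b, c} ∈ K.faces) : K.side a b c ≠ 0 := by
  intro h
  obtain ⟨μ, hμ⟩ := exists_smul_of_cross (sub_ne_zero.2 (pos_ne hab.symm)) h
  obtain ⟨t, ht0, ht1, ht2⟩ : ∃ t : ℝ, 0 < t ∧ t ≤ 1 / 2 ∧ t * |μ| ≤ 1 / 2 := by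
    refine ⟨1 / (2 * (1 + |μ|)), by positivity, ?_, ?_⟩
    · rw [div_le_div_iff₀ (by positivity) (by positivity)]; nlinarith [abs_nonneg μ]
    · rw [div_mul_eq_mul_div, div_le_div_iff₀ (by positivity) (by positivity)]
      nlinarith [abs_nonneg μ]
  have b1 := mul_le_mul_of_nonneg_left (le_abs_self μ) ht0.le
  have b2 := mul_le_mul_of_nonneg_left (neg_abs_le μ) ht0.le
  have h1 := triple_mem_cell hab hac hbc (α := 1 / 2 - t) (β := 1 / 2) (γ := t) (by linarith)
    (by linarith) ht0.le (by ring)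
  have h2 := triple_mem_cell hab hac hbc (α := 1 / 2 - t * μ) (β := 1 / 2 + t * μ) (γ := 0)
    (by linarith) (by linarith) le_rfl (by ring)
  have := K.draw_injOn (mem_space hf h1) (mem_space hf h2) (by
    rw [draw_triple hab hac hbc, draw_triple hab hac hbc]
    have hc : K.pos c = μ • (K.pos b - K.pos a) + K.pos a := by rw [← hμ]; abel
    rw [hc]
    module)
  have := congrFun this c
  rw [triple_right hac hbc, triple_right hac hbc] at this
  exact ht0.ne' this

/-- Two triangles drawn on the same side of their common edge overlap near its midpoint. The weights
`κ` and `κ'` give points at the same height, and `μ` corrects their position along the edge. -/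
lemma side_mul_neg {a b c d : V} (hab : a ≠ b) (hac : a ≠ c) (hbc : b ≠ c) (had : a ≠ d)
    (hbd : b ≠ d) (hcd : c ≠ d) (hf : {a, b, c} ∈ K.faces) (hf' : {a, b, d} ∈ K.faces) :
    K.side a b c * K.side a b d < 0 := by
  have h1 := side_ne_zero hab hac hbc hf
  have h2 := side_ne_zero hab had hbd hf'
  by_contra hpos
  have hpos : 0 < K.side a b c * K.side a b d :=
    lt_of_le_of_ne (not_lt.1 hpos) (mul_ne_zero h1 h2).symm
  set κ := |K.side a b c|
  set κ' := |K.side a b d|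
  have hκ : 0 < κ := abs_pos.2 h1
  have hκ' : 0 < κ' := abs_pos.2 h2
  obtain ⟨μ, hμ⟩ := exists_smul_of_cross (sub_ne_zero.2 (pos_ne (K := K) hab.symm))
    (x := κ' • (K.pos c - K.pos a) - κ • (K.pos d - K.pos a)) (by
      rw [cross_smul_sub]
      change κ' * K.side a b c - κ * K.side a b d = 0
      rcases pos_and_pos_or_neg_and_neg_of_mul_pos hpos with ⟨h3, h4⟩ | ⟨h3, h4⟩
      · simp only [κ, κ', abs_of_pos h3, abs_of_pos h4]; ring
      · simp only [κ, κ', abs_of_neg h3, abs_of_neg h4]; ring)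
  obtain ⟨t, ht0, ht1, ht2⟩ : ∃ t : ℝ, 0 < t ∧ t * κ' ≤ 1 / 2 ∧ t * κ + t * |μ| ≤ 1 / 2 := by
    have := abs_nonneg μ
    refine ⟨1 / (2 * (κ + κ' + |μ|)), by positivity, ?_, ?_⟩
    · rw [div_mul_eq_mul_div, div_le_div_iff₀ (by positivity) (by positivity)]; linarith
    · rw [← mul_add, div_mul_eq_mul_div, div_le_div_iff₀ (by positivity) (by positivity)]; linarith
  have b1 := mul_le_mul_of_nonneg_left (le_abs_self μ) ht0.le
  have b2 := mul_le_mul_of_nonneg_left (neg_abs_le μ) ht0.le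
  have b3 := mul_pos ht0 hκ
  have b4 := mul_pos ht0 hκ'
  have m1 := triple_mem_cell hab hac hbc (α := 1 / 2 - t * κ') (β := 1 / 2) (γ := t * κ')
    (by linarith) (by linarith) b4.le (by ring)
  have m2 := triple_mem_cell hab had hbd (α := 1 / 2 - t * κ - t * μ) (β := 1 / 2 + t * μ)
    (γ := t * κ) (by linarith) (by linarith) b3.le (by ring)
  have := K.draw_injOn (mem_space hf m1) (mem_space hf' m2) (by
    rw [draw_triple hab hac hbc, draw_triple hab had hbd, ← sub_eq_zero]
    have : (1 / 2 - t * κ') • K.pos a + (1 / 2 : ℝ) • K.pos b + (t * κ') • K.pos c -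
        ((1 / 2 - t * κ - t * μ) • K.pos a + (1 / 2 + t * μ) • K.pos b + (t * κ) • K.pos d) =
        t • (κ' • (K.pos c - K.pos a) - κ • (K.pos d - K.pos a) - μ • (K.pos b - K.pos a)) := by
      module
    rw [this, hμ, sub_self, smul_zero])
  have := congrFun this c
  rw [triple_right hac hbc, triple_other (by simp [hac.symm, hbc.symm, hcd])] at this
  exact b4.ne' this

variable (K) in
-- Three nonzero numbers cannot have pairwise opposite signs.
lemma atMostTwo : K.AtMostTwo := by
  intro a b c d e hab hac hbc had hbd hae hbe hc hd he hcd hce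
  by_contra hde
  have h1 := side_mul_neg hab hac hbc had hbd hcd hc hd
  have h2 := side_mul_neg hab hac hbc hae hbe hce hc he
  have h3 := side_mul_neg hab had hbd hae hbe hde hd he
  nlinarith [mul_pos_of_neg_of_neg h1 h2, sq_nonneg (K.side a b c)]

lemma continuous_draw (pos : V → EuclideanSpace ℝ (Fin 2)) : Continuous (draw pos) := by
  unfold draw; fun_prop

lemma cross_draw (w : EuclideanSpace ℝ (Fin 2)) (pos : V → EuclideanSpace ℝ (Fin 2))
    (x : V → ℝ) : cross w (draw pos x) = ∑ v, x v * cross w (pos v) := by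
  simp only [cross, draw, WithLp.ofLp_sum, Finset.sum_apply, PiLp.smul_apply, smul_eq_mul,
    Finset.mul_sum, ← Finset.sum_sub_distrib]
  exact Finset.sum_congr rfl fun v _ => by ring

/-- The free edges are drawn on the frontier. -/
theorem mem_boundary {hK : K.IsCAT0} {t : K.Pt hK} (ht : t.OnFreeEdge) : t.val ∈ K.boundary := by
  obtain ⟨a, b, c, ⟨hab, hac, hbc, hf, huniq⟩, hs⟩ := ht
  refine ⟨t.mem, subset_closure ⟨_, t.mem, rfl⟩, fun hint => ?_⟩
  have hta : t.val a ≠ 0 := mem_supp.1 (by simp [hs])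
  have htb : t.val b ≠ 0 := mem_supp.1 (by simp [hs])
  have hcl : IsClosed (draw K.pos '' (K.space ∩ {x | x a = 0 ∨ x b = 0})) := by
    refine (IsCompact.image ?_ (continuous_draw _)).isClosed
    refine K.isCompact_space.inter_right ?_
    exact (isClosed_eq (continuous_apply a) continuous_const).union
      (isClosed_eq (continuous_apply b) continuous_const)
  have hnF : draw K.pos t.val ∉ draw K.pos '' (K.space ∩ {x | x a = 0 ∨ x b = 0}) := by
    rintro ⟨y, ⟨hy, h⟩, he⟩
    have := K.draw_injOn hy t.mem he
    subst this
    exact h.elim hta htb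
  have hopen := (isOpen_interior (s := draw K.pos '' K.space)).inter hcl.isOpen_compl
  -- Were the image an interior point, one could step off the edge away from `c` and remain in the
  -- drawing. Close to `t` both coordinates `a` and `b` are nonzero, so the point reached belongs to
  -- the only triangle at the edge, yet is drawn on the wrong side of it.
  have hQ : Continuous fun s : ℝ => draw K.pos t.val - s • (K.pos c - K.pos a) := by fun_prop
  have hev := (hQ.tendsto 0).eventually (hopen.mem_nhds (by
rw [zero_smul, sub_zero]; exact ⟨hint, hnF⟩ : draw K.pos t.val - (0 : ℝ) • (K.pos c - K.pos a) ∈ _))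
  obtain ⟨ε, hε, hb⟩ := Metric.eventually_nhds_iff.1 hev
  obtain ⟨h1, h2⟩ := hb (y := ε / 2) (by
    rw [Real.dist_eq, sub_zero, abs_of_pos (by positivity)]; linarith)
  obtain ⟨y, hy, hye⟩ := interior_subset h1
  set y' := hK.mk y hy
  have hya : y a ≠ 0 := fun h => h2 ⟨y, ⟨hy, Or.inl h⟩, hye⟩
  have hyb : y b ≠ 0 := fun h => h2 ⟨y, ⟨hy, Or.inr h⟩, hye⟩
  have hyc : y ∈ cell {a, b, c} := by
    refine (Pt.mem_cell_iff (a := y')).2 fun v hv => ?_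
    simp only [Finset.mem_insert, Finset.mem_singleton]
    by_contra! hne
    refine hne.2.2 (huniq v hne.1.symm hne.2.1.symm (mem_faces_sub y'.supp_mem ?_ (by simp)))
    intro w
    simp only [Finset.mem_insert, Finset.mem_singleton]
    rintro (rfl | rfl | rfl)
    · exact mem_supp.2 hya
    · exact mem_supp.2 hyb
    · exact hv
  have htc : t.val ∈ cell {a, b, c} := Pt.mem_cell_iff.2 (hs ▸ by intro v; simp; tauto)
  have htc0 : t.val c = 0 := by
    by_contra h
    have := mem_supp.2 h
    rw [hs] at this
    simp [hac.symm, hbc.symm] at this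
  -- compare the positions relative to the line through the edge
  set w := K.pos b - K.pos a
  have hw : cross w (K.pos b) = cross w (K.pos a) := by
    simp only [cross, w, PiLp.sub_apply]; ring
  have hside : cross w (K.pos c - K.pos a) = cross w (K.pos c) - cross w (K.pos a) := by
    simp only [cross, PiLp.sub_apply]; ring
  have e1 : ∀ x ∈ cell {a, b, c}, cross w (draw K.pos x) =
      cross w (K.pos a) + x c * cross w (K.pos c - K.pos a) := by
    intro x hx
    have hsum := sum_triple hab hac hbc hx.2.2
    rw [hx.2.1] at hsum
    rw [cross_draw, sum_triple hab hac hbc fun v hv => by rw [hx.2.2 v hv, zero_mul], hw, hside]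
    linear_combination (-cross w (K.pos a)) * hsum
  have e2 : cross w (draw K.pos t.val - (ε / 2) • (K.pos c - K.pos a)) =
      cross w (draw K.pos t.val) - ε / 2 * cross w (K.pos c - K.pos a) := by
    have := cross_smul_sub w (draw K.pos t.val) (K.pos c - K.pos a) 1 (ε / 2)
    rwa [one_smul, one_mul] at this
  rw [← hye, e1 y hyc, e1 t.val htc, htc0] at e2
  have hne : cross w (K.pos c - K.pos a) ≠ 0 := side_ne_zero hab hac hbc hf
  have h3 : (y c + ε / 2) * cross w (K.pos c - K.pos a) = 0 := by linear_combination e2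
  have h4 := (mul_eq_zero.1 h3).resolve_right hne
  have := hyc.1 c
  linarith

end PlanarComplex

/-! ### Fans -/

/-- Concatenation of finite sequences. -/
lemma exists_concat {α : Type*} (n : ℕ) (w w' : ℕ → α) (h : w n = w' 0) :
    ∃ v : ℕ → α, (∀ i ≤ n, v i = w i) ∧ ∀ i, v (n + i) = w' i := by
  refine ⟨fun i => if i ≤ n then w i else w' (i - n), fun i hi => by simp [hi], fun i => ?_⟩
  rcases Nat.eq_zero_or_pos i with rfl | hi
  · simp [h]
  · dsimp only
    rw [if_neg (by omega), Nat.add_sub_cancel_left]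

/-- A finite closed cover of an interval admits a chain from one end to the other. -/
lemma exists_chain {ι : Type*} [DecidableEq ι] (F : ι → Set ℝ) (hF : ∀ j, IsClosed (F j)) (l : ℝ) :
    ∀ (k : ℕ) (J : Finset ι), J.card = k → ∀ s ≤ l, (∀ t ∈ Icc s l, ∃ j ∈ J, t ∈ F j) →
    ∃ (n : ℕ) (c : ℕ → ℝ), c 0 = s ∧ c n = l ∧ (∀ i ≤ n, c i ∈ Icc s l) ∧
      ∀ i < n, c i ≤ c (i + 1) ∧ ∃ j ∈ J, c i ∈ F j ∧ c (i + 1) ∈ F j := by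
  intro k
  induction k with
  | zero =>
    intro J hJ s hs h
    obtain ⟨j, hj, -⟩ := h s ⟨le_rfl, hs⟩
    simp [Finset.card_eq_zero.1 hJ] at hj
  | succ k ih =>
    intro J hJ s hs h
    obtain ⟨j, hj, hsj⟩ := h s ⟨le_rfl, hs⟩
    obtain ⟨m, ⟨hmF, hm⟩, hmax⟩ := ((isCompact_Icc (a := s) (b := l)).inter_left
      (hF j)).exists_isMaxOn ⟨s, hsj, le_rfl, hs⟩ (continuous_id.continuousOn)
    have hmax' : ∀ t ∈ Icc s l, t ∈ F j → t ≤ m := fun t ht htF => hmax ⟨htF, ht⟩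
    rcases hm.2.eq_or_lt with rfl | hml
    · refine ⟨1, fun i => if i = 0 then s else m, by simp, by simp, ?_, ?_⟩
      · intro i _; dsimp only; split_ifs
        exacts [⟨le_rfl, hs⟩, ⟨hs, le_rfl⟩]
      · intro i hi
        obtain rfl : i = 0 := by omega
        exact ⟨by simpa using hs, j, hj, by simpa using hsj, by simpa using hmF⟩
    -- Beyond its last point `m` the set `F j` is not needed, and the remaining closed sets also
    -- cover `m` itself. So the induction on their number continues from `m`.
    · have hcov : Icc m l ⊆ ⋃ i ∈ J.erase j, F i := by
        have hcl : IsClosed (⋃ i ∈ J.erase j, F i) := (J.erase j).finite_toSet.isClosed_biUnion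
          fun i _ => hF i
        rw [← closure_Ioc hml.ne]
        refine hcl.closure_subset_iff.2 fun t ht => ?_
        have ht' : t ∈ Icc s l := ⟨hm.1.trans ht.1.le, ht.2⟩
        obtain ⟨i, hi, hti⟩ := h t ht'
        refine mem_biUnion (x := i) ?_ hti
        refine Finset.mem_erase.2 ⟨?_, hi⟩
        rintro rfl
        exact absurd (hmax' t ht' hti) (not_le.2 ht.1)
      obtain ⟨n, c, h0, hn, hI, hc⟩ := ih (J.erase j) (by rw [Finset.card_erase_of_mem hj, hJ]; rfl)
        m hml.le fun t ht => by simpa using mem_iUnion₂.1 (hcov ht)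
      refine ⟨n + 1, fun i => Nat.casesOn i s c, rfl, hn, ?_, ?_⟩
      · rintro (_ | i) hi
        · exact ⟨le_rfl, hs⟩
        · exact ⟨hm.1.trans (hI i (by omega)).1, (hI i (by omega)).2⟩
      · rintro (_ | i) hi
        · exact ⟨by simpa [h0] using hm.1, j, hj, hsj, by simpa [h0] using hmF⟩
        · obtain ⟨h1, i', h2, h3⟩ := hc i (by omega)
          exact ⟨h1, i', Finset.mem_of_mem_erase h2, h3⟩

namespace TriComplex
open CatZero

variable {V : Type*} [Fintype V] [DecidableEq V] {K : TriComplex V} {hK : K.IsCAT0}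

/-- The law of cosines, for points on the rays through two given points. -/
lemma dist_sq_of_angle {f : Finset V} (hf : f ∈ K.faces) {u a b a' b' : K.Pt hK}
    (hu : u.val ∈ cell f) (ha : a.val ∈ cell f) (hb : b.val ∈ cell f) (ha' : a'.val ∈ cell f)
    (hb' : b'.val ∈ cell f) (hau : a ≠ u) (hbu : b ≠ u) {s t : ℝ}
    (hs : a'.val = u.val + s • (a.val - u.val)) (ht : b'.val = u.val + t • (b.val - u.val)) :
    dist a' b' ^ 2 = (s * dist u a) ^ 2 + (t * dist u b) ^ 2 -
      2 * (s * dist u a) * (t * dist u b) * Real.cos (K.cellAngle u.val a.val b.val) := by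
  obtain ⟨P, hP⟩ := exists_develops hf
  have hda : 0 < dist u a := dist_pos.2 hau.symm
  have hdb : 0 < dist u b := dist_pos.2 hbu.symm
  have hin : K.cellInner (a.val - u.val) (b.val - u.val) =
      inner ℝ (lin P a.val - lin P u.val) (lin P b.val - lin P u.val) := by
    rw [hP.cellInner, lin_sub, lin_sub]
    · intro v hv; simp [ha.2.2 v hv, hu.2.2 v hv]
    · intro v hv; simp [hb.2.2 v hv, hu.2.2 v hv]
    · simp [ha.2.1, hu.2.1]
    · simp [hb.2.1, hu.2.1]
  have ea : ‖lin P a.val - lin P u.val‖ = dist u a := by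
    rw [dist_comm, hP.dist_eq hf ha hu]
  have eb : ‖lin P b.val - lin P u.val‖ = dist u b := by
    rw [dist_comm, hP.dist_eq hf hb hu]
  have hcos : Real.cos (K.cellAngle u.val a.val b.val) =
      inner ℝ (lin P a.val - lin P u.val) (lin P b.val - lin P u.val) / (dist u a * dist u b) := by
    rw [cellAngle, ← dist_eq_cellDist hf hu ha, ← dist_eq_cellDist hf hu hb, hin, ← ea, ← eb,
      Real.cos_arccos]
    · exact (abs_le.1 (abs_real_inner_div_norm_mul_norm_le_one _ _)).1
    · exact (abs_le.1 (abs_real_inner_div_norm_mul_norm_le_one _ _)).2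
  have hlin : ∀ (c c' : K.Pt hK) (r : ℝ), c'.val = u.val + r • (c.val - u.val) →
      lin P c'.val = lin P u.val + r • (lin P c.val - lin P u.val) := by
    intro c c' r h
    have e : c'.val = (1 - r) • u.val + r • c.val := by rw [h, smul_sub, sub_smul, one_smul]; abel
    rw [e, lin_comb, smul_sub, sub_smul, one_smul]; abel
  have key : lin P a'.val - lin P b'.val =
      s • (lin P a.val - lin P u.val) - t • (lin P b.val - lin P u.val) := by
    rw [hlin a a' s hs, hlin b b' t ht]; abel
  rw [hP.dist_eq hf ha' hb', key, norm_sub_sq_real, norm_smul, norm_smul, ea, eb, mul_pow, mul_pow,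
    Real.norm_eq_abs, Real.norm_eq_abs, sq_abs, sq_abs, inner_smul_left, inner_smul_right, hcos]
  simp only [conj_trivial]
  field_simp
  ring

lemma dist_sq_eq {f : Finset V} (hf : f ∈ K.faces) {u a b : K.Pt hK}
    (hu : u.val ∈ cell f) (ha : a.val ∈ cell f) (hb : b.val ∈ cell f) (hau : a ≠ u) (hbu : b ≠ u) :
    dist a b ^ 2 = dist u a ^ 2 + dist u b ^ 2 -
      2 * dist u a * dist u b * Real.cos (K.cellAngle u.val a.val b.val) := by
  simpa using dist_sq_of_angle hf hu ha hb ha hb hau hbu (s := 1) (t := 1) (by simp) (by simp)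

/-- In a cell, the points of a segment are affine combinations. -/
lemma pt_val {f : Finset V} (hf : f ∈ K.faces) {a b : K.Pt hK} (ha : a.val ∈ cell f)
    (hb : b.val ∈ cell f) {t : ℝ} (ht : t ∈ Icc (0 : ℝ) 1) :
    (pt a b t).val = a.val + t • (b.val - a.val) := by
  obtain ⟨P, hP⟩ := exists_develops hf
  have e : a.val + t • (b.val - a.val) = (1 - t) • a.val + t • b.val := by
    rw [smul_sub, sub_smul, one_smul]; abel
  have hy : a.val + t • (b.val - a.val) ∈ cell f :=
    e ▸ convex_cell f ha hb (by linarith [ht.2]) ht.1 (by ring)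
  set y := hK.mk _ (mem_space hf hy) with hydef
  suffices h : pt a b t = y by rw [h, hydef, IsCAT0.mk_val]
  refine pt_eq ht ((mem_seg_iff_segment hf ha hb).2
    ⟨1 - t, t, by linarith [ht.2], ht.1, by ring, e.symm⟩) ?_
  have e1 : lin P a.val - lin P y.val = t • (lin P a.val - lin P b.val) := by
    rw [hydef, IsCAT0.mk_val, e, lin_comb]
    simp only [sub_smul, smul_sub, one_smul]; abel
  rw [hP.dist_eq hf ha (b := y) hy, hP.dist_eq hf ha hb, e1, norm_smul, Real.norm_of_nonneg ht.1]

lemma cellAngle_nonneg (u a b : V → ℝ) : 0 ≤ K.cellAngle u a b := Real.arccos_nonneg _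

lemma cellAngle_le_pi (u a b : V → ℝ) : K.cellAngle u a b ≤ Real.pi := Real.arccos_le_pi _

variable (K) in
/-- The triangle `u`, `a`, `b` may occur in a fan at `u` inside `S`. -/
def FanStep (S : Set (V → ℝ)) (u a b : V → ℝ) : Prop :=
  (∃ f ∈ K.faces, u ∈ cell f ∧ a ∈ cell f ∧ b ∈ cell f) ∧ convexHull ℝ {u, a, b} ⊆ S ∧
    K.cellAngle u a b < Real.pi

variable (K) in
/-- There is a fan at `u` inside `S` of total angle `L` from the point `a` to the point `b`. -/
def FanReach (S : Set (V → ℝ)) (u a b : V → ℝ) (L : ℝ) : Prop :=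
  ∃ (n : ℕ) (w : ℕ → V → ℝ), w 0 = a ∧ w n = b ∧ (∀ i ≤ n, w i ≠ u) ∧
    (∀ i < n, K.FanStep S u (w i) (w (i + 1))) ∧
    L = ∑ i ∈ Finset.range n, K.cellAngle u (w i) (w (i + 1))

lemma FanReach.trans {S : Set (V → ℝ)} {u a b c : V → ℝ} {L M : ℝ} (h : K.FanReach S u a b L)
    (h' : K.FanReach S u b c M) : K.FanReach S u a c (L + M) := by
  obtain ⟨n, w, h0, hn, hne, hw, rfl⟩ := h
  obtain ⟨m, w', h0', hm', hne', hw', rfl⟩ := h'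
  obtain ⟨v, h1, h2⟩ := exists_concat n w w' (hn.trans h0'.symm)
  refine ⟨n + m, v, by rw [h1 0 (Nat.zero_le _), h0], by rw [h2, hm'], ?_, ?_, ?_⟩
  · intro i hi
    rcases le_or_gt i n with hin | hin
    · rw [h1 i hin]; exact hne i hin
    · obtain ⟨j, rfl⟩ := Nat.exists_eq_add_of_lt hin
      rw [add_assoc, h2]; exact hne' _ (by omega)
  · intro i hi
    rcases lt_or_ge i n with hin | hin
    · rw [h1 i hin.le, h1 (i + 1) hin]; exact hw i hin
    · obtain ⟨j, rfl⟩ := Nat.exists_eq_add_of_le hin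
      rw [add_assoc, h2, h2]; exact hw' j (by omega)
  · rw [Finset.sum_range_add]
    congr 1
    · refine Finset.sum_congr rfl fun i hi => ?_
      have := Finset.mem_range.1 hi
      rw [h1 i this.le, h1 (i + 1) this]
    · refine Finset.sum_congr rfl fun i _ => ?_
      rw [add_assoc, h2, h2]

lemma FanReach.innerAngle_le {S : Set (V → ℝ)} {u a b a' b' : V → ℝ} {L : ℝ}
    (h : K.FanReach S u a' b' L) (ha : a' ∈ K.geod u a) (hb : b' ∈ K.geod u b) :
    K.innerAngle S u a b ≤ ENNReal.ofReal L := by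
  obtain ⟨n, w, rfl, rfl, hne, hw, rfl⟩ := h
  exact iInf_le_of_le n (iInf_le_of_le w (iInf_le_of_le ⟨ha, hb, hne, hw⟩ le_rfl))

/-- The triangles of a cell with vertices in a convex set lie in this set. -/
lemma convexHull_subset_image {C : Set (K.Pt hK)} (hC : ∀ r ∈ C, ∀ s ∈ C, seg r s ⊆ C)
    {f : Finset V} (hf : f ∈ K.faces) {u a b : K.Pt hK} (hu : u.val ∈ cell f) (ha : a.val ∈ cell f)
    (hb : b.val ∈ cell f) (huC : u ∈ C) (haC : a ∈ C) (hbC : b ∈ C) :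
    convexHull ℝ {u.val, a.val, b.val} ⊆ Pt.val '' C := by
  rw [convexHull_insert (by simp), convexHull_pair]
  intro y hy
  simp only [mem_convexJoin, mem_singleton_iff, exists_eq_left] at hy
  obtain ⟨m, hm, hy⟩ := hy
  have hmf := (convex_cell f).segment_subset ha hb hm
  have hyf := (convex_cell f).segment_subset hu hmf hy
  set m' := hK.mk m (mem_space hf hmf)
  set y' := hK.mk y (mem_space hf hyf)
  have hmC : m' ∈ C := hC a haC b hbC ((mem_seg_iff_segment hf ha hb).2 hm)
  exact ⟨y', hC u huC m' hmC ((mem_seg_iff_segment (b := m') hf hu hmf).2 hy), rfl⟩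

/-- The angles of a fan along a geodesic that misses the apex add up to less than `π`. -/
lemma sum_cellAngle_lt_pi {u : K.Pt hK} (n : ℕ) (w : ℕ → K.Pt hK) (hne : ∀ i ≤ n, w i ≠ u)
    (hf : ∀ i < n, ∃ f ∈ K.faces, u.val ∈ cell f ∧ (w i).val ∈ cell f ∧ (w (i + 1)).val ∈ cell f)
    (hlen : ∑ i ∈ Finset.range n, dist (w i) (w (i + 1)) < dist u (w 0) + dist u (w n)) :
    ∑ i ∈ Finset.range n, K.cellAngle u.val (w i).val (w (i + 1)).val < Real.pi := by
  set θ : ℕ → ℝ := fun k => ∑ i ∈ Finset.range k, K.cellAngle u.val (w i).val (w (i + 1)).val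
  by_contra! hpi
  -- Lay the fan out in the plane, with the polar angle stopped at `π`. Each step is at least as
  -- long as the change of the abscissa, and the abscissas run from the first distance to minus the
  -- last one. Hence the path is at least as long as the detour through `u`.
  set φ : ℕ → ℝ := fun k => min (θ k) Real.pi
  have hstep : ∀ i < n, dist u (w i) * Real.cos (φ i) - dist u (w (i + 1)) * Real.cos (φ (i + 1)) ≤
      dist (w i) (w (i + 1)) := by
    intro i hi
    obtain ⟨f, hf, h1, h2, h3⟩ := hf i hi
    have hd := dist_sq_eq hf h1 h2 h3 (hne i hi.le) (hne (i + 1) hi)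
    set α := K.cellAngle u.val (w i).val (w (i + 1)).val with hα
    have hα0 : 0 ≤ α := cellAngle_nonneg _ _ _
    have hθ : θ (i + 1) = θ i + α := Finset.sum_range_succ _ _
    have hφ1 : φ i ≤ φ (i + 1) := min_le_min_right _ (by linarith)
    have hφ2 : φ (i + 1) - φ i ≤ α := by
      simp only [φ, hθ]
      rcases le_total (θ i) Real.pi with h | h
      · rw [min_eq_left h]; linarith [min_le_left (θ i + α) Real.pi]
      · rw [min_eq_right h]; linarith [min_le_right (θ i + α) Real.pi]
    have hcos : Real.cos α ≤ Real.cos (φ (i + 1) - φ i) :=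
      Real.cos_le_cos_of_nonneg_of_le_pi (by linarith) (cellAngle_le_pi _ _ _) hφ2
    rw [Real.cos_sub] at hcos
    refine le_of_sq_le_sq ?_ dist_nonneg
    rw [hd]
    have h5 := mul_le_mul_of_nonneg_left hcos
      (mul_nonneg (dist_nonneg (x := u) (y := w i)) (dist_nonneg (x := u) (y := w (i + 1))))
    nlinarith [sq_nonneg (dist u (w i) * Real.sin (φ i) - dist u (w (i + 1)) * Real.sin (φ (i + 1))),
      Real.sin_sq_add_cos_sq (φ i), Real.sin_sq_add_cos_sq (φ (i + 1))]
  have hsum := Finset.sum_le_sum fun i (hi : i ∈ Finset.range n) => hstep i (Finset.mem_range.1 hi)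
  rw [Finset.sum_range_sub' (fun i => dist u (w i) * Real.cos (φ i))] at hsum
  have h0 : φ 0 = 0 := by simp [φ, θ, Real.pi_pos.le]
  have hn : φ n = Real.pi := min_eq_right hpi
  rw [h0, hn, Real.cos_zero, Real.cos_pi] at hsum
  linarith

/-- Near `u` there are fans of total angle less than `π` inside convex sets. -/
theorem exists_fan (u : K.Pt hK) : ∃ ε > 0, ∀ C : Set (K.Pt hK), (∀ r ∈ C, ∀ s ∈ C, seg r s ⊆ C) →
    u ∈ C → ∀ a ∈ C, ∀ b ∈ C, dist u a < ε → dist u b < ε → u ∉ seg a b →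
    ∃ L < Real.pi, K.FanReach (Pt.val '' C) u.val a.val b.val L := by
  classical
  obtain ⟨ρ, hρ, hstar⟩ := u.exists_star
  refine ⟨ρ / 3, by positivity, fun C hC huC a haC b hbC hda hdb hu => ?_⟩
  have hcell : ∀ σ, ∀ f, (pt a b σ).val ∈ cell f → u.val ∈ cell f := by
    intro σ f hf
    refine Pt.mem_cell_iff.2 ((hstar _ ?_).trans (Pt.mem_cell_iff.1 hf))
    have h1 := dist_triangle u a (pt a b σ)
    have h2 := dist_le_of_mem (pt_mem_seg a b σ)
    have h3 := dist_triangle a u b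
    rw [dist_comm a u] at h3
    linarith
  -- The geodesic is cut into finitely many pieces, each inside one cell. Such a cell also contains
  -- `u`, since the whole geodesic is within `ρ` of `u`.
  obtain ⟨n, c, h0, hn, hI, hc⟩ := exists_chain (fun f : Finset V => {σ | (pt a b σ).val ∈ cell f})
    (fun f => (isClosed_cell f).preimage (Pt.continuous_val.comp (continuous_pt_param a b))) 1 _
    (Finset.univ.filter (· ∈ K.faces)) rfl 0 zero_le_one (fun σ _ =>
      ⟨supp (pt a b σ).val, by simpa using Pt.supp_mem _, Pt.mem_cell_supp _⟩)
  have hne : ∀ i ≤ n, pt a b (c i) ≠ u := fun i _ h => hu (h ▸ pt_mem_seg a b (c i))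
  have hface : ∀ i < n, ∃ f ∈ K.faces, u.val ∈ cell f ∧ (pt a b (c i)).val ∈ cell f ∧
      (pt a b (c (i + 1))).val ∈ cell f := by
    intro i hi
    obtain ⟨-, f, hf, h1, h2⟩ := hc i hi
    exact ⟨f, by simpa using hf, hcell _ f h1, h1, h2⟩
  have hdist : ∀ i < n, dist (pt a b (c i)) (pt a b (c (i + 1))) = (c (i + 1) - c i) * dist a b := by
    intro i hi
    rw [dist_pt_param (hI i hi.le) (hI (i + 1) hi), abs_sub_comm,
      abs_of_nonneg (by linarith [(hc i hi).1])]
  have hlt : dist a b < dist u a + dist u b := by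
    refine lt_of_le_of_ne (by rw [dist_comm u a]; exact dist_triangle a u b) fun h => hu ?_
    rw [mem_seg, dist_comm a u, h]
  have hsum := sum_cellAngle_lt_pi n (fun i => pt a b (c i)) hne hface (by
    rw [Finset.sum_congr rfl fun i hi => hdist i (Finset.mem_range.1 hi), ← Finset.sum_mul,
      Finset.sum_range_sub c, h0, hn, pt_zero, pt_one]
    linarith)
  refine ⟨_, hsum, n, fun i => (pt a b (c i)).val, ?_, ?_, ?_, ?_, rfl⟩
  · dsimp only; rw [h0, pt_zero]
  · dsimp only; rw [hn, pt_one]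
  · exact fun i hi h => hne i hi (Pt.ext h)
  · intro i hi
    have hin : ∀ j, pt a b (c j) ∈ C := fun j => hC a haC b hbC (pt_mem_seg _ _ _)
    refine ⟨hface i hi, ?_, ?_⟩
    · obtain ⟨f, hf, h1, h2, h3⟩ := hface i hi
      exact convexHull_subset_image hC hf h1 h2 h3 huC (hin _) (hin _)
    · refine lt_of_le_of_lt ?_ hsum
      exact Finset.single_le_sum (f := fun i => K.cellAngle u.val (pt a b (c i)).val
        (pt a b (c (i + 1))).val) (fun j _ => cellAngle_nonneg _ _ _) (Finset.mem_range.2 hi)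

/-- At an inner point of a geodesic, every fan from one direction to the other has a total angle of
at least `π`. -/
theorem pi_le_innerAngle {u a b : K.Pt hK} (hu : u ∈ seg a b) (S : Set (V → ℝ)) :
    ENNReal.ofReal Real.pi ≤ K.innerAngle S u.val a.val b.val := by
  refine le_iInf fun n => le_iInf fun w => le_iInf fun ⟨h0, hn, hne, hw⟩ =>
    ENNReal.ofReal_le_ofReal ?_
  set θ : ℕ → ℝ := fun k => ∑ i ∈ Finset.range k, K.cellAngle u.val (w i) (w (i + 1)) with hθ
  by_contra! hlt
  set Φ := θ n
  have hθ0 : θ 0 = 0 := by simp [hθ]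
  have hsucc : ∀ i, θ (i + 1) = θ i + K.cellAngle u.val (w i) (w (i + 1)) := fun i =>
    Finset.sum_range_succ _ _
  have hmono : Monotone θ := monotone_nat_of_le_succ fun i => by
    rw [hsucc]; linarith [cellAngle_nonneg (K := K) u.val (w i) (w (i + 1))]
  have hcosΦ : 0 < Real.cos (Φ / 2) := Real.cos_pos_of_mem_Ioo
    ⟨by linarith [hmono (Nat.zero_le n), Real.pi_pos], by linarith⟩
  have hcos : ∀ i ≤ n, Real.cos (Φ / 2) ≤ Real.cos (θ i - Φ / 2) := by
    intro i hi
    rw [← Real.cos_abs (θ i - Φ / 2)]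
    refine Real.cos_le_cos_of_nonneg_of_le_pi (abs_nonneg _) (by linarith [Real.pi_pos]) ?_
    rw [abs_le]
    constructor <;> linarith [hmono (Nat.zero_le i), hmono hi]
  -- the points of the fan
  have hspace : ∀ i ≤ n, ∃ y : K.Pt hK, y.val = w i := by
    intro i hi
    rcases hi.eq_or_lt with rfl | hi
    · rw [geod_eq] at hn
      obtain ⟨y, -, hy⟩ := hn
      exact ⟨y, hy⟩
    · obtain ⟨⟨f, hf, -, h, -⟩, -⟩ := hw i hi
      exact ⟨hK.mk _ (mem_space hf h), rfl⟩
  have : Nonempty (K.Pt hK) := ⟨u⟩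
  choose! g hg using hspace
  have hgne : ∀ i ≤ n, g i ≠ u := fun i hi h => hne i hi (by rw [← hg i hi, h])
  -- With `ε` the least distance of a fan point from `u`, all points used below lie on the rays
  -- before the fan points.
  obtain ⟨k, hk, hmin⟩ := Finset.exists_min_image (Finset.range (n + 1)) (fun i => dist u (g i))
    ⟨0, by simp⟩
  have hk' : k ≤ n := Nat.lt_succ_iff.1 (Finset.mem_range.1 hk)
  set ε := dist u (g k)
  have hε : 0 < ε := dist_pos.2 (hgne k hk').symm
  have hεle : ∀ i ≤ n, ε ≤ dist u (g i) := fun i hi => hmin i (Finset.mem_range.2 (by omega))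
  have hr : ∀ i ≤ n, 0 < dist u (g i) := fun i hi => hε.trans_le (hεle i hi)
  -- Lay the fan of total angle `Φ < π` out in the plane. The points `q i` are where its rays meet
  -- the chord joining the points at distance `ε` on the two outer rays. The polygon through them
  -- has length at most `2 * ε * sin (Φ / 2) < 2 * ε`, although its ends are at distance `2 * ε` on
  -- the geodesic through `u`.
  set t : ℕ → ℝ := fun i => ε * Real.cos (Φ / 2) / (Real.cos (θ i - Φ / 2) * dist u (g i))
  have htr : ∀ i ≤ n, t i * dist u (g i) = ε * Real.cos (Φ / 2) / Real.cos (θ i - Φ / 2) := by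
    intro i hi
    have h1 := hr i hi
    have h2 := hcosΦ.trans_le (hcos i hi)
    simp only [t]; field_simp
  have ht : ∀ i ≤ n, t i ∈ Icc (0 : ℝ) 1 := by
    intro i hi
    have h1 := hr i hi
    have h2 := hcosΦ.trans_le (hcos i hi)
    refine ⟨by positivity, (div_le_one (by positivity)).2 ?_⟩
    rw [mul_comm ε]
    exact mul_le_mul (hcos i hi) (hεle i hi) hε.le h2.le
  set q : ℕ → K.Pt hK := fun i => pt u (g i) (t i)
  have hstep : ∀ i < n, dist (q i) (q (i + 1)) ≤ ε * Real.cos (Φ / 2) *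
      (Real.tan (θ (i + 1) - Φ / 2) - Real.tan (θ i - Φ / 2)) := by
    intro i hi
    obtain ⟨⟨f, hf, hf1, hf2, hf3⟩, -, -⟩ := hw i hi
    rw [← hg i hi.le] at hf2
    rw [← hg (i + 1) hi] at hf3
    have e1 := pt_val hf hf1 hf2 (ht i hi.le)
    have e2 := pt_val hf hf1 hf3 (ht (i + 1) hi)
    have hd := dist_sq_of_angle hf hf1 hf2 hf3
      (seg_subset_cell hf hf1 hf2 (pt_mem_seg u (g i) (t i)))
      (seg_subset_cell hf hf1 hf3 (pt_mem_seg u (g (i + 1)) (t (i + 1))))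
      (hgne i hi.le) (hgne (i + 1) hi) e1 e2
    rw [htr i hi.le, htr (i + 1) hi, hg i hi.le, hg (i + 1) hi] at hd
    have hα : K.cellAngle u.val (w i) (w (i + 1)) = (θ (i + 1) - Φ / 2) - (θ i - Φ / 2) := by
      rw [hsucc]; ring
    have hsin : 0 ≤ Real.sin ((θ (i + 1) - Φ / 2) - (θ i - Φ / 2)) := by
      rw [← hα]; exact Real.sin_nonneg_of_nonneg_of_le_pi (cellAngle_nonneg _ _ _) (cellAngle_le_pi _ _ _)
    rw [hα, Real.cos_sub (θ (i + 1) - Φ / 2) (θ i - Φ / 2)] at hd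
    have hX := hcosΦ.trans_le (hcos i hi.le)
    have hY := hcosΦ.trans_le (hcos (i + 1) hi)
    have htan : Real.tan (θ (i + 1) - Φ / 2) - Real.tan (θ i - Φ / 2) =
        Real.sin ((θ (i + 1) - Φ / 2) - (θ i - Φ / 2)) /
          (Real.cos (θ i - Φ / 2) * Real.cos (θ (i + 1) - Φ / 2)) := by
      rw [Real.tan_eq_sin_div_cos, Real.tan_eq_sin_div_cos,
        Real.sin_sub (θ (i + 1) - Φ / 2) (θ i - Φ / 2), div_sub_div _ _ hY.ne' hX.ne',
        mul_comm (Real.cos (θ i - Φ / 2))]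
    refine le_of_sq_le_sq (le_of_eq ?_) (mul_nonneg (by positivity) (htan ▸ by positivity))
    rw [show dist (q i) (q (i + 1)) ^ 2 = _ from hd, Real.tan_eq_sin_div_cos, Real.tan_eq_sin_div_cos]
    have s1 := Real.sin_sq_add_cos_sq (θ i - Φ / 2)
    have s2 := Real.sin_sq_add_cos_sq (θ (i + 1) - Φ / 2)
    generalize Real.sin (θ i - Φ / 2) = S₁ at *
    generalize Real.sin (θ (i + 1) - Φ / 2) = S₂ at *
    generalize Real.cos (θ i - Φ / 2) = X at *
    generalize Real.cos (θ (i + 1) - Φ / 2) = Y at *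
    field_simp
    linear_combination (-Y ^ 2) * s1 - X ^ 2 * s2
  have hpath := (dist_le_range_sum_dist q n).trans
    (Finset.sum_le_sum fun i hi => hstep i (Finset.mem_range.1 hi))
  rw [← Finset.mul_sum, Finset.sum_range_sub (fun i => Real.tan (θ i - Φ / 2)), hθ0,
    show θ n - Φ / 2 = Φ / 2 by ring, zero_sub, Real.tan_neg, Real.tan_eq_sin_div_cos] at hpath
  have hq : ∀ i ≤ n, |θ i - Φ / 2| = Φ / 2 → dist u (q i) = ε := by
    intro i hi h
    rw [dist_left_pt (ht i hi), htr i hi, ← Real.cos_abs (θ i - Φ / 2), h]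
    field_simp
  have hΦ0 : 0 ≤ Φ := hθ0 ▸ hmono (Nat.zero_le n)
  have hq0 := hq 0 (Nat.zero_le n) (by
    rw [hθ0, zero_sub, abs_neg, abs_of_nonneg (by linarith)])
  have hqn := hq n le_rfl (by
    rw [show θ n - Φ / 2 = Φ / 2 by ring, abs_of_nonneg (by linarith)])
  have m0 : q 0 ∈ seg u a := mem_of_mem_left (mem_geod.1 (by rw [hg 0 (Nat.zero_le n)]; exact h0))
    (pt_mem_seg _ _ _)
  have mn : q n ∈ seg u b := mem_of_mem_left (mem_geod.1 (by rw [hg n le_rfl]; exact hn))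
    (pt_mem_seg _ _ _)
  have hmem : u ∈ seg (q 0) (q n) := mem_mid' (mem_mid hu (mem_comm.1 m0)) mn
  rw [mem_seg, dist_comm (q 0) u, hq0, hqn] at hmem
  have hsin : Real.sin (Φ / 2) < 1 := by
    rw [← Real.sin_pi_div_two]
    exact Real.sin_lt_sin_of_lt_of_le_pi_div_two (by linarith [Real.pi_pos]) le_rfl (by linarith)
  have : ε * Real.cos (Φ / 2) * (Real.sin (Φ / 2) / Real.cos (Φ / 2) -
      -(Real.sin (Φ / 2) / Real.cos (Φ / 2))) = 2 * ε * Real.sin (Φ / 2) := by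
    field_simp; ring
  rw [this, ← hmem] at hpath
  nlinarith

end TriComplex

namespace TriComplex
open CatZero

variable {V : Type*} [Fintype V] [DecidableEq V] {K : TriComplex V} {hK : K.IsCAT0}

/-! ### Vertices -/

lemma vertexPoint_mem_cell {v : V} {f : Finset V} (h : v ∈ f) : vertexPoint v ∈ cell f := by
  refine ⟨fun w => ?_, by simp [vertexPoint], fun w hw => ?_⟩
  · unfold vertexPoint
    rcases eq_or_ne w v with rfl | hne <;> simp [*]
  · have : w ≠ v := fun e => hw (e ▸ h)
    simp [vertexPoint, this]

lemma vertexPoint_injective : Function.Injective (vertexPoint : V → V → ℝ) := by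
  intro v w h
  by_contra hne
  have := congrFun h v
  simp [vertexPoint, hne] at this

/-- The point given by a vertex. -/
def vert (hK : K.IsCAT0) (v : V) : K.Pt hK :=
  hK.mk (vertexPoint v) (mem_space (K.vertex_mem v) (vertexPoint_mem_cell (by simp)))

@[simp] lemma vert_val (v : V) : (vert hK v).val = vertexPoint v := rfl

lemma isVertex_vert (v : V) : (vert hK v).IsVertex := ⟨v, rfl⟩

lemma finite_isVertex : Set.Finite {w : K.Pt hK | w.IsVertex} := by
  refine Set.Finite.of_finite_image (f := Pt.val) ?_ Pt.val_injective.injOn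
  refine (Set.finite_range (vertexPoint : V → V → ℝ)).subset ?_
  rintro _ ⟨w, ⟨v, hv⟩, rfl⟩
  exact ⟨v, hv.symm⟩

lemma mem_seg_vert {a b : V} (h : {a, b} ∈ K.faces) {y : K.Pt hK} (hy : y.val ∈ cell {a, b}) :
    y ∈ seg (vert hK a) (vert hK b) := by
  rw [mem_seg_iff_segment h (vertexPoint_mem_cell (by simp)) (vertexPoint_mem_cell (by simp))]
  rcases eq_or_ne a b with rfl | hab
  · have : y.val = vertexPoint a := Pt.isVertex_of_supp_subset (by
      simpa using Pt.mem_cell_iff.1 hy)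
    simp [this]
  · have hsum : y.val a + y.val b = 1 := by
      rw [← hy.2.1, ← Finset.sum_subset (Finset.subset_univ {a, b}) fun v _ hv => hy.2.2 v hv,
        Finset.sum_pair hab]
    refine ⟨y.val a, y.val b, y.nonneg a, y.nonneg b, hsum, ?_⟩
    ext v
    simp only [vert_val, vertexPoint, Pi.add_apply, Pi.smul_apply, smul_eq_mul, Pi.single_apply]
    by_cases hva : v = a
    · subst hva; simp [hab]
    · by_cases hvb : v = b
      · subst hvb; simp [hva]
      · simp [hva, hvb, hy.2.2 v (by simp [hva, hvb])]

/-- A cell whose vertices lie on a geodesic lies on the geodesic. -/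
lemma cell_subset_seg {f : Finset V} (hf : f ∈ K.faces) {x z : K.Pt hK}
    (h : ∀ v ∈ f, vert hK v ∈ seg x z) {y : K.Pt hK} (hy : y.val ∈ cell f) : y ∈ seg x z := by
  obtain ⟨a, ha, hmin⟩ := f.exists_min_image (fun v => dist x (vert hK v)) (K.nonempty_of_mem f hf)
  obtain ⟨b, hb, hmax⟩ := f.exists_max_image (fun v => dist x (vert hK v)) (K.nonempty_of_mem f hf)
  -- Every vertex of the cell lies between the extreme ones `a` and `b`, but a vertex is never an
  -- inner point of a segment in a cell.
  have hsub : f ⊆ {a, b} := by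
    intro v hv
    have h1 := mem_of_dist_le (h b hb) (h v hv) (hmax v hv)
    have h2 := mem_of_dist_le (h v hv) (h a ha) (hmin v hv)
    have h3 := mem_mid h1 h2
    rcases IsVertex.eq_or_eq (a := vert hK a) (b := vert hK b) hf (isVertex_vert v) (vertexPoint_mem_cell ha)
      (vertexPoint_mem_cell hb) h3 with e | e
    · have := vertexPoint_injective (congrArg Pt.val e); simp [this]
    · have := vertexPoint_injective (congrArg Pt.val e); simp [this]
  have heq : f = {a, b} := hsub.antisymm (by
    intro v hv; simp only [Finset.mem_insert, Finset.mem_singleton] at hv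
    rcases hv with rfl | rfl <;> assumption)
  subst heq
  exact seg_subset (h a (by simp)) (h b (by simp)) (mem_seg_vert hf hy)

/-! ### Families of cones -/

variable (K hK) in
/-- The data and the elementary properties of the cones of a shortest path map. The sides of the
cone `i` lead from the apex `z i` to the points `e i true` and `e i false`, and `R i` is its
interior. -/
structure ConeMap (x : K.Pt hK) (ι : Type*) where
  z : ι → K.Pt hK
  e : ι → Bool → K.Pt hK
  R : ι → Set (K.Pt hK)
  isOpen : ∀ i, IsOpen (R i)
  isPreconnected : ∀ i, IsPreconnected (R i)
  nonempty : ∀ i, (R i).Nonempty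
  notMem : ∀ i s, ∀ y ∈ R i, y ∉ seg (z i) (e i s)
  closure_subset : ∀ i, closure (R i) ⊆ R i ∪ (seg (z i) (e i true) ∪ seg (z i) (e i false))
  subset_closure : ∀ i s, seg (z i) (e i s) ⊆ closure (R i)
  maximal : ∀ i, ∀ T : Set (K.Pt hK), IsPreconnected T → (∀ y ∈ T, ∀ s, y ∉ seg (z i) (e i s)) →
    (T ∩ R i).Nonempty → T ⊆ R i
  inter_sides : ∀ i s, seg (z i) (e i s) ∩ seg (z i) (e i !s) = {z i}
  ne : ∀ i s, e i s ≠ z i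
  disjoint : ∀ i j, i ≠ j → Disjoint (R i) (R j)
  cover : ∀ y, ∃ i, y ∈ R i ∨ ∃ s, y ∈ seg (z i) (e i s)
  vertex : ∀ y : K.Pt hK, y.IsVertex → ∃ i s, y ∈ seg x (e i s)
  apex : ∀ i s, z i ∈ seg x (e i s)

namespace ConeMap

variable {x : K.Pt hK} {ι : Type*} (M : ConeMap K hK x ι)

/-- The points on the sides of the cones. -/
def Side (y : K.Pt hK) : Prop := ∃ i s, y ∈ seg (M.z i) (M.e i s)

/-- The points on the geodesics of the map. -/
def Tree (y : K.Pt hK) : Prop := ∃ i s, y ∈ seg x (M.e i s)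

/-- The point set of a cone. -/
def C (i : ι) : Set (K.Pt hK) := M.R i ∪ (seg (M.z i) (M.e i true) ∪ seg (M.z i) (M.e i false))

variable {M} {i j : ι} {s : Bool} {y w t p q : K.Pt hK}

lemma mem_C : y ∈ M.C i ↔ y ∈ M.R i ∨ ∃ s, y ∈ seg (M.z i) (M.e i s) := by
  simp [C, or_comm]

lemma side_subset_C (i : ι) (s : Bool) : seg (M.z i) (M.e i s) ⊆ M.C i :=
  fun _ hy => mem_C.2 (Or.inr ⟨s, hy⟩)

lemma isClosed_C (i : ι) : IsClosed (M.C i) := by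
  have : M.C i = closure (M.R i) ∪ (seg (M.z i) (M.e i true) ∪ seg (M.z i) (M.e i false)) := by
    apply subset_antisymm
    · exact union_subset_union_left _ _root_.subset_closure
    · exact union_subset (M.closure_subset i) subset_union_right
  rw [this]
  exact isClosed_closure.union ((isClosed_seg _ _).union (isClosed_seg _ _))

lemma Side.tree (h : M.Side y) : M.Tree y := by
  obtain ⟨i, s, h⟩ := h
  exact ⟨i, s, mem_of_mem_right (M.apex i s) h⟩

lemma Tree.mono (h : M.Tree y) (hw : w ∈ seg x y) : M.Tree w := by
  obtain ⟨i, s, h⟩ := h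
  exact ⟨i, s, mem_of_mem_left h hw⟩

lemma eq_apex (h : y ∈ seg (M.z i) (M.e i s)) (h' : y ∈ seg (M.z i) (M.e i !s)) : y = M.z i := by
  have : y ∈ seg (M.z i) (M.e i s) ∩ seg (M.z i) (M.e i !s) := ⟨h, h'⟩
  rwa [M.inter_sides] at this

/-- A side of another cone is in the closure of that cone's interior, and an open set disjoint from
a set is disjoint from its closure. -/
lemma not_side_of_mem (hy : y ∈ M.R i) : ¬ M.Side y := by
  rintro ⟨j, s, h⟩
  by_cases hij : i = j
  · subst hij; exact M.notMem i s y hy h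
  · obtain ⟨w, hw1, hw2⟩ := mem_closure_iff.1 (M.subset_closure j s h) (M.R i) (M.isOpen i) hy
    exact disjoint_left.1 (M.disjoint i j hij) hw1 hw2

lemma exists_mem_of_not_side (hy : ¬ M.Side y) : ∃ i, y ∈ M.R i := by
  obtain ⟨i, h | ⟨s, h⟩⟩ := M.cover y
  · exact ⟨i, h⟩
  · exact absurd ⟨i, s, h⟩ hy

lemma subset_of_not_side {T : Set (K.Pt hK)} (hT : IsPreconnected T) (h : ∀ y ∈ T, ¬ M.Side y)
    (hy : y ∈ T) (hyR : y ∈ M.R i) : T ⊆ M.R i :=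
  M.maximal i T hT (fun w hw s hws => h w hw ⟨i, s, hws⟩) ⟨y, hy, hyR⟩

lemma eq_of_mem (hi : y ∈ M.R i) (hj : y ∈ M.R j) : i = j := by
  by_contra hij
  exact disjoint_left.1 (M.disjoint i j hij) hi hj

/-- The first point outside the interior of a cone lies on a side. -/
lemma exists_exit_side (hy : y ∈ M.R i) (hp : p ∉ M.R i) :
    ∃ s, ∃ w ∈ seg y p, w ≠ y ∧ w ∈ seg (M.z i) (M.e i s) ∧ ∀ v ∈ seg y w, v ≠ w → v ∈ M.R i := by
  obtain ⟨w, hw, hwR, hv⟩ := exists_exit (a := y) (M.isOpen i) hp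
  have hwy : w ≠ y := fun h => hwR (h ▸ hy)
  have hcl : w ∈ closure (M.R i) := by
    rw [Metric.mem_closure_iff]
    intro ε hε
    obtain ⟨v, h1, h2, h3⟩ := exists_near hwy hε
    exact ⟨v, hv v (mem_comm.1 h1) h2, h3⟩
  obtain ⟨s, hs⟩ := (mem_C.1 (M.closure_subset i hcl)).resolve_left hwR
  exact ⟨s, w, hw, hwy, hs, hv⟩

lemma apex_mem_of_side (h : y ∈ seg (M.z i) (M.e i s)) : M.z i ∈ seg x y :=
  mem_mid' (M.apex i s) h

/-! ### The geodesics of the map consist of sides -/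

/-- The geodesic leaves the interior at a point `w` of a side, and the geodesic from `x` to `w`
contains the apex. An apex before `y` would put `y` on the side. An apex strictly between `y` and
`w` would lie in the interior. So the apex is `w`. -/
lemma apex_of_tree_mem (hy : y ∈ M.R i) {k : ι} {r : Bool} (hyp : y ∈ seg x (M.e k r)) :
    y ∈ seg x (M.z i) ∧ M.z i ∈ seg x (M.e k r) ∧ ∀ v ∈ seg y (M.z i), v ≠ M.z i → v ∈ M.R i := by
  obtain ⟨s, w, hw, hwy, hws, hv⟩ := exists_exit_side (M := M) (p := M.e k r) hy
    fun h => not_side_of_mem h ⟨k, r, right_mem _ _⟩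
  have hyw : y ∈ seg x w := mem_mid' hyp hw
  have hzw := apex_mem_of_side hws
  rcases mem_split hyw hzw with h | h
  · exact absurd (mem_of_mem_left hws (mem_mid hyw h)) (M.notMem i s y hy)
  · have hz : M.z i = w := by
      by_contra hne
      exact M.notMem i s _ (hv _ h hne) (left_mem _ _)
    rw [hz]
    exact ⟨hyw, mem_of_mem_right hyp hw, hv⟩

lemma not_mem_seg_apex (hy : y ∈ M.R i) (h : y ∈ seg x (M.z i)) : M.z i ∉ seg x y := fun h' => by
  have := seg_antisymm h h'
  exact M.notMem i true y hy (this ▸ left_mem _ _)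

/-- An interior that meets a geodesic of the map contains the origin. -/
lemma root_mem (hy : y ∈ M.R i) (ht : M.Tree y) : x ∈ M.R i := by
  obtain ⟨k, r, hyp⟩ := ht
  by_contra hx
  -- Going back to `x` one also leaves through a side, and that would put the apex before `y`,
  -- whereas it comes after `y`.
  obtain ⟨s, w, hw, -, hws, -⟩ := exists_exit_side (M := M) hy hx
  exact not_mem_seg_apex hy (apex_of_tree_mem hy hyp).1
    (mem_of_mem_left (mem_comm.1 hw) (apex_mem_of_side hws))

/-- If the origin is interior to the cone, all geodesics of the map pass through its apex, and the
apex is a vertex because the sides branch there. Every vertex of the complex is then on the segment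
from `x` to the apex or beyond it, so the complex is one-dimensional along this segment. The
interior is contained in the segment, and its closure cannot contain the ends of the cone. -/
lemma not_root_mem (hT : K.AtMostTwo) (hx : x ∈ M.R i) : False := by
  have key := fun k r => apex_of_tree_mem (M := M) hx (left_mem x (M.e k r))
  have hxz : x ≠ M.z i := fun h => M.notMem i true x hx (h ▸ left_mem _ _)
  have hz : (M.z i).IsVertex := by
    by_contra hz
    obtain ⟨w, hw, h1, h2⟩ := exists_common hT hz (M.apex i true) (M.apex i false) hxz
      (M.ne i true) (M.ne i false)
    exact hw (eq_apex h1 h2)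
  have hvert : ∀ v, vert hK v ∈ seg x (M.z i) ∨ M.z i ∈ seg x (vert hK v) := by
    intro v
    obtain ⟨k, r, hv⟩ := M.vertex _ (isVertex_vert v)
    exact mem_total (key k r).2.1 hv
  set T := seg x (M.z i) \ {M.z i} with hTdef
  have hTR : T ⊆ M.R i := fun v hv => (key i true).2.2 v hv.1 hv.2
  -- Near a point `r` of `T` a cell contains `r`. A vertex of it beyond the apex would make the apex
  -- an inner point of a segment in a cell. So all its vertices are on the segment.
  have hTo : IsOpen T := by
    rw [Metric.isOpen_iff]
    rintro r ⟨hr, hrz⟩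
    obtain ⟨ε, hε, hstar⟩ := r.exists_star
    have hd : 0 < dist r (M.z i) := dist_pos.2 hrz
    refine ⟨min ε (dist r (M.z i)), lt_min hε hd, fun y hy => ?_⟩
    rw [Metric.mem_ball, dist_comm] at hy
    refine ⟨?_, ?_⟩
    · have hrf : r.val ∈ cell (supp y.val) :=
        Pt.mem_cell_iff.2 (hstar y (hy.trans_le (min_le_left _ _)))
      refine cell_subset_seg y.supp_mem (fun v hv => ?_) y.mem_cell_supp
      rcases hvert v with h | h
      · exact h
      · rcases IsVertex.eq_or_eq (b := vert hK v) y.supp_mem hz hrf (vertexPoint_mem_cell hv)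
          (mem_mid h (mem_of_mem_left hr (right_mem _ _))) with e | e
        · exact absurd e.symm hrz
        · rw [← e]; exact right_mem _ _
    · rintro rfl
      exact absurd (hy.trans_le (min_le_right _ _)) (lt_irrefl _)
  have hRT : M.R i ⊆ T := by
    refine (M.isPreconnected i).subset_left_of_subset_union hTo
      (isClosed_seg x (M.z i)).isOpen_compl
      (disjoint_left.2 fun v hv hv' => hv' hv.1) (fun v hv => ?_) ⟨x, hx, left_mem _ _, hxz⟩
    by_cases h : v ∈ seg x (M.z i)
    · exact Or.inl ⟨h, fun e => M.notMem i true v hv (e ▸ left_mem _ _)⟩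
    · exact Or.inr h
  have hcl : closure (M.R i) ⊆ seg x (M.z i) :=
    closure_minimal (hRT.trans sdiff_subset) (isClosed_seg _ _)
  exact M.ne i true (seg_antisymm (hcl (M.subset_closure i true (right_mem _ _))) (M.apex i true))

/-- Off the sides a point is interior to a cone, and this cone would contain the origin in its
interior. -/
theorem side_of_tree (hT : K.AtMostTwo) (h : M.Tree y) : M.Side y := by
  by_contra hs
  obtain ⟨i, hi⟩ := exists_mem_of_not_side hs
  exact not_root_mem hT (root_mem hi h)

lemma Side.mono (hT : K.AtMostTwo) (h : M.Side y) (hw : w ∈ seg x y) : M.Side w :=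
  side_of_tree hT (h.tree.mono hw)

/-- The interior of a cone contains no vertex. -/
theorem not_isVertex (hT : K.AtMostTwo) (hy : y ∈ M.R i) : ¬ y.IsVertex :=
  fun h => not_side_of_mem hy (side_of_tree hT (M.vertex y h))

/-! ### The base of a cone -/

/-- Every point of the interior lies between the origin and a point of a free edge. -/
lemma exists_freeEdge (hT : K.AtMostTwo) (hy : y ∈ M.R i) :
    ∃ t ∈ M.R i, t.OnFreeEdge ∧ y ∈ seg x t := by
  -- The farthest point from `x` whose geodesic passes through `y`. The way from `y` to it meets no
  -- side, since everything before a point of a side is on sides. So it remains in the interior, and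
  -- it is on a free edge because the geodesic cannot be prolonged.
  obtain ⟨t, hyt, hmax⟩ := (isClosed_eq (by fun_prop) (by fun_prop) :
    IsClosed {t | dist x y + dist y t = dist x t}).isCompact.exists_isMaxOn ⟨y, right_mem x y⟩
    (f := fun t => dist x t) (by fun_prop)
  have hyt : y ∈ seg x t := hyt
  have hns : ∀ w ∈ seg y t, ¬ M.Side w := fun w hw h =>
    not_side_of_mem hy (h.mono hT (mem_mid' hyt hw))
  have htR : t ∈ M.R i := subset_of_not_side (isPreconnected_seg y t) hns (left_mem _ _) hy
    (right_mem _ _)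
  refine ⟨t, htR, ?_, hyt⟩
  by_contra hfree
  have hxt : x ≠ t := by rintro rfl; exact not_root_mem hT htR
  obtain ⟨u, hu, htu⟩ := exists_extension (not_isVertex hT htR) hfree hxt
  have hyu : y ∈ seg x u := mem_of_mem_left htu hyt
  have h1 : dist x u ≤ dist x t := hmax hyu
  exact hu (dist_eq_zero.1 (by
    rw [mem_seg] at htu; linarith [dist_nonneg (x := t) (y := u), dist_comm t u]))

variable (M) in
/-- A segment of the free edge `a b` that crosses the cone `i` from side to side through `t`. -/
structure Chord (i : ι) (s : Bool) (a b c : V) (t p q : K.Pt hK) : Prop where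
  free : K.FreeEdge a b c
  supp_eq : supp t.val = {a, b}
  mem : t ∈ M.R i
  left : p.val ∈ cell {a, b}
  right : q.val ∈ cell {a, b}
  between : t ∈ seg p q
  left_side : p ∈ seg (M.z i) (M.e i s)
  right_side : q ∈ seg (M.z i) (M.e i !s)
  inner : ∀ w ∈ seg p q, w ≠ p → w ≠ q → w ∈ M.R i

lemma Chord.symm {a b c : V} (h : M.Chord i s a b c t p q) : M.Chord i (!s) a b c t q p where
  free := h.free
  supp_eq := h.supp_eq
  mem := h.mem
  left := h.right
  right := h.left
  between := mem_comm.1 h.between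
  left_side := h.right_side
  right_side := by simpa using h.left_side
  inner := fun w hw h1 h2 => h.inner w (mem_comm.1 hw) h2 h1

/-- Follow the edge from `t` in both directions until it leaves the interior, which happens since
the interior contains no vertex. The two exits are on different sides, because a side is convex and
does not contain `t`. -/
lemma exists_chord (hT : K.AtMostTwo) (ht : t ∈ M.R i) (hf : t.OnFreeEdge) (s : Bool) :
    ∃ a b c p q, M.Chord i s a b c t p q := by
  obtain ⟨a, b, c, hfree, hs⟩ := hf
  have hfab : {a, b} ∈ K.faces := hs ▸ t.supp_mem
  have htab : t.val ∈ cell {a, b} := Pt.mem_cell_iff.2 hs.subset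
  have hva : (vert hK a).val ∈ cell {a, b} := vertexPoint_mem_cell (by simp)
  have hvb : (vert hK b).val ∈ cell {a, b} := vertexPoint_mem_cell (by simp)
  have hm := mem_seg_vert hfab htab
  obtain ⟨r, p, hp, hpt, hps, hpi⟩ := exists_exit_side (M := M) ht (p := vert hK a)
    fun h => not_isVertex hT h (isVertex_vert a)
  obtain ⟨r', q, hq, hqt, hqs, hqi⟩ := exists_exit_side (M := M) ht (p := vert hK b)
    fun h => not_isVertex hT h (isVertex_vert b)
  have hpq : t ∈ seg p q := mem_mid' (mem_comm.1 (mem_mid' (mem_comm.1 hm) hp)) hq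
  have hr : r' = !r := by
    by_contra hne
    have : r' = r := by cases r <;> cases r' <;> simp_all
    subst this
    exact M.notMem i _ t ht (seg_subset hps hqs hpq)
  subst hr
  have h : M.Chord i r a b c t p q := ⟨hfree, hs, ht, seg_subset_cell hfab htab hva hp,
    seg_subset_cell hfab htab hvb hq, hpq, hps, hqs, fun w hw h1 h2 => by
      rcases mem_split hpq hw with h | h
      · exact hpi w (mem_comm.1 h) h1
      · exact hqi w h h2⟩
  by_cases hrs : r = s
  · subst hrs; exact ⟨a, b, c, p, q, h⟩
  · have : s = !r := by cases r <;> cases s <;> simp_all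
    subst this; exact ⟨a, b, c, q, p, h.symm⟩

namespace Chord

variable {a b c a' b' c' : V} {t' p' q' : K.Pt hK}

lemma left_ne (h : M.Chord i s a b c t p q) : p ≠ M.z i := fun e =>
  M.notMem i (!s) t h.mem (seg_subset (e ▸ left_mem _ _) h.right_side h.between)

lemma right_ne (h : M.Chord i s a b c t p q) : q ≠ M.z i := h.symm.left_ne

lemma left_notMem (h : M.Chord i s a b c t p q) : p ∉ seg (M.z i) (M.e i !s) := fun h' =>
  h.left_ne (eq_apex h.left_side h')

lemma apex_notMem (h : M.Chord i s a b c t p q) : M.z i ∉ seg p q := fun h' =>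
  M.notMem i s _ (h.inner _ h' h.left_ne.symm h.right_ne.symm) (left_mem _ _)

lemma seg_subset_C (h : M.Chord i s a b c t p q) : seg p q ⊆ M.C i := fun w hw => by
  by_cases h1 : w = p
  · exact mem_C.2 (Or.inr ⟨s, h1 ▸ h.left_side⟩)
  by_cases h2 : w = q
  · exact mem_C.2 (Or.inr ⟨!s, h2 ▸ h.right_side⟩)
  exact mem_C.2 (Or.inl (h.inner w hw h1 h2))

/-- If the side runs on beyond the chord, it prolongs the chord. -/
lemma left_mem_seg (hT : K.AtMostTwo) (h : M.Chord i s a b c t p q) (hp : p ≠ M.e i s) :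
    p ∈ seg q (M.e i s) := by
  have hpt : p ≠ t := fun e => M.notMem i s t h.mem (e ▸ h.left_side)
  -- The side passes through the point `p` of the free edge. If its half towards the apex prolonged
  -- the chord, `p` would lie between `q` and the apex, hence on the opposite side.
  rcases mem_seg_of_freeEdge hT h.free h.supp_eq h.left hpt h.left_side h.left_ne.symm hp.symm
    with h' | h'
  · exact absurd (mem_of_mem_left h.right_side (mem_comm.1
      (ext' (mem_comm.1 h.between) h' hpt.symm))) h.left_notMem
  · exact ext' (mem_comm.1 h.between) h' hpt.symm

lemma left_mem_seg_of_mem (hT : K.AtMostTwo) (h : M.Chord i s a b c t p q)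
    (h' : M.Chord i s a' b' c' t' p' q') (hp : p ∈ seg (M.z i) p') (hne : p ≠ p') :
    p ∈ seg q p' := by
  have he : p ≠ M.e i s := fun e => hne (seg_antisymm hp (e ▸ h'.left_side))
  exact mem_mid' (h.left_mem_seg hT he) (mem_mid h'.left_side hp)

/-- If `p` came strictly before `p'`, the side would prolong the first chord to a geodesic from `q`
to `p'`. Comparing `q` with `q'` on the other side then puts `p` or `q` inside the second chord,
thus in the interior, or else `p` on the opposite side. -/
lemma left_eq_of_mem (hT : K.AtMostTwo) (h : M.Chord i s a b c t p q)
    (h' : M.Chord i s a' b' c' t' p' q') (hp : p ∈ seg (M.z i) p') : p = p' := by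
  by_contra hne
  have h1 := h.left_mem_seg_of_mem hT h' hp hne
  have notR : p ∉ M.R i := fun hR => M.notMem i s p hR h.left_side
  have notR' : q ∉ M.R i := fun hR => M.notMem i (!s) q hR h.right_side
  have npq : ∀ {u v : K.Pt hK}, u ∈ seg (M.z i) (M.e i s) → u ≠ M.z i →
      v ∈ seg (M.z i) (M.e i !s) → u ≠ v := fun h1 h2 h3 e => h2 (eq_apex h1 (e ▸ h3))
  by_cases hqq : q = q'
  · subst hqq
    exact notR (h'.inner p (mem_comm.1 h1) hne (npq h.left_side h.left_ne h.right_side))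
  rcases mem_total h.right_side h'.right_side with hq | hq
  · -- `q'` lies before `q`
    have h2 := h'.symm.left_mem_seg_of_mem hT h.symm hq (Ne.symm hqq)
    rcases mem_split (mem_comm.1 h2) h1 with h3 | h3
    · exact h.left_notMem (seg_subset h.right_side h'.right_side h3)
    · exact notR (h'.inner p (mem_comm.1 h3) hne (npq h.left_side h.left_ne h'.right_side))
  · have h2 := h.symm.left_mem_seg_of_mem hT h'.symm hq hqq
    have h3 : q ∈ seg q' p' := ext (mem_comm.1 h2) h1 (npq h.left_side h.left_ne h.right_side).symm
    exact notR' (h'.inner q (mem_comm.1 h3) (npq h'.left_side h'.left_ne h.right_side).symm hqq)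

lemma left_eq (hT : K.AtMostTwo) (h : M.Chord i s a b c t p q)
    (h' : M.Chord i s a' b' c' t' p' q') : p = p' :=
  (mem_total h'.left_side h.left_side).elim (h.left_eq_of_mem hT h')
    fun hp => (h'.left_eq_of_mem hT h hp).symm

/-- All chords have the same ends, so the interior lies in the compact union of the geodesics from
`x` to points of one chord. Its closure contains the end of the side. A side running beyond `p` is
incompatible with its end lying on such a geodesic. -/
lemma left_eq_end (hT : K.AtMostTwo) (h : M.Chord i s a b c t p q) : p = M.e i s := by
  by_contra hne
  have hcl : IsClosed {y | ∃ w ∈ seg p q, y ∈ seg x w} := by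
    have : {y | ∃ w ∈ seg p q, y ∈ seg x w} =
        (fun v : K.Pt hK × ℝ => pt x v.1 v.2) '' (seg p q ×ˢ Icc (0 : ℝ) 1) := by
      ext y
      simp only [mem_ofPred_eq, mem_image, Prod.exists, mem_prod, seg_eq_image x]
      exact ⟨fun ⟨w, hw, r, hr, e⟩ => ⟨w, r, ⟨hw, hr⟩, e⟩, fun ⟨w, r, ⟨hw, hr⟩, e⟩ => ⟨w, hw, r, hr, e⟩⟩
    rw [this]
    exact (((isCompact_seg p q).prod isCompact_Icc).image
      (continuous_pt.comp (by fun_prop : Continuous fun v : K.Pt hK × ℝ => (x, v.1, v.2)))).isClosed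
  have hsub : M.R i ⊆ {y | ∃ w ∈ seg p q, y ∈ seg x w} := by
    intro y hy
    obtain ⟨t', ht', hf, hyt⟩ := exists_freeEdge hT hy
    obtain ⟨a', b', c', p', q', h'⟩ := exists_chord hT ht' hf s
    rw [h.left_eq hT h', h.symm.left_eq hT h'.symm]
    exact ⟨t', h'.between, hyt⟩
  obtain ⟨w, hw, hew⟩ := closure_minimal hsub hcl (M.subset_closure i s (right_mem _ _))
  have hz := M.apex i s
  by_cases h1 : w = p
  · subst h1
    exact hne (seg_antisymm (mem_of_mem_right hz h.left_side) hew)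
  have hzw : M.z i ∈ seg x w := mem_of_mem_left hew hz
  have hezw : M.e i s ∈ seg (M.z i) w := mem_mid hew hz
  by_cases h2 : w = q
  · subst h2
    exact M.ne i s (eq_apex (right_mem _ _) (mem_of_mem_left h.right_side hezw))
  have hpw : p ∈ seg (M.z i) w := mem_of_mem_left hezw h.left_side
  exact h.left_notMem (mem_of_mem_left h.right_side
    (CatZero.ext hpw hw (Ne.symm h1)))

end Chord

variable (M) in
/-- The ends of a cone lie on a free edge, and the segment of the edge between them crosses the
cone. -/
theorem exists_base (hT : K.AtMostTwo) (i : ι) (s : Bool) :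
    ∃ a b c t, M.Chord i s a b c t (M.e i s) (M.e i !s) := by
  obtain ⟨y, hy⟩ := M.nonempty i
  obtain ⟨t, ht, hf, -⟩ := exists_freeEdge hT hy
  obtain ⟨a, b, c, p, q, h⟩ := exists_chord hT ht hf s
  have hp := h.left_eq_end hT
  have hq := h.symm.left_eq_end hT
  subst hp hq
  exact ⟨a, b, c, t, h⟩

/-- The point spans a chord, and every chord has the ends of the cone as its ends. -/
lemma mem_base (hT : K.AtMostTwo) (hy : y ∈ M.R i) (hf : y.OnFreeEdge) (s : Bool) :
    y ∈ seg (M.e i s) (M.e i !s) := by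
  obtain ⟨a, b, c, p, q, h⟩ := exists_chord hT hy hf s
  rw [← h.left_eq_end hT, ← h.symm.left_eq_end hT]
  exact h.between

/-- The cones are convex. -/
theorem convex_C (hT : K.AtMostTwo) (i : ι) : ∀ r ∈ M.C i, ∀ s ∈ M.C i, seg r s ⊆ M.C i := by
  obtain ⟨a, b, c, t, h⟩ := M.exists_base hT i true
  intro r hr s hs
  exact cone_convex (M.isOpen i) (M.closure_subset i) (M.inter_sides i true)
    (disjoint_left.2 fun y hy hy' => hy'.elim (M.notMem i true y hy) (M.notMem i false y hy))
    h.left_side h.right_side h.apex_notMem h.seg_subset_C hr hs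

/-! ### Inner angles -/

/-- The angle of a cone at its apex is less than `π`. -/
theorem innerAngle_lt_pi (hT : K.AtMostTwo) (i : ι) (s : Bool) :
    K.innerAngle (Pt.val '' M.C i) (M.z i).val (M.e i s).val (M.e i !s).val <
      ENNReal.ofReal Real.pi := by
  obtain ⟨a, b, c, t, h⟩ := M.exists_base hT i s
  obtain ⟨ε, hε, hfan⟩ := exists_fan (M.z i)
  obtain ⟨p, hp, hpz, hpd⟩ := exists_near (M.ne i s).symm hε
  obtain ⟨q, hq, hqz, hqd⟩ := exists_near (M.ne i !s).symm hε
  -- The apex is not between the chosen points, since prolonging along the sides would put it on the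
  -- base.
  obtain ⟨L, hL, hr⟩ := hfan (M.C i) (convex_C hT i) (side_subset_C i s (left_mem _ _))
    p (side_subset_C i s hp) q (side_subset_C i (!s) hq) hpd hqd fun hz => h.apex_notMem (by
      exact mem_comm.1 (CatZero.ext (mem_comm.1 (CatZero.ext hz hq hqz.symm)) hp hpz.symm))
  exact (hr.innerAngle_le (mem_geod.2 hp) (mem_geod.2 hq)).trans_lt
    ((ENNReal.ofReal_lt_ofReal_iff Real.pi_pos).2 hL)

lemma side_notMem_base (hT : K.AtMostTwo) (hy : y ∈ seg (M.z i) (M.e i s)) (hyz : y ≠ M.z i)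
    (hye : y ≠ M.e i s) : y ∉ seg (M.e i s) (M.e i !s) := by
  intro h'
  obtain ⟨a, b, c, t, h⟩ := M.exists_base hT i s
  refine M.notMem i s y (h.inner y h' hye fun e => hyz (eq_apex hy (e ▸ right_mem _ _))) hy

/-- The inner angle of a cone at an inner point of a side is finite. -/
theorem innerAngle_side_lt_top (hT : K.AtMostTwo) {u : K.Pt hK} (hu : u ∈ seg (M.z i) (M.e i s))
    (huz : u ≠ M.z i) (hue : u ≠ M.e i s) :
    K.innerAngle (Pt.val '' M.C i) u.val (M.z i).val (M.e i s).val < ⊤ := by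
  have h1 := side_notMem_base hT hu huz hue
  have h2 : u ∉ seg (M.z i) (M.e i !s) := fun h => huz (eq_apex hu h)
  have huq : u ≠ M.e i !s := fun e => h2 (e ▸ right_mem _ _)
  obtain ⟨ε, hε, hfan⟩ := exists_fan u
  obtain ⟨z', hz', hzu, hzd⟩ := exists_near huz hε
  obtain ⟨p', hp', hpu, hpd⟩ := exists_near hue hε
  obtain ⟨q', hq', hqu, hqd⟩ := exists_near huq hε
  have hC := convex_C (M := M) hT i
  have huC := side_subset_C i s hu
  have hzC := hC u huC _ (side_subset_C i s (left_mem _ _)) hz'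
  have hpC := hC u huC _ (side_subset_C i s (right_mem _ _)) hp'
  have hqC := hC u huC _ (side_subset_C i (!s) (right_mem _ _)) hq'
  have trans : ∀ {a b a' b' : K.Pt hK}, u ∉ seg a b → a' ∈ seg u a → b' ∈ seg u b → a' ≠ u →
      b' ≠ u → u ∉ seg a' b' := fun hn ha hb ha' hb' h =>
    hn (mem_comm.1 (CatZero.ext (mem_comm.1 (CatZero.ext h hb hb'.symm)) ha ha'.symm))
  -- The direct fan may have to exceed `π`, so it is composed of two, through the direction of the
  -- opposite end: `u` is neither on the opposite side nor on the base.
  obtain ⟨L, -, hL⟩ := hfan _ hC huC z' hzC q' hqC hzd hqd (trans h2 hz' hq' hzu hqu)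
  obtain ⟨L', -, hL'⟩ := hfan _ hC huC q' hqC p' hpC hqd hpd
    (trans (fun h => h1 (mem_comm.1 h)) hq' hp' hqu hpu)
  exact ((hL.trans hL').innerAngle_le (mem_geod.2 hz') (mem_geod.2 hp')).trans_lt
    ENNReal.ofReal_lt_top

/-! ### The tree -/

/-- A geodesic through an end that is not a vertex meets the base there, so the base is prolonged by
one of its halves. The half towards `x` would put the end on the opposite side. If it is the half
towards `q`, non-branching makes the base and the geodesic of the map share points inside the cone.
-/
lemma mem_seg_ends_absurd (hT : K.AtMostTwo) (hv : ¬ (M.e i s).IsVertex) (hxe : x ≠ M.e i s)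
    (hq : M.e i s ≠ q) (h : M.e i s ∈ seg x q) : False := by
  obtain ⟨a, b, c, t, hch⟩ := M.exists_base hT i s
  have hpt : M.e i s ≠ t := fun e => M.notMem i s t hch.mem (e ▸ right_mem _ _)
  rcases mem_seg_of_freeEdge hT hch.free hch.supp_eq hch.left hpt h hxe hq.symm with h' | h'
  · have h1 := ext' (mem_comm.1 hch.between) h' hpt.symm
    have h2 := mem_mid (mem_comm.1 h1) (M.apex i s)
    exact M.ne i s (eq_apex (right_mem _ _) h2)
  · obtain ⟨w, hw, hw1, hw2⟩ := exists_common hT hv (mem_comm.1 h') (mem_comm.1 h) hq.symm hpt.symm hxe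
    have hwt : w ∈ seg (M.e i s) (M.e i !s) := mem_of_mem_left hch.between hw1
    refine not_side_of_mem (hch.inner w hwt hw ?_)
      (side_of_tree hT ⟨i, s, mem_comm.1 hw2⟩)
    rintro rfl
    have := seg_antisymm hch.between hw1
    exact M.notMem i (!s) t hch.mem (this ▸ right_mem _ _)

/-- Different geodesics of the map branch at a vertex or at the origin. -/
theorem branch_isVertex (hT : K.AtMostTwo) {r : Bool} (hne : M.e i s ≠ M.e j r)
    (h : seg x (M.e i s) ∩ seg x (M.e j r) = seg x w) (hwx : w ≠ x) : w.IsVertex := by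
  by_contra hv
  have hw : w ∈ seg x (M.e i s) ∩ seg x (M.e j r) := h ▸ right_mem _ _
  by_cases h1 : w = M.e i s
  · subst h1
    exact mem_seg_ends_absurd hT hv hwx.symm hne hw.2
  by_cases h2 : w = M.e j r
  · subst h2
    exact mem_seg_ends_absurd hT hv hwx.symm hne.symm hw.1
  obtain ⟨v, hv, hv1, hv2⟩ := exists_common hT hv hw.1 hw.2 hwx.symm (Ne.symm h1) (Ne.symm h2)
  exact hv (branch_disjoint h hw hv1 hv2)

/-! ### Common sides -/

/-- Beyond an inner point of a side there is another cone. -/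
lemma exists_other_cone [Finite ι] (hT : K.AtMostTwo) {u : K.Pt hK}
    (hu : u ∈ seg (M.z i) (M.e i s)) (huz : u ≠ M.z i) (hue : u ≠ M.e i s) (hv : ¬ u.IsVertex)
    (hf : ¬ u.OnFreeEdge) : ∃ j, j ≠ i ∧ ∃ r, u ∈ seg (M.z j) (M.e j r) := by
  have h1 := side_notMem_base hT hu huz hue
  have h2 : u ∉ seg (M.z i) (M.e i !s) := fun h => huz (eq_apex hu h)
  set c := M.e i !s with hc
  have hcu : c ≠ u := fun e => h2 (e ▸ right_mem _ _)
  obtain ⟨u', hu', hcu'⟩ := exists_extension hv hf hcu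
  -- A geodesic from the opposite end `c` leaves the cone for good at `u`. Otherwise take the
  -- farthest point of the cone beyond `u`. In the interior it could be prolonged, unless it is on
  -- the base, and then so is `u`. On a side it would force `u` onto the base or onto the opposite
  -- side.
  have hout : ∀ v ∈ M.C i, u ∈ seg c v → v = u := by
    intro v₀ hv₀ huv₀
    by_contra hne₀
    obtain ⟨v, ⟨hvC, huv⟩, hmax⟩ := ((isClosed_C (M := M) i).inter
      (isClosed_eq (by fun_prop) (by fun_prop) :
        IsClosed {v | dist c u + dist u v = dist c v})).isCompact.exists_isMaxOn
      ⟨v₀, hv₀, huv₀⟩ (f := fun v => dist c v) (by fun_prop)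
    have huv : u ∈ seg c v := huv
    have hmax' : ∀ w ∈ M.C i, u ∈ seg c w → dist c w ≤ dist c v := fun w h h' => hmax ⟨h, h'⟩
    have hvu : v ≠ u := by
      rintro rfl
      have h3 := hmax' v₀ hv₀ huv₀
      rw [mem_seg] at huv₀
      exact hne₀ (dist_eq_zero.1 (by
        linarith [dist_nonneg (x := v) (y := v₀), dist_comm v v₀]))
    rcases mem_C.1 hvC with hvR | ⟨r, hr⟩
    · by_cases hvf : v.OnFreeEdge
      · have h3 := mem_base hT hvR hvf s
        exact h1 (mem_comm.1 (mem_of_mem_left (mem_comm.1 h3) huv))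
      · have hcv : c ≠ v := by
          rintro rfl; exact M.notMem i (!s) _ hvR (right_mem _ _)
        obtain ⟨v', hv', hcv'⟩ := exists_extension (not_isVertex hT hvR) hvf hcv
        obtain ⟨ε, hε, hb⟩ := Metric.isOpen_iff.1 (M.isOpen i) v hvR
        obtain ⟨v₁, hv₁, hv₁v, hd⟩ := exists_near hv'.symm hε
        have hv₁R : v₁ ∈ M.R i := hb (by rwa [Metric.mem_ball, dist_comm])
        have hcv₁ : v ∈ seg c v₁ := mem_mid' hcv' hv₁
        have h3 := hmax' v₁ (mem_C.2 (Or.inl hv₁R)) (mem_of_mem_left hcv₁ huv)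
        rw [mem_seg] at hcv₁
        exact hv₁v (dist_eq_zero.1 (by
          linarith [dist_nonneg (x := v) (y := v₁), dist_comm v v₁]))
    · by_cases hrs : r = s
      · subst hrs
        rcases mem_split hu hr with h | h
        · exact h2 (mem_comm.1 (CatZero.ext huv (mem_comm.1 h) hvu.symm))
        · exact h1 (mem_comm.1 (CatZero.ext huv h hvu.symm))
      · have : r = !s := by cases r <;> cases s <;> simp_all
        subst this
        exact h2 (seg_subset hr (right_mem _ _) (mem_comm.1 huv))
  have hcl : IsClosed (⋃ j ∈ {j | j ≠ i}, M.C j) :=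
    (Set.toFinite _).isClosed_biUnion fun j _ => isClosed_C j
  -- The points just beyond `u` are in the other cones, which are finitely many closed sets.
  have hmem : u ∈ ⋃ j ∈ {j | j ≠ i}, M.C j := by
    refine hcl.closure_subset (Metric.mem_closure_iff.2 fun ε hε => ?_)
    obtain ⟨v, hv, hvu, hd⟩ := exists_near hu'.symm hε
    obtain ⟨j, hj⟩ := M.cover v
    refine ⟨v, mem_biUnion (x := j) ?_ (mem_C.2 hj), hd⟩
    rintro rfl
    exact hvu (hout v (mem_C.2 hj) (mem_mid' hcu' hv))
  obtain ⟨j, hj, hju⟩ := mem_iUnion₂.1 hmem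
  exact ⟨j, hj, (mem_C.1 hju).resolve_left fun h => not_side_of_mem h ⟨i, s, hu⟩⟩

/-- A point of a side that is not close to a free edge lies on a common side of two cones. -/
theorem exists_common_side [Finite ι] (hT : K.AtMostTwo) (hy : M.Side y)
    (hf : ∃ ε > 0, ∀ y', dist y y' < ε → ¬ y'.OnFreeEdge) :
    ∃ i j, i ≠ j ∧ ∃ s r y', y' ≠ y ∧ y ∈ seg (M.z i) (M.e i s) ∧ y' ∈ seg (M.z i) (M.e i s) ∧
      y ∈ seg (M.z j) (M.e j r) ∧ y' ∈ seg (M.z j) (M.e j r) := by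
  obtain ⟨i, s, hy⟩ := hy
  obtain ⟨ε, hε, hf⟩ := hf
  -- The points of the side to which `exists_other_cone` applies. They accumulate at `y`; as there
  -- are finitely many sides, those on a single side of another cone already do, and this closed
  -- side contains `y` and one of them.
  set T : Set (K.Pt hK) := {u | u ∈ seg (M.z i) (M.e i s) ∧ u ≠ y ∧ u ≠ M.z i ∧ u ≠ M.e i s ∧
    ¬ u.IsVertex ∧ ¬ u.OnFreeEdge}
  have hyT : y ∈ closure T := by
    obtain ⟨d, hd, hyd⟩ : ∃ d ∈ seg (M.z i) (M.e i s), y ≠ d := by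
      by_cases h : y = M.z i
      · exact ⟨M.e i s, right_mem _ _, h ▸ (M.ne i s).symm⟩
      · exact ⟨M.z i, left_mem _ _, h⟩
    have hfin : Set.Finite (({w : K.Pt hK | w.IsVertex} ∪ {M.z i, M.e i s}) \ {y}) :=
      (finite_isVertex.union (by simp)).sdiff
    obtain ⟨δ, hδ, hb⟩ := Metric.isOpen_iff.1 hfin.isClosed.isOpen_compl y (by simp)
    refine Metric.mem_closure_iff.2 fun η hη => ?_
    obtain ⟨u, hu, huy, hud⟩ := exists_near hyd (lt_min hη (lt_min hδ hε))
    have h1 := hb (a := u) (by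
      rw [Metric.mem_ball, dist_comm]
      exact hud.trans_le ((min_le_right _ _).trans (min_le_left _ _)))
    have h2 : ¬ (u.IsVertex ∨ u = M.z i ∨ u = M.e i s) := fun h => h1 ⟨h, huy⟩
    push Not at h2
    exact ⟨u, ⟨seg_subset hy hd hu, huy, h2.2.1, h2.2.2, h2.1, hf u
      (hud.trans_le ((min_le_right _ _).trans (min_le_right _ _)))⟩, hud.trans_le (min_le_left _ _)⟩
  have hTsub : T ⊆ ⋃ v ∈ {v : ι × Bool | v.1 ≠ i}, T ∩ seg (M.z v.1) (M.e v.1 v.2) := by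
    intro u hu
    obtain ⟨j, hj, r, hr⟩ := exists_other_cone hT hu.1 hu.2.2.1 hu.2.2.2.1 hu.2.2.2.2.1 hu.2.2.2.2.2
    exact mem_biUnion (x := (j, r)) hj ⟨hu, hr⟩
  have h1 := closure_mono hTsub hyT
  rw [(Set.toFinite _).closure_biUnion] at h1
  obtain ⟨⟨j, r⟩, hj, h2⟩ := mem_iUnion₂.1 h1
  obtain ⟨u, hu, hur⟩ := closure_nonempty_iff.1 ⟨y, h2⟩
  exact ⟨i, j, Ne.symm hj, s, r, u, hu.2.1, hy, hu.1,
    closure_minimal inter_subset_right (isClosed_seg _ _) h2, hur⟩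

end ConeMap

end TriComplex

/-! ### Connected components of open sets. -/

namespace CatZero

variable {X : Type*} [MetricSpace X] [CatZero X]

/-- Balls are star-shaped with respect to geodesics from the centre. -/
lemma isPreconnected_ball (a : X) (ε : ℝ) : IsPreconnected (Metric.ball a ε) := by
  rcases le_or_gt ε 0 with hε | hε
  · rw [Metric.ball_eq_empty.2 hε]; exact isPreconnected_empty
  refine isPreconnected_of_forall a fun y hy => ⟨seg a y, fun w hw => ?_, left_mem _ _,
    right_mem _ _, isPreconnected_seg _ _⟩
  rw [Metric.mem_ball, dist_comm] at *
  exact (dist_le_of_mem hw).trans_lt hy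

lemma subset_component {A T : Set X} {y w : X} (hT : IsPreconnected T) (hTA : T ⊆ A) (hw : w ∈ T)
    (hwy : w ∈ connectedComponentIn A y) : T ⊆ connectedComponentIn A y := by
  rw [connectedComponentIn_eq hwy]
  exact hT.subset_connectedComponentIn hw hTA

lemma isOpen_component {A : Set X} (hA : IsOpen A) (y : X) : IsOpen (connectedComponentIn A y) := by
  rw [Metric.isOpen_iff]
  intro r hr
  obtain ⟨ε, hε, hb⟩ := Metric.isOpen_iff.1 hA r (connectedComponentIn_subset _ _ hr)
  exact ⟨ε, hε, subset_component (isPreconnected_ball r ε) hb (Metric.mem_ball_self hε) hr⟩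

lemma closure_component_subset {A : Set X} (hA : IsOpen A) (y : X) :
    closure (connectedComponentIn A y) ⊆ connectedComponentIn A y ∪ Aᶜ := by
  intro r hr
  by_cases hrA : r ∈ A
  · obtain ⟨ε, hε, hb⟩ := Metric.isOpen_iff.1 hA r hrA
    obtain ⟨w, hw, hd⟩ := Metric.mem_closure_iff.1 hr ε hε
    exact Or.inl (subset_component (isPreconnected_ball r ε) hb
      (by rwa [Metric.mem_ball, dist_comm]) hw (Metric.mem_ball_self hε))
  · exact Or.inr hrA

end CatZero

/-- Regions are components in the space of coordinates; this carries them over to the metric space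
`Pt`. -/
lemma Topology.IsEmbedding.image_connectedComponentIn_eq {X Y : Type*} [TopologicalSpace X]
    [TopologicalSpace Y] {f : X → Y} (hf : Topology.IsEmbedding f) {A : Set X} {y : X} (hy : y ∈ A) :
    f '' connectedComponentIn A y = connectedComponentIn (f '' A) (f y) := by
  apply subset_antisymm
  · exact (isPreconnected_connectedComponentIn.image f hf.continuous.continuousOn
      ).subset_connectedComponentIn (mem_image_of_mem f (mem_connectedComponentIn hy))
      (image_mono (connectedComponentIn_subset _ _))
  · have hsub := connectedComponentIn_subset (f '' A) (f y)
    have himg : f '' (f ⁻¹' connectedComponentIn (f '' A) (f y)) =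
        connectedComponentIn (f '' A) (f y) :=
      image_preimage_eq_of_subset (hsub.trans (image_subset_range _ _))
    rw [← himg]
    refine image_mono (IsPreconnected.subset_connectedComponentIn ?_
      (mem_connectedComponentIn (mem_image_of_mem f hy)) ?_)
    · rw [← hf.isInducing.isPreconnected_image, himg]
      exact isPreconnected_connectedComponentIn
    · intro w hw
      exact hf.injective.mem_set_image.1 (hsub hw)

/-! ### From a shortest path map to the abstract family of cones. -/

namespace PlanarComplex
open CatZero TriComplex

variable {V : Type*} [Fintype V] [DecidableEq V] {K : PlanarComplex V} {hK : K.IsCAT0}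

lemma boundary_subset (K : PlanarComplex V) : K.boundary ⊆ K.space := fun _ h => h.1

lemma isClosed_boundary (K : PlanarComplex V) : IsClosed K.boundary :=
  K.isCompact_space.isClosed.inter (isClosed_frontier.preimage (continuous_draw K.pos))

section Cone

variable {c : Cone V} {z p q : K.Pt hK}

lemma sides_eq (hz : z.val = c.apex) (hp : p.val = c.left) (hq : q.val = c.right) :
    K.sides c = Pt.val '' (seg z p ∪ seg z q) := by
  rw [sides, ← hz, ← hp, ← hq, geod_eq, geod_eq, image_union]

lemma exists_component (hc : K.IsCone c) (hz : z.val = c.apex) (hp : p.val = c.left)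
    (hq : q.val = c.right) : ∃ y ∈ (seg z p ∪ seg z q)ᶜ,
      c.region = Pt.val '' connectedComponentIn (seg z p ∪ seg z q)ᶜ y := by
  obtain ⟨-, -, -, ⟨y, hy, hR⟩, -⟩ := hc
  have e : K.space \ K.sides c = Pt.val '' (seg z p ∪ seg z q)ᶜ := by
    rw [sides_eq hz hp hq, image_compl_eq_range_sdiff_image Pt.val_injective]
    congr 1
    ext w
    exact ⟨fun h => ⟨hK.mk w h, rfl⟩, fun ⟨v, hv⟩ => hv ▸ v.mem⟩
  rw [e] at hy hR
  obtain ⟨y', hy', rfl⟩ := hy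
  exact ⟨y', hy', hR.trans
    (Pt.isClosedEmbedding_val.isEmbedding.image_connectedComponentIn_eq hy').symm⟩

/-- A second common point of the sides would be a fan with no triangles, of total angle `0`, against
the positivity of the apex angle. -/
lemma sides_inter (hc : K.IsCone c) (hz : z.val = c.apex) (hp : p.val = c.left)
    (hq : q.val = c.right) : seg z p ∩ seg z q = {z} := by
  refine subset_antisymm (fun w hw => ?_) (by rintro _ rfl; exact ⟨left_mem _ _, left_mem _ _⟩)
  by_contra hne
  have h : K.FanReach (K.carrier c) z.val w.val w.val 0 :=
    ⟨0, fun _ => w.val, rfl, rfl, fun _ _ h => hne (Pt.ext h), by simp, by simp⟩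
  have h1 := h.innerAngle_le (mem_geod.2 hw.1) (mem_geod.2 hw.2)
  rw [ENNReal.ofReal_zero, hz, hp, hq] at h1
  exact absurd hc.2.2.2.2.2.1 (not_lt.2 h1)

/-- A finite apex angle provides a fan, whose points are distinct from the apex; a side reduced to
the apex has no such point. -/
lemma ends_ne (hc : K.IsCone c) (hz : z.val = c.apex) (hp : p.val = c.left)
    (hq : q.val = c.right) : p ≠ z ∧ q ≠ z := by
  have h := hc.2.2.2.2.2.2
  rw [apexAngle, innerAngle, ← hz, ← hp, ← hq] at h
  obtain ⟨n, h⟩ := iInf_lt_iff.1 h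
  obtain ⟨w, h⟩ := iInf_lt_iff.1 h
  obtain ⟨⟨h0, hn, hne, -⟩, -⟩ := iInf_lt_iff.1 h
  constructor
  · rintro rfl
    rw [geod_eq, seg_self, image_singleton] at h0
    exact hne 0 (Nat.zero_le _) h0
  · rintro rfl
    rw [geod_eq, seg_self, image_singleton] at hn
    exact hne n le_rfl hn

end Cone

end PlanarComplex

namespace PlanarComplex
open CatZero TriComplex

variable {V : Type*} [Fintype V] [DecidableEq V] {K : PlanarComplex V} {hK : K.IsCAT0}

section SPM

variable {x : K.Pt hK} {ι : Type*} {C : ι → Cone V}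

/-- The endpoints of the sides, indexed by a Boolean. -/
def endPt (hC : ∀ i, K.IsCone (C i)) (i : ι) (s : Bool) : K.Pt hK :=
  hK.mk (if s then (C i).left else (C i).right) (by
    cases s
    · exact boundary_subset K (hC i).2.2.1
    · exact boundary_subset K (hC i).2.1)

/-- The apex. -/
def apexPt (hC : ∀ i, K.IsCone (C i)) (i : ι) : K.Pt hK := hK.mk (C i).apex (hC i).1

lemma mem_ends {hC : ∀ i, K.IsCone (C i)} {i : ι} {p : V → ℝ} :
    p ∈ (C i).ends ↔ ∃ s, p = (endPt (hK := hK) hC i s).val := by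
  simp [Cone.ends, endPt, or_comm]

lemma sides_eq' (hC : ∀ i, K.IsCone (C i)) (i : ι) : K.sides (C i) =
    Pt.val '' (seg (apexPt (hK := hK) hC i) (endPt hC i true) ∪
      seg (apexPt (hK := hK) hC i) (endPt hC i false)) := sides_eq rfl rfl rfl

lemma exists_preimage_region (hC : ∀ i, K.IsCone (C i)) (i : ι) :
    ∃ y ∈ (seg (apexPt (hK := hK) hC i) (endPt hC i true) ∪
      seg (apexPt (hK := hK) hC i) (endPt hC i false))ᶜ, Pt.val ⁻¹' (C i).region =
        connectedComponentIn (seg (apexPt (hK := hK) hC i) (endPt hC i true) ∪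
          seg (apexPt (hK := hK) hC i) (endPt hC i false))ᶜ y := by
  obtain ⟨y, hy, h⟩ := exists_component (hC i) (z := apexPt (hK := hK) hC i) (p := endPt hC i true)
    (q := endPt hC i false) rfl rfl rfl
  exact ⟨y, hy, by rw [h, preimage_image_eq _ Pt.val_injective]⟩

lemma region_subset (hc : K.IsCone (C i)) : (C i).region ⊆ K.space \ K.sides (C i) := by
  obtain ⟨-, -, -, ⟨y, hy, hR⟩, -⟩ := hc
  exact hR ▸ connectedComponentIn_subset _ _

lemma coneInterior_eq {i : ι} (hc : K.IsCone (C i)) : K.coneInterior (C i) = (C i).region := by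
  rw [coneInterior, carrier, union_sdiff_right]
  exact sdiff_eq_left.2 (disjoint_left.2 fun y hy => (region_subset hc hy).2)

/-- The points of the cones of a shortest path map. -/
def coneMap (hC : K.IsSPM x.val C) : ConeMap K.toTriComplex hK x ι where
  z := apexPt hC.isCone
  e := endPt hC.isCone
  R i := Pt.val ⁻¹' (C i).region
  isOpen i := by
    obtain ⟨y, hy, h⟩ := exists_preimage_region (hK := hK) hC.isCone i
    rw [h]
    exact isOpen_component ((isClosed_seg _ _).union (isClosed_seg _ _)).isOpen_compl y
  isPreconnected i := by
    obtain ⟨y, hy, h⟩ := exists_preimage_region (hK := hK) hC.isCone i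
    rw [h]
    exact isPreconnected_connectedComponentIn
  nonempty i := by
    obtain ⟨y, hy, h⟩ := exists_preimage_region (hK := hK) hC.isCone i
    rw [h]
    exact ⟨y, mem_connectedComponentIn hy⟩
  notMem i s y hy hs := by
    refine (region_subset (hC.isCone i) hy).2 ?_
    rw [sides_eq' (hK := hK) hC.isCone]
    cases s
    · exact mem_image_of_mem _ (Or.inr hs)
    · exact mem_image_of_mem _ (Or.inl hs)
  closure_subset i := by
    obtain ⟨y, hy, h⟩ := exists_preimage_region (hK := hK) hC.isCone i
    rw [h]
    have := closure_component_subset ((isClosed_seg (apexPt (hK := hK) hC.isCone i)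
      (endPt hC.isCone i true)).union (isClosed_seg (apexPt (hK := hK) hC.isCone i)
      (endPt hC.isCone i false))).isOpen_compl y
    rwa [compl_compl] at this
  subset_closure i s y hy := by
    have h1 : y.val ∈ K.sides (C i) := by
      rw [sides_eq' (hK := hK) hC.isCone]
      cases s
      · exact mem_image_of_mem _ (Or.inr hy)
      · exact mem_image_of_mem _ (Or.inl hy)
    have h2 := (hC.isCone i).2.2.2.2.1 h1
    have h3 : (C i).region = Pt.val '' (Pt.val ⁻¹' (C i).region : Set (K.Pt hK)) :=
      (image_preimage_eq_of_subset fun w hw =>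
        ⟨hK.mk w (region_subset (hC.isCone i) hw).1, rfl⟩).symm
    -- The closure in coordinates is the closure in the intrinsic metric.
    rw [h3, Pt.isClosedEmbedding_val.closure_image_eq] at h2
    exact Pt.val_injective.mem_set_image.1 h2
  maximal i T hT hTs hne := by
    obtain ⟨y, hy, h⟩ := exists_preimage_region (hK := hK) hC.isCone i
    obtain ⟨w, hw, hwR⟩ := hne
    rw [h] at hwR ⊢
    exact subset_component hT (fun v hv hv' => hv'.elim (hTs v hv true) (hTs v hv false)) hw hwR
  inter_sides i s := by
    have h := sides_inter (hC.isCone i) (z := apexPt (hK := hK) hC.isCone i)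
      (p := endPt hC.isCone i true) (q := endPt hC.isCone i false) rfl rfl rfl
    cases s
    · rw [inter_comm]; exact h
    · exact h
  ne i s := by
    have h := ends_ne (hC.isCone i) (z := apexPt (hK := hK) hC.isCone i)
      (p := endPt hC.isCone i true) (q := endPt hC.isCone i false) rfl rfl rfl
    cases s
    · exact h.2
    · exact h.1
  disjoint i j hij := by
    have h := hC.disjoint i j hij
    rw [coneInterior_eq (hC.isCone i), coneInterior_eq (hC.isCone j)] at h
    exact h.preimage _
  cover y := by
    have h : y.val ∈ ⋃ i, K.carrier (C i) := hC.cover ▸ y.mem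
    obtain ⟨i, h | h⟩ := mem_iUnion.1 h
    · exact ⟨i, Or.inl h⟩
    · rw [sides_eq' (hK := hK) hC.isCone, Pt.val_injective.mem_set_image] at h
      exact ⟨i, Or.inr (h.elim (fun h => ⟨true, h⟩) fun h => ⟨false, h⟩)⟩
  vertex y hy := by
    obtain ⟨v, hv⟩ := hy
    obtain ⟨p, hp, h⟩ := hC.through_vertex v
    obtain ⟨i, hi⟩ := mem_iUnion.1 hp
    obtain ⟨s, rfl⟩ := (mem_ends (hK := hK) (hC := hC.isCone)).1 hi
    rw [← hv] at h
    exact ⟨i, s, mem_geod.1 h⟩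
  apex i s := mem_geod.1 (hC.apex_mem i _ (mem_ends.2 ⟨s, rfl⟩))

lemma carrier_eq (hC : K.IsSPM x.val C) (i : ι) : K.carrier (C i) = Pt.val '' (coneMap hC).C i := by
  rw [carrier, sides_eq' (hK := hK) hC.isCone]
  refine Eq.trans ?_ (image_union _ _ _).symm
  congr 1
  exact (image_preimage_eq_of_subset fun w hw =>
    (⟨hK.mk w (region_subset (hC.isCone i) hw).1, rfl⟩ :
      w ∈ range (Pt.val : K.Pt hK → V → ℝ))).symm

lemma mem_side_iff (hC : K.IsSPM x.val C) {y : K.Pt hK} : (coneMap hC).Side y ↔ ∃ i, y.val ∈ K.sides (C i) := by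
  refine exists_congr fun i => ?_
  rw [sides_eq' (hK := hK) hC.isCone, Pt.val_injective.mem_set_image]
  exact Bool.exists_bool.trans or_comm

lemma endPt_mem_boundary (hC : K.IsSPM x.val C) (i : ι) (s : Bool) :
    (endPt (hK := hK) hC.isCone i s).val ∈ K.boundary := by
  cases s
  · exact (hC.isCone i).2.2.1
  · exact (hC.isCone i).2.1

theorem isGeodesicTree (hC : K.IsSPM x.val C) : K.IsGeodesicTree x.val (allEnds C) := by
  have := hC.finite
  refine ⟨finite_iUnion fun i => (finite_singleton _).insert _, ?_, ?_⟩
  · intro p hp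
    obtain ⟨i, hi⟩ := mem_iUnion.1 hp
    obtain ⟨s, rfl⟩ := (mem_ends (hK := hK) (hC := hC.isCone)).1 hi
    exact endPt_mem_boundary hC i s
  · intro p hp q hq hpq
    obtain ⟨i, hi⟩ := mem_iUnion.1 hp
    obtain ⟨s, rfl⟩ := (mem_ends (hK := hK) (hC := hC.isCone)).1 hi
    obtain ⟨j, hj⟩ := mem_iUnion.1 hq
    obtain ⟨r, rfl⟩ := (mem_ends (hK := hK) (hC := hC.isCone)).1 hj
    obtain ⟨w, hw, h⟩ := exists_branch x (endPt hC.isCone i s) (endPt hC.isCone j r)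
    refine ⟨w.val, ?_, by rw [geod_eq, geod_eq, geod_eq, ← image_inter Pt.val_injective, h]⟩
    by_cases hwx : w = x
    · exact Or.inl (congrArg Pt.val hwx)
    · exact Or.inr ((coneMap hC).branch_isVertex K.atMostTwo (fun e => hpq (congrArg Pt.val e)) h hwx)

theorem iUnion_sides_eq (hC : K.IsSPM x.val C) :
    ⋃ i, K.sides (C i) = ⋃ p ∈ allEnds C, K.geod x.val p := by
  ext y
  constructor
  · intro hy
    obtain ⟨i, hi⟩ := mem_iUnion.1 hy
    rw [sides_eq' (hK := hK) hC.isCone] at hi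
    obtain ⟨y, hi, rfl⟩ := hi
    obtain ⟨j, r, hj⟩ := ConeMap.Side.tree (M := coneMap hC) (y := y)
      ⟨i, hi.elim (fun h => ⟨true, h⟩) fun h => ⟨false, h⟩⟩
    exact mem_biUnion (x := (endPt hC.isCone j r).val)
      (mem_iUnion.2 ⟨j, (mem_ends (hK := hK)).2 ⟨r, rfl⟩⟩) (mem_geod.2 hj)
  · intro h
    obtain ⟨p, hp, hy⟩ := mem_iUnion₂.1 h
    obtain ⟨i, hi⟩ := mem_iUnion.1 hp
    obtain ⟨s, rfl⟩ := (mem_ends (hK := hK) (hC := hC.isCone)).1 hi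
    rw [geod_eq] at hy
    obtain ⟨y, hy, rfl⟩ := hy
    exact mem_iUnion.2 ((mem_side_iff hC).1 (ConeMap.side_of_tree K.atMostTwo ⟨i, s, hy⟩))

theorem inner_point (hC : K.IsSPM x.val C) {y : K.Pt hK} (hy : y.val ∉ K.boundary) :
    (∃ i, y.val ∈ K.coneInterior (C i) ∧ ∀ j, y.val ∈ K.carrier (C j) → j = i) ∨
      ∃ i j, i ≠ j ∧ K.OnCommonSide (C i) (C j) y.val := by
  have := hC.finite
  by_cases hs : (coneMap hC).Side y
  · right
    -- The boundary is closed and contains the free edges, so an inner point keeps a positive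
    -- distance from them.
    obtain ⟨ε, hε, hb⟩ := Metric.isOpen_iff.1
      ((isClosed_boundary K).preimage (Pt.continuous_val (hK := hK))).isOpen_compl y hy
    obtain ⟨i, j, hij, s, r, y', hne, h1, h2, h3, h4⟩ := ConeMap.exists_common_side K.atMostTwo hs
      ⟨ε, hε, fun y' hd hf => hb (a := y') (by rwa [Metric.mem_ball, dist_comm]) (mem_boundary hf)⟩
    refine ⟨i, j, hij, (endPt hC.isCone i s).val, mem_ends.2 ⟨s, rfl⟩,
      (endPt hC.isCone j r).val, mem_ends.2 ⟨r, rfl⟩, y'.val,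
      fun e => hne (Pt.ext e), ?_, ⟨mem_geod.2 h1, mem_geod.2 h3⟩, ⟨mem_geod.2 h2, mem_geod.2 h4⟩⟩
    rw [geod_eq]
    rintro _ ⟨w, hw, rfl⟩
    exact ⟨mem_geod.2 (seg_subset h1 h2 hw), mem_geod.2 (seg_subset h3 h4 hw)⟩
  · left
    obtain ⟨i, hi⟩ := ConeMap.exists_mem_of_not_side hs
    refine ⟨i, (coneInterior_eq (hC.isCone i)).symm ▸ hi, fun j hj => ?_⟩
    rcases hj with hj | hj
    · exact ConeMap.eq_of_mem (M := coneMap hC) hj hi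
    · exact absurd ((mem_side_iff hC).2 ⟨j, hj⟩) hs

end SPM

end PlanarComplex

/-! ### The proposition. -/

theorem mainTheorem4 {V : Type*} [Fintype V] [DecidableEq V] (K : PlanarComplex V)
    (hK : K.IsCAT0) (x : V → ℝ) (hx : x ∈ K.space)
    {ι : Type*} (C : ι → Cone V) (hC : K.IsSPM x C) :
    -- (i) the sides of the cones make up a geodesic tree rooted at `x`
    (K.IsGeodesicTree x (PlanarComplex.allEnds C) ∧
      ⋃ i, K.sides (C i) = ⋃ p ∈ PlanarComplex.allEnds C, K.geod x p) ∧
    -- (ii) the angle of a cone at its apex is less than `π`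
    (∀ i, K.apexAngle (C i) < ENNReal.ofReal Real.pi) ∧
    -- (iii) every cone is convex
    (∀ i, K.GeodConvex (K.carrier (C i))) ∧
    -- (iv) the interior of a cone contains no vertex
    (∀ i, ∀ v : V, TriComplex.vertexPoint v ∉ K.coneInterior (C i)) ∧
    -- (v) an inner point lies in the interior of one cone and in no other cone, or on a common
    -- side of two cones
    (∀ y ∈ K.space, y ∉ K.boundary →
      (∃ i, y ∈ K.coneInterior (C i) ∧ ∀ j, y ∈ K.carrier (C j) → j = i) ∨
      (∃ i j, i ≠ j ∧ K.OnCommonSide (C i) (C j) y)) ∧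
    -- (vi) at the points of a side other than its two endpoints, the angle inside the cone between
    -- the two directions of the side is (finite and) at least `π`
    (∀ i, ∀ p ∈ (C i).ends, ∀ u ∈ K.geod (C i).apex p, u ≠ (C i).apex → u ≠ p →
      ENNReal.ofReal Real.pi ≤ K.innerAngle (K.carrier (C i)) u (C i).apex p ∧
      K.innerAngle (K.carrier (C i)) u (C i).apex p < ⊤) := by
  obtain ⟨x, rfl⟩ : ∃ x' : K.Pt hK, x = x'.val := ⟨hK.mk x hx, rfl⟩
  have hT := K.atMostTwo
  refine ⟨⟨PlanarComplex.isGeodesicTree hC, PlanarComplex.iUnion_sides_eq hC⟩, fun i => ?_, fun i => ?_, fun i v hv => ?_,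
    fun y hy hyb => ?_, fun i p hp u hu huz hup => ?_⟩
  · rw [PlanarComplex.apexAngle, PlanarComplex.carrier_eq hC]
    exact TriComplex.ConeMap.innerAngle_lt_pi (M := PlanarComplex.coneMap hC) hT i true
  · rw [PlanarComplex.carrier_eq hC]
    rintro _ ⟨r, hr, rfl⟩ _ ⟨s, hs, rfl⟩
    rw [TriComplex.geod_eq]
    exact Set.image_mono (TriComplex.ConeMap.convex_C hT i r hr s hs)
  · rw [PlanarComplex.coneInterior_eq (hC.isCone i)] at hv
    exact TriComplex.ConeMap.not_isVertex (M := PlanarComplex.coneMap hC) (y := TriComplex.vert hK v) hT hv (TriComplex.isVertex_vert v)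
  · exact PlanarComplex.inner_point hC (y := hK.mk y hy) hyb
  · obtain ⟨s, rfl⟩ := (PlanarComplex.mem_ends (hK := hK) (hC := hC.isCone)).1 hp
    have hz : (C i).apex = (PlanarComplex.apexPt (hK := hK) hC.isCone i).val := rfl
    rw [hz, TriComplex.geod_eq] at hu
    obtain ⟨u, hu, rfl⟩ := hu
    refine ⟨?_, ?_⟩
    · rw [hz]; exact TriComplex.pi_le_innerAngle hu _
    · rw [PlanarComplex.carrier_eq hC]
      exact TriComplex.ConeMap.innerAngle_side_lt_top (M := PlanarComplex.coneMap hC) hT hu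
        (fun e => huz (congrArg TriComplex.Pt.val e)) fun e => hup (congrArg TriComplex.Pt.val e)
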